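/- A finite normal-form game $\Gamma$ consists of players $1,\dots,N$, a nonempty finite action set $A^i$ for each player $i$, and rational payoff functions $u^i : A \to \mathbb{Q}$ on the set $A = A^1\times\cdots\times A^N$ of action profiles. Let $\mathcal{A} = \bigsqcup_i A^i$. A symmetry of $\Gamma$ is a bijection $\phi : \mathcal{A}\to\mathcal{A}$ for which there is a bijection $\pi$ of the players with $\phi(A^i) = A^{\pi(i)}$ for all $i$, such that $u^i(\mathbf a) = u^{\pi(i)}(\phi(\mathbf a))$ for all players $i$ and profiles $\mathbf a$, where $\phi(\mathbf a) = (\phi(\mathbf a_{\pi^{-1}(j)}))_j$. The symmetries form a group $\mathrm{Sym}(\Gamma)$ under composition. Games are given by their action numbers and payoff tables (payoffs in binary), graphs (finite, simple, undirected) by adjacency matrices, symmetries by their tables of values. A problem $P$ is polynomial-time Turing-reducible to a problem $Q$ if there is a deterministic oracle machine that, given any oracle that answers every instance of $Q$ correctly with answers of length polynomial in the length of the query, outputs a correct answer to every instance of $P$ in time polynomial in the length of the instance (the polynomial may depend only on the polynomial that bounds the answers). Two problems are polynomial-time Turing-equivalent if each is reducible to the other. Let GI be the problem of deciding whether two given graphs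 are isomorphic. Theorem. (1) The problem of computing, for a given game $\Gamma$, the number $|\mathrm{Sym}(\Gamma)|$ (in binary) is polynomial-time Turing-equivalent to GI. (2) The problem of computing, for a given game $\Gamma$, a list of symmetries that generates the group $\mathrm{Sym}(\Gamma)$ is polynomial-time Turing-equivalent to GI. (3) Let $\Gamma$ be a game and $\lambda\neq\lambda'$ natural numbers that are not payoffs of $\Gamma$. Let $G_\Gamma$ be the edge-labeled graph on the disjoint union of the set of players, $\mathcal{A}$ and $A$, with an edge labeled $\lambda$ between $i$ and $a$ for each player $i$ and each $a \in A^i$, an edge labeled $\lambda'$ between $a$ and $\mathbf a$ for each profile $\mathbf a$ and each action $a$ played in it, and an edge labeled $u^i(\mathbf a)$ between $i$ and $\mathbf a$ for each player $i$ and each profile $\mathbf a$. Then the map that sends $\phi\in\mathrm{Sym}(\Gamma)$, with player map $\pi$, to the map $i\mapsto\pi(i)$, $a\mapsto\phi(a)$, $\mathbf a\mapsto\phi(\mathbf a)$ is a group isomorphism from $\mathrm{Sym}(\Gamma)$ onto the group of label-preserving automorphisms of $G_\Gamma$. (4) Let $G=(V,E)$ be a finite simple graph with $V\neq\emptyset$,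 and let $c_1,\dots,c_4$ and $d_1,\dots,d_4$ be rationals with the $c_k$ pairwise distinct and the $d_k$ pairwise distinct. Let $\Gamma_G$ be the two-player game with $A^1 = V$ and $A^2 = V\sqcup\{\alpha\}$ in which players 1 and 2 receive $c_k$ and $d_k$, respectively, where $k=1$ if player 2 plays $\alpha$, $k=2$ if the players choose distinct non-adjacent vertices, $k=3$ if they choose adjacent vertices, and $k=4$ if they choose the same vertex. Then the map that sends $\psi\in\mathrm{Aut}(G)$ to the map that acts as $\psi$ on the vertices in $A^1$ and in $A^2$ and fixes $\alpha$ is a group isomorphism from $\mathrm{Aut}(G)$ onto $\mathrm{Sym}(\Gamma_G)$. -/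

import Mathlib

namespace GameSym

/-! ## Normal-form games and their symmetries -/

/-- A finite normal-form game with players `0, …, N - 1`, nonempty action sets
`{0, …, numActions i - 1}` and rational payoffs (so that its payoff table is a finite string). -/
@[ext]
structure Game where
  N : ℕ
  numActions : Fin N → ℕ
  numActions_pos : ∀ i, 0 < numActions i
  u : Fin N → (∀ i, Fin (numActions i)) → ℚ

namespace Game

variable (Γ : Game)

/-- The disjoint union of all action sets. -/
abbrev Action : Type := Σ i : Fin Γ.N, Fin (Γ.numActions i)

/-- Action profiles. -/
abbrev Profile : Type := ∀ i : Fin Γ.N, Fin (Γ.numActions i)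

variable {Γ}

/-- The action `x` is one of the actions played in the profile `a`. -/
def Plays (a : Γ.Profile) (x : Γ.Action) : Prop := a x.1 = x.2

/-- `φ` maps the profile `a`, read as the set of actions played in it, to the profile `b`. When `φ`
maps the action set of each player `i` onto that of player `π i`, this says
`b j = φ (a (π⁻¹ j))` for all players `j`. -/
def MapsProfile (φ : Equiv.Perm Γ.Action) (a b : Γ.Profile) : Prop :=
  ∀ i, Plays b (φ ⟨i, a i⟩)

/-- A symmetry of a game: a bijection of the set of all actions that maps actions of the same player
to actions of the same player, and that leaves the payoffs invariant. As all action sets are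
nonempty, the player map `π` is determined by `φ`, and it is automatically bijective. -/
def IsSymmetry (φ : Equiv.Perm Γ.Action) : Prop :=
  ∃ π : Equiv.Perm (Fin Γ.N),
    (∀ x : Γ.Action, (φ x).1 = π x.1) ∧
    ∀ (i : Fin Γ.N) (a b : Γ.Profile), MapsProfile φ a b → Γ.u i a = Γ.u (π i) b

theorem eq_of_eq_fst {x y z : Γ.Action} (h : x.1 = y.1) (a : Γ.Profile) (hx : Plays a x)
    (hy : Plays a y) (hz : z = x) : z = y := by
  subst hz
  obtain ⟨i, k⟩ := z
  obtain ⟨j, l⟩ := y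
  obtain rfl : i = j := h
  simp only [Plays] at hx hy
  rw [← hx, ← hy]

theorem exists_mapsProfile {φ : Equiv.Perm Γ.Action} {π : Equiv.Perm (Fin Γ.N)}
    (h : ∀ x : Γ.Action, (φ x).1 = π x.1) (a : Γ.Profile) : ∃ b, MapsProfile φ a b := by
  have key : ∀ j, ∃ k : Fin (Γ.numActions j),
      φ ⟨π.symm j, a (π.symm j)⟩ = (⟨j, k⟩ : Γ.Action) := by
    intro j
    have h1 := h ⟨π.symm j, a (π.symm j)⟩
    simp only [Equiv.apply_symm_apply] at h1
    generalize φ ⟨π.symm j, a (π.symm j)⟩ = z at h1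
    obtain ⟨j', k⟩ := z
    obtain rfl : j' = j := h1
    exact ⟨k, rfl⟩
  choose b hb using key
  refine ⟨b, fun i => ?_⟩
  have h2 := hb (π i)
  rw [Equiv.symm_apply_apply] at h2
  rw [h2]
  rfl

theorem MapsProfile.symm {φ : Equiv.Perm Γ.Action} {π : Equiv.Perm (Fin Γ.N)}
    (h : ∀ x : Γ.Action, (φ x).1 = π x.1) {a b : Γ.Profile} (hab : MapsProfile φ a b) :
    MapsProfile φ⁻¹ b a := by
  intro j
  have h1 := h ⟨π.symm j, a (π.symm j)⟩
  have h2 : φ ⟨π.symm j, a (π.symm j)⟩ = ⟨j, b j⟩ :=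
    eq_of_eq_fst (y := ⟨j, b j⟩) (by rw [h1]; simp) b (hab _) rfl rfl
  rw [← h2, show φ⁻¹ (φ ⟨π.symm j, a (π.symm j)⟩) = _ from φ.symm_apply_apply _]
  rfl

theorem MapsProfile.trans {φ ψ : Equiv.Perm Γ.Action} {π : Equiv.Perm (Fin Γ.N)}
    (h : ∀ x : Γ.Action, (φ x).1 = π x.1) {a b c : Γ.Profile} (hab : MapsProfile φ a b)
    (hac : MapsProfile (ψ * φ) a c) : MapsProfile ψ b c := by
  intro j
  have h1 := h ⟨π.symm j, a (π.symm j)⟩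
  have h2 : φ ⟨π.symm j, a (π.symm j)⟩ = ⟨j, b j⟩ :=
    eq_of_eq_fst (y := ⟨j, b j⟩) (by rw [h1]; simp) b (hab _) rfl rfl
  have h3 := hac (π.symm j)
  rwa [Equiv.Perm.mul_apply, h2] at h3

variable (Γ)

/-- The group of symmetries of a game, under composition. -/
def symmetryGroup : Subgroup (Equiv.Perm Γ.Action) where
  carrier := {φ | IsSymmetry φ}
  one_mem' := by
    refine ⟨1, fun x => rfl, fun i a b hab => ?_⟩
    have : a = b := funext fun j => (hab j).symm
    rw [this]
    rfl
  mul_mem' := by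
    rintro ψ φ ⟨ρ, hρ, hu⟩ ⟨π, hπ, hv⟩
    refine ⟨ρ * π, fun x => ?_, fun i a c hac => ?_⟩
    · rw [Equiv.Perm.mul_apply, hρ, hπ]
      rfl
    · obtain ⟨b, hab⟩ := exists_mapsProfile hπ a
      rw [hv i a b hab, hu (π i) b c (hab.trans hπ hac)]
      rfl
  inv_mem' := by
    rintro φ ⟨π, hπ, hv⟩
    have hinv : ∀ x : Γ.Action, (φ⁻¹ x).1 = π⁻¹ x.1 := by
      intro x
      have h1 := hπ (φ⁻¹ x)
      rw [show φ (φ⁻¹ x) = x from φ.apply_symm_apply x] at h1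
      rw [h1]
      exact (π.symm_apply_apply _).symm
    refine ⟨π⁻¹, hinv, fun i a b hab => ?_⟩
    have h2 : MapsProfile φ b a := by simpa using hab.symm hinv
    rw [hv (π⁻¹ i) b a h2, show π (π⁻¹ i) = i from π.apply_symm_apply i]

end Game

/-! ## The graph of a game, and the game of a graph -/

/-- An edge-labeled graph on `V`: for each label, the graph formed by the edges with that label. -/
abbrev LabeledGraph (V L : Type) : Type := L → SimpleGraph V

/-- The group of label-preserving automorphisms of an edge-labeled graph. -/
def LabeledGraph.autGroup {V L : Type} (G : LabeledGraph V L) : Subgroup (Equiv.Perm V) where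
  carrier := {σ | ∀ l v w, (G l).Adj (σ v) (σ w) ↔ (G l).Adj v w}
  one_mem' := fun _ _ _ => Iff.rfl
  mul_mem' := fun {σ τ} hσ hτ l v w => (hσ l (τ v) (τ w)).trans (hτ l v w)
  inv_mem' := fun {σ} hσ l v w => by
    have := hσ l (σ⁻¹ v) (σ⁻¹ w)
    simpa using this.symm

namespace Game

variable (Γ : Game)

/-- The vertices of the graph of a game: players, actions and action profiles. -/
inductive Vertex : Type
  | player (i : Fin Γ.N)
  | action (x : Γ.Action)
  | profile (a : Γ.Profile)

/-- The edge-labeled graph of a game: an edge with label `lam` between each player and each of their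
actions, an edge with label `lam'` between each profile and each action played in it, and an edge
with label `u i a` between each player `i` and each profile `a`. -/
def labeledGraph (lam lam' : ℕ) : LabeledGraph Γ.Vertex ℚ := fun l =>
  SimpleGraph.fromRel fun v w =>
    match v, w with
    | .player i, .action x => x.1 = i ∧ l = lam
    | .action x, .profile a => Plays a x ∧ l = lam'
    | .player i, .profile a => l = Γ.u i a
    | _, _ => False

end Game

open Classical in
/-- The two-player game of a nonempty graph: the actions of player `0` are the vertices, those of
player `1` are the vertices and one further action `n`. The payoffs of players `0` and `1` are
`c k` and `d k`, where `k = 0` if player `1` plays `n`, `k = 1` if the players choose distinct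
non-adjacent vertices, `k = 2` if they choose adjacent vertices, and `k = 3` if they choose the
same vertex. -/
noncomputable def graphGame {n : ℕ} (hn : 0 < n) (G : SimpleGraph (Fin n)) (c d : Fin 4 → ℚ) :
    Game where
  N := 2
  numActions := ![n, n + 1]
  numActions_pos := fun i => by fin_cases i <;> simp [hn]
  u := fun i a =>
    let v : Fin n := a 0
    let w : Fin (n + 1) := a 1
    let k : Fin 4 :=
      if w = Fin.last n then 0
      else if w = v.castSucc then 3
      else if ∃ w' : Fin n, w = w'.castSucc ∧ G.Adj v w' then 2
      else 1
    if i = 0 then c k else d k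

/-- A vertex as an action of player `0` in the game of a graph. -/
def graphGame.fst {n : ℕ} {hn : 0 < n} {G : SimpleGraph (Fin n)} {c d : Fin 4 → ℚ} (v : Fin n) :
    (graphGame hn G c d).Action := ⟨(0 : Fin 2), v⟩

/-- A vertex, or the further action `n`, as an action of player `1` in the game of a graph. -/
def graphGame.snd {n : ℕ} {hn : 0 < n} {G : SimpleGraph (Fin n)} {c d : Fin 4 → ℚ}
    (w : Fin (n + 1)) : (graphGame hn G c d).Action := ⟨(1 : Fin 2), w⟩

/-! ## Oracle machines and polynomial-time Turing reductions -/

/-- The instructions of an oracle machine with finite control `Q`. The memory consists of stacks of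
bits; a stack is the part of a Turing tape on one side of the head.
* `push s b q`: push `b` on stack `s`, go to state `q`;
* `pop s q`: remove the top of stack `s` and go to the state that `q` assigns to it
  (`none` if the stack is empty);
* `query q`: replace the content of the answer stack `2` by the oracle's answer to the content of
  the query stack `1`, clear the query stack, go to state `q`;
* `halt`: stop; the output is the content of stack `0`. -/
inductive OracleInstr (Q : Type) : Type
  | push (s : ℕ) (b : Bool) (next : Q)
  | pop (s : ℕ) (next : Option Bool → Q)
  | query (next : Q)
  | halt

/-- A deterministic oracle machine with finitely many states. As a state refers to at most one
stack, only finitely many stacks are in use. The query stack is filled bit by bit, so that the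
length of a query is at most the number of steps made before. -/
structure OracleMachine where
  State : Type
  finite_state : Finite State
  start : State
  program : State → OracleInstr State

/-- Memory contents: the content of each stack, top first. -/
abbrev Memory : Type := ℕ → List Bool

/-- The initial memory: the input is on stack `0`, all other stacks are empty. -/
def initMemory (x : List Bool) : Memory := Function.update (fun _ => []) 0 x

namespace OracleMachine

/-- The output of the machine with oracle `f`, run from state `q` with memory `m`, if it halts
within `t` steps (the halting instruction counts as a step); otherwise `none`. -/
def runFrom (M : OracleMachine) (f : List Bool → List Bool) : ℕ → M.State → Memory → Option (List Bool)
  | 0, _, _ => none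
  | t + 1, q, m =>
    match M.program q with
    | .push s b next => runFrom M f t next (Function.update m s (b :: m s))
    | .pop s next => runFrom M f t (next (m s).head?) (Function.update m s (m s).tail)
    | .query next => runFrom M f t next (Function.update (Function.update m 2 (f (m 1))) 1 [])
    | .halt => some (m 0)

/-- The output of the machine with oracle `f` on input `x`, if it halts within `t` steps. -/
def run (M : OracleMachine) (f : List Bool → List Bool) (t : ℕ) (x : List Bool) : Option (List Bool) :=
  M.runFrom f t M.start (initMemory x)

end OracleMachine

/-- A computational problem: its instances, their encodings as bit strings, and the bit strings that
are correct answers to an instance. -/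
structure Problem where
  Inst : Type
  encode : Inst → List Bool
  encode_injective : Function.Injective encode
  IsSolution : Inst → List Bool → Prop

/-- `f` answers all instances of `P` correctly (and answers other strings arbitrarily). -/
def Problem.SolvedBy (P : Problem) (f : List Bool → List Bool) : Prop :=
  ∀ x : P.Inst, P.IsSolution x (f (P.encode x))

/-- The length of `f y` is at most `r (length of y)`. -/
def LengthBounded (r : Polynomial ℕ) (f : List Bool → List Bool) : Prop :=
  ∀ y, (f y).length ≤ r.eval y.length

/-- `P` is polynomial-time Turing-reducible to `Q`: some oracle machine solves every instance of `P`
in polynomial time, given any oracle that solves `Q` with answers of polynomial length. (A problem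
may have correct answers of superpolynomial length, for example redundant generating sets; the
polynomial time bound may depend on the polynomial that bounds the length of the answers.) -/
def TuringReducible (P Q : Problem) : Prop :=
  ∃ M : OracleMachine, ∀ r : Polynomial ℕ, ∃ p : Polynomial ℕ,
    ∀ f : List Bool → List Bool, LengthBounded r f → Q.SolvedBy f →
      ∀ x : P.Inst, ∃ y, M.run f (p.eval (P.encode x).length) (P.encode x) = some y ∧
        P.IsSolution x y

/-- Polynomial-time Turing-equivalence of problems. -/
def TuringEquivalent (P Q : Problem) : Prop := TuringReducible P Q ∧ TuringReducible Q P

/-! ## Encodings -/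

/-- Unary code of a natural number. -/
def encUnary (n : ℕ) : List Bool := List.replicate n true ++ [false]

/-- Code of a list: `1` before each entry, `0` at the end. -/
def encList {α : Type} (e : α → List Bool) (l : List α) : List Bool :=
  l.flatMap (fun x => true :: e x) ++ [false]

/-- Self-delimiting binary code of a natural number, least significant bit first. -/
def encNat (n : ℕ) : List Bool := encList (fun b => [b]) n.bits

/-- Code of an integer: sign and absolute value. -/
def encInt (z : ℤ) : List Bool := decide (z < 0) :: encNat z.natAbs

/-- Code of a rational number: numerator and denominator in lowest terms. -/
def encRat (q : ℚ) : List Bool := encInt q.num ++ encNat q.den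

open Classical in
/-- Code of a graph: number of vertices and adjacency matrix. -/
noncomputable def encGraph (G : Σ n, SimpleGraph (Fin n)) : List Bool :=
  encUnary G.1 ++ (List.finRange G.1).flatMap fun v =>
    (List.finRange G.1).flatMap fun w => [decide (G.2.Adj v w)]

/-- Code of a game: the numbers of actions, then the payoff table of each player (profiles in
the mixed-radix order, in which the action of player `0` varies fastest). -/
def encGame (Γ : Game) : List Bool :=
  encList encUnary (List.ofFn Γ.numActions) ++ (List.finRange Γ.N).flatMap fun i =>
    (List.finRange (∏ j, Γ.numActions j)).flatMap fun k => encRat (Γ.u i (finPiFinEquiv.symm k))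

/-- Code of an action: player and number of the action. -/
def encAction {Γ : Game} (x : Γ.Action) : List Bool := encUnary x.1 ++ encUnary x.2

/-- Code of a bijection of the set of actions in explicit form: the table of its values. -/
def encPerm {Γ : Game} (φ : Equiv.Perm Γ.Action) : List Bool :=
  (List.finRange Γ.N).flatMap fun i =>
    (List.finRange (Γ.numActions i)).flatMap fun k => encAction (φ ⟨i, k⟩)

/-- A code in which code words can be split off the front of a string. -/
def PrefixInjective {α : Type} (e : α → List Bool) : Prop :=
  ∀ x y s t, e x ++ s = e y ++ t → x = y ∧ s = t

theorem PrefixInjective.injective {α : Type} {e : α → List Bool} (h : PrefixInjective e) :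
    Function.Injective e :=
  fun x y hxy => (h x y [] [] (by rw [hxy])).1

theorem prefixInjective_append {α β γ : Type} {e : α → List Bool} {g : β → List Bool}
    (he : PrefixInjective e) (hg : PrefixInjective g) {p : γ → α} {q : γ → β}
    (hpq : ∀ x y, p x = p y → q x = q y → x = y) :
    PrefixInjective fun x => e (p x) ++ g (q x) := by
  intro x y s t h
  simp only [List.append_assoc] at h
  obtain ⟨h1, h2⟩ := he _ _ _ _ h
  obtain ⟨h3, h4⟩ := hg _ _ _ _ h2
  exact ⟨hpq x y h1 h3, h4⟩

theorem prefixInjective_singleton : PrefixInjective fun b : Bool => [b] := by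
  intro x y s t h
  simpa using h

theorem prefixInjective_encUnary : PrefixInjective encUnary := by
  intro x
  induction x with
  | zero =>
    intro y s t h
    cases y with
    | zero => exact ⟨rfl, by simpa [encUnary] using h⟩
    | succ y => simp [encUnary, List.replicate_succ] at h
  | succ x ih =>
    intro y s t h
    cases y with
    | zero => simp [encUnary, List.replicate_succ] at h
    | succ y =>
      obtain ⟨h1, h2⟩ := ih y s t (by simpa [encUnary, List.replicate_succ] using h)
      exact ⟨by rw [h1], h2⟩

theorem prefixInjective_encList {α : Type} {e : α → List Bool} (he : PrefixInjective e) :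
    PrefixInjective (encList e) := by
  intro x
  induction x with
  | nil =>
    intro y s t h
    cases y with
    | nil => exact ⟨rfl, by simpa [encList] using h⟩
    | cons b y => simp [encList] at h
  | cons a x ih =>
    intro y s t h
    cases y with
    | nil => simp [encList] at h
    | cons b y =>
      simp only [encList, List.flatMap_cons, List.cons_append, List.append_assoc,
        List.cons.injEq, true_and] at h
      obtain ⟨h1, h2⟩ := he _ _ _ _ h
      obtain ⟨h3, h4⟩ := ih y s t (by simpa [encList] using h2)
      exact ⟨by rw [h1, h3], h4⟩

theorem prefixInjective_encNat : PrefixInjective encNat := by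
  intro x y s t h
  obtain ⟨h1, h2⟩ := prefixInjective_encList prefixInjective_singleton _ _ _ _ h
  refine ⟨?_, h2⟩
  have h3 := congrArg (fun l => Nat.ofDigits 2 (l.map fun b => cond b 1 0)) h1
  simpa [← Nat.digits_two_eq_bits, Nat.ofDigits_digits] using h3

theorem prefixInjective_encInt : PrefixInjective encInt := by
  refine prefixInjective_append prefixInjective_singleton prefixInjective_encNat
    (p := fun z : ℤ => decide (z < 0)) (q := fun z => z.natAbs) fun x y h1 h2 => ?_
  have h3 : x < 0 ↔ y < 0 := by simpa using h1
  omega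

theorem prefixInjective_encRat : PrefixInjective encRat :=
  prefixInjective_append prefixInjective_encInt prefixInjective_encNat fun _ _ h1 h2 => Rat.ext h1 h2

theorem flatMap_append_inj {α β : Type} {e : β → List Bool} (he : PrefixInjective e)
    (l : List α) (F G : α → β) (s t : List Bool)
    (h : l.flatMap (fun a => e (F a)) ++ s = l.flatMap (fun a => e (G a)) ++ t) :
    (∀ a ∈ l, F a = G a) ∧ s = t := by
  induction l with
  | nil => exact ⟨by simp, by simpa using h⟩
  | cons a l ih =>
    simp only [List.flatMap_cons, List.append_assoc] at h
    obtain ⟨h1, h2⟩ := he _ _ _ _ h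
    obtain ⟨h3, h4⟩ := ih h2
    exact ⟨by simpa [h1] using h3, h4⟩

theorem prefixInjective_table {β : Type} {e : β → List Bool} (he : PrefixInjective e) (n : ℕ) :
    PrefixInjective fun F : Fin n → β => (List.finRange n).flatMap fun a => e (F a) := by
  intro F G s t h
  obtain ⟨h1, h2⟩ := flatMap_append_inj he _ F G s t h
  exact ⟨funext fun a => h1 a (List.mem_finRange a), h2⟩

theorem prefixInjective_encGraph : PrefixInjective encGraph := by
  classical
  rintro ⟨n, G⟩ ⟨n', H⟩ s t h
  simp only [encGraph, List.append_assoc] at h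
  obtain ⟨rfl, h1⟩ := prefixInjective_encUnary _ _ _ _ h
  obtain ⟨h2, h3⟩ := prefixInjective_table (prefixInjective_table prefixInjective_singleton n) n
    (fun v w => decide (G.Adj v w)) (fun v w => decide (H.Adj v w)) s t (by convert h1)
  refine ⟨?_, h3⟩
  have h4 : G = H := by
    ext v w
    simpa using congrFun (congrFun h2 v) w
  rw [h4]

theorem prefixInjective_encGame : PrefixInjective encGame := by
  rintro ⟨N, m, hm, u⟩ ⟨N', m', hm', u'⟩ s t h
  simp only [encGame, List.append_assoc] at h
  obtain ⟨h1, h2⟩ := prefixInjective_encList prefixInjective_encUnary _ _ _ _ h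
  obtain rfl : N = N' := by simpa using congrArg List.length h1
  obtain rfl : m = m' := List.ofFn_injective h1
  obtain ⟨h3, h4⟩ := prefixInjective_table (prefixInjective_table prefixInjective_encRat _) N
    (fun i k => u i (finPiFinEquiv.symm k)) (fun i k => u' i (finPiFinEquiv.symm k)) s t h2
  refine ⟨?_, h4⟩
  have h5 : u = u' := by
    funext i a
    have := congrFun (congrFun h3 i) (finPiFinEquiv a)
    simpa using this
  rw [h5]

/-! ## The three problems -/

open Classical in
/-- The graph isomorphism problem: given two graphs, decide whether they are isomorphic. -/
noncomputable def graphIsomorphism : Problem where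
  Inst := (Σ n, SimpleGraph (Fin n)) × (Σ n, SimpleGraph (Fin n))
  encode := fun x => encGraph x.1 ++ encGraph x.2
  encode_injective :=
    (prefixInjective_append prefixInjective_encGraph prefixInjective_encGraph
      fun _ _ h1 h2 => Prod.ext h1 h2).injective
  IsSolution := fun x y => y = [decide (Nonempty (x.1.2 ≃g x.2.2))]

/-- Given a game, compute the number of its symmetries, in binary. -/
noncomputable def symmetryCounting : Problem where
  Inst := Game
  encode := encGame
  encode_injective := prefixInjective_encGame.injective
  IsSolution := fun Γ y => y = (Nat.card Γ.symmetryGroup).bits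

/-- Given a game, compute a list of symmetries that generate its symmetry group. -/
def symmetryGenerators : Problem where
  Inst := Game
  encode := encGame
  encode_injective := prefixInjective_encGame.injective
  IsSolution := fun Γ y => ∃ L : List (Equiv.Perm Γ.Action),
    Subgroup.closure {φ | φ ∈ L} = Γ.symmetryGroup ∧ y = encList encPerm L

end GameSym

/-! Graph isomorphism can test for symmetries. Take a vertex for each player, each action and each
cell (i, a) of the payoff tables, join a player to its own actions and cells, and a cell to the
actions played in it, and colour the cells by their payoffs. If moreover the actions of a list
receive colours of their own, an isomorphism between two such coloured graphs amounts to a symmetry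
that maps one list to the other (`Game.nonempty_iso_iff_exists_map_eq`). Colours are turned into
numbers of pendant vertices, so a single oracle query decides whether some symmetry maps xs to ys
(`Game.solvedBy_graphIsomorphism`).

Such queries explore the stabilizer chain of the symmetry group along the list of all actions. The
order of the group is the product of the orbit lengths in the chain (`card_eq_prod`), and each orbit
is found with one query per action. The group is generated by symmetries that fix the first i
actions and map the next one to y, one for each i and each y for which this is possible
(`le_of_forall_isPartialImage`). They are found by extending a partial image greedily
(`exists_foldl_extendStep_eq`).

Conversely, given graphs G and H, add one further vertex, an apex, to each of them, and consider the
matrix on the union that records equality, adjacency and membership in the same half. If one player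
receives the entries of the matrix and the other a constant above all of them, the symmetries are
the automorphisms of the matrix (`matrixGame.isSymmetry_iff`). One that moves the apex of G must
swap the two halves, so it exists if and only if G and H are isomorphic (`nonempty_iso_iff`). Given
generators, it is enough to look for one that moves this apex. Given only orders, the group is
compared with its subgroup that fixes the apex, which is realized by changing one entry of the
matrix (`nonempty_iso_iff_card_ne`).

For the running times, a class of functions on data coded by binary trees is shown to be closed
under composition, pairing, case distinction, oracle queries, and iteration over a list with
polynomially bounded intermediate results (`PTO.foldl_of_bound`). `TuringReducible.of_pto` turns a
function of this class into a reduction.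

In the labeled graph of a game, actions are the only vertices that lie on edges of both labels `lam`
and `lam'`. Hence an automorphism preserves the three types of vertices, and the edges labeled by
payoffs express the invariance of payoffs (`Game.exists_vertexHom_eq`). In the game of a graph, the
players have different numbers of actions and cannot be exchanged, and the payoffs of player `0`
reveal the further action, equality and adjacency (`graphGame.symmetry_surjective`). -/

namespace GameSym

/-! ## Structured programs for oracle machines -/

/-- Structured programs: `pop s c` pops stack `s` and goes on with the command that `c` assigns to
the removed bit, `loop s c` pops stack `s` until it is empty and runs `c b` for each removed bit
`b`. -/
inductive Cmd : Type
  | skip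
  | push (s : ℕ) (b : Bool)
  | pop (s : ℕ) (c : Option Bool → Cmd)
  | seq (c d : Cmd)
  | loop (s : ℕ) (c : Bool → Cmd)
  | query

namespace Cmd

/-- The control states of the machine that runs a program. -/
def State : Cmd → Type
  | skip => Empty
  | push _ _ => Unit
  | pop _ c => Option (Σ o, (c o).State)
  | seq c d => c.State ⊕ d.State
  | loop _ c => Option (Σ b, (c b).State)
  | query => Unit

theorem finite_state (c : Cmd) : Finite c.State := by
  induction c with
  | skip => exact inferInstanceAs (Finite Empty)
  | push s b => exact inferInstanceAs (Finite Unit)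
  | pop s c ih => exact inferInstanceAs (Finite (Option (Σ o, (c o).State)))
  | seq c d hc hd => exact inferInstanceAs (Finite (c.State ⊕ d.State))
  | loop s c ih => exact inferInstanceAs (Finite (Option (Σ b, (c b).State)))
  | query => exact inferInstanceAs (Finite Unit)

variable {Q : Type}

/-- The first state of a program whose states are embedded by `e`, and which is followed by `q`. -/
def entry : (c : Cmd) → (c.State → Q) → Q → Q
  | skip, _, q => q
  | push _ _, e, _ => e ()
  | pop _ _, e, _ => e none
  | seq c d, e, q => c.entry (fun x => e (.inl x)) (d.entry (fun x => e (.inr x)) q)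
  | loop _ _, e, _ => e none
  | query, e, _ => e ()

/-- The instructions of a program whose states are embedded by `e`, and which is followed by
`q`. -/
def instr : (c : Cmd) → (c.State → Q) → Q → c.State → OracleInstr Q
  | skip, _, _, x => Empty.elim x
  | push s b, _, q, _ => .push s b q
  | pop s c, e, q, none => .pop s fun o => (c o).entry (fun x => e (some ⟨o, x⟩)) q
  | pop _ c, e, q, some ⟨o, x⟩ => (c o).instr (fun x => e (some ⟨o, x⟩)) q x
  | seq c d, e, q, .inl x => c.instr (fun x => e (.inl x)) (d.entry (fun x => e (.inr x)) q) x
  | seq _ d, e, q, .inr x => d.instr (fun x => e (.inr x)) q x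
  | loop s c, e, q, none => .pop s fun o => o.elim q fun b =>
      (c b).entry (fun x => e (some ⟨b, x⟩)) (e none)
  | loop _ c, e, _, some ⟨b, x⟩ => (c b).instr (fun x => e (some ⟨b, x⟩)) (e none) x
  | query, _, q, _ => .query q

/-- The machine that runs a program and then halts. -/
def machine (c : Cmd) : OracleMachine where
  State := Option c.State
  finite_state := have := c.finite_state; inferInstance
  start := c.entry some none
  program := fun q => q.elim .halt (c.instr some none)

end Cmd

/-- `Exec f c m m' t`: the program `c` with oracle `f` transforms the memory `m` into `m'` in `t`
steps. -/
inductive Exec (f : List Bool → List Bool) : Cmd → Memory → Memory → ℕ → Prop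
  | skip (m) : Exec f .skip m m 0
  | push (s b m) : Exec f (.push s b) m (Function.update m s (b :: m s)) 1
  | pop {s c m m' t} : Exec f (c (m s).head?) (Function.update m s (m s).tail) m' t →
      Exec f (.pop s c) m m' (t + 1)
  | seq {c d m m' m'' t t'} : Exec f c m m' t → Exec f d m' m'' t' →
      Exec f (.seq c d) m m'' (t + t')
  | loop_nil {s c m} : m s = [] → Exec f (.loop s c) m m 1
  | loop_cons {s c m m' m'' b l t t'} : m s = b :: l →
      Exec f (c b) (Function.update m s l) m' t → Exec f (.loop s c) m' m'' t' →
      Exec f (.loop s c) m m'' (t + t' + 1)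
  | query (m) : Exec f .query m (Function.update (Function.update m 2 (f (m 1))) 1 []) 1

/-- The embedding `e` and the continuation `q` have to be arbitrary for the induction over the run:
the first half of a sequence is followed by the entry of the second half, and a loop body by the
loop itself. The number `k` is the supply of steps that remains when `q` is reached. -/
theorem Exec.runFrom {f : List Bool → List Bool} {c : Cmd} {m m' : Memory} {t : ℕ}
    (h : Exec f c m m' t) (M : OracleMachine) (k : ℕ) :
    ∀ (e : c.State → M.State) (q : M.State), (∀ x, M.program (e x) = c.instr e q x) →
      M.runFrom f (t + k) (c.entry e q) m = M.runFrom f k q m' := by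
  induction h generalizing k with
  | skip m => intro e q _; simp [Cmd.entry]
  | push s b m =>
    intro e q he
    have h1 := he ()
    simp only [Cmd.instr] at h1
    rw [add_comm 1 k, Cmd.entry, OracleMachine.runFrom, h1]
  | @pop s c m m' t h ih =>
    intro e q he
    have h1 := he none
    simp only [Cmd.instr] at h1
    rw [show t + 1 + k = t + k + 1 by omega, Cmd.entry, OracleMachine.runFrom, h1]
    exact ih k _ q fun x => he (some ⟨_, x⟩)
  | @seq c d m m' m'' t t' h1 h2 ih1 ih2 =>
    intro e q he
    rw [add_assoc, Cmd.entry, ih1 _ _ _ fun x => he (.inl x)]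
    exact ih2 _ _ _ fun x => he (.inr x)
  | @loop_nil s c m hm =>
    intro e q he
    have h1 := he none
    simp only [Cmd.instr] at h1
    rw [add_comm 1 k, Cmd.entry, OracleMachine.runFrom, h1]
    have h2 : Function.update m s [] = m := by rw [← hm, Function.update_eq_self]
    simp [hm, h2]
  | @loop_cons s c m m' m'' b l t t' hm h1 h2 ih1 ih2 =>
    intro e q he
    have h3 := he none
    simp only [Cmd.instr] at h3
    rw [show t + t' + 1 + k = t + (t' + k) + 1 by omega, Cmd.entry, OracleMachine.runFrom, h3]
    simp only [hm, List.head?_cons, List.tail_cons, Option.elim_some]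
    rw [ih1 _ _ _ fun x => he (some ⟨_, x⟩)]
    exact ih2 k e q he
  | query m =>
    intro e q he
    have h1 := he ()
    simp only [Cmd.instr] at h1
    rw [add_comm 1 k, Cmd.entry, OracleMachine.runFrom, h1]

theorem Exec.run_machine {f : List Bool → List Bool} {c : Cmd} {x : List Bool} {m' : Memory}
    {t k : ℕ} (h : Exec f c (initMemory x) m' t) (hk : t < k) :
    c.machine.run f k x = some (m' 0) := by
  -- One step beyond `t` is spent on the halting instruction.
  obtain ⟨k, rfl⟩ : ∃ j, k = t + (j + 1) := ⟨k - t - 1, by omega⟩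
  rw [OracleMachine.run]
  refine (h.runFrom c.machine (k + 1) some none fun x => rfl).trans ?_
  rfl

/-- A program writes at most one bit per step on the output stack. -/
theorem Exec.length_le {f : List Bool → List Bool} {c : Cmd} {m m' : Memory} {t : ℕ}
    (h : Exec f c m m' t) : (m' 0).length ≤ (m 0).length + t := by
  have key : ∀ (m : Memory) (s : ℕ) (l : List Bool), l.length ≤ (m s).length →
      (Function.update m s l 0).length ≤ (m 0).length := by
    intro m s l hl
    by_cases hs : 0 = s
    · subst hs; simpa using hl
    · simp [Function.update_of_ne hs]
  induction h with
  | skip m => simp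
  | push s b m =>
    by_cases hs : 0 = s
    · subst hs; simp
    · simp [Function.update_of_ne hs]
  | @pop s c m m' t h ih =>
    have := key m s (m s).tail (by simp)
    omega
  | seq h1 h2 ih1 ih2 => omega
  | loop_nil hm => omega
  | @loop_cons s c m m' m'' b l t t' hm h1 h2 ih1 ih2 =>
    have := key m s l (by simp [hm])
    omega
  -- A query changes only the stacks `1` and `2`, so the bound holds however long the answer is.
  | query m => simp [Function.update_of_ne]

end GameSym

/-! ### Time-bounded runs, and memories with five stacks -/

namespace GameSym

/-- `Run f c m m' T`: the program `c` with oracle `f` transforms the memory `m` into `m'` in at most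
`T` steps. -/
def Run (f : List Bool → List Bool) (c : Cmd) (m m' : Memory) (T : ℕ) : Prop :=
  ∃ t ≤ T, Exec f c m m' t

/-- The memory with the given content of the stacks `0, …, 4`. -/
def mem (l₀ l₁ l₂ l₃ l₄ : List Bool) : Memory
  | 0 => l₀
  | 1 => l₁
  | 2 => l₂
  | 3 => l₃
  | 4 => l₄
  | _ => []

section mem

variable (l₀ l₁ l₂ l₃ l₄ l : List Bool)

@[simp] theorem mem_zero : mem l₀ l₁ l₂ l₃ l₄ 0 = l₀ := rfl
@[simp] theorem mem_one : mem l₀ l₁ l₂ l₃ l₄ 1 = l₁ := rfl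
@[simp] theorem mem_two : mem l₀ l₁ l₂ l₃ l₄ 2 = l₂ := rfl
@[simp] theorem mem_three : mem l₀ l₁ l₂ l₃ l₄ 3 = l₃ := rfl
@[simp] theorem mem_four : mem l₀ l₁ l₂ l₃ l₄ 4 = l₄ := rfl

@[simp] theorem update_mem_zero :
    Function.update (mem l₀ l₁ l₂ l₃ l₄) 0 l = mem l l₁ l₂ l₃ l₄ := by
  funext i; rcases i with _ | _ | _ | _ | _ | i <;> simp [Function.update, mem]

@[simp] theorem update_mem_one :
    Function.update (mem l₀ l₁ l₂ l₃ l₄) 1 l = mem l₀ l l₂ l₃ l₄ := by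
  funext i; rcases i with _ | _ | _ | _ | _ | i <;> simp [Function.update, mem]

@[simp] theorem update_mem_two :
    Function.update (mem l₀ l₁ l₂ l₃ l₄) 2 l = mem l₀ l₁ l l₃ l₄ := by
  funext i; rcases i with _ | _ | _ | _ | _ | i <;> simp [Function.update, mem]

@[simp] theorem update_mem_three :
    Function.update (mem l₀ l₁ l₂ l₃ l₄) 3 l = mem l₀ l₁ l₂ l l₄ := by
  funext i; rcases i with _ | _ | _ | _ | _ | i <;> simp [Function.update, mem]

@[simp] theorem update_mem_four :
    Function.update (mem l₀ l₁ l₂ l₃ l₄) 4 l = mem l₀ l₁ l₂ l₃ l := by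
  funext i; rcases i with _ | _ | _ | _ | _ | i <;> simp [Function.update, mem]

theorem initMemory_eq_mem : initMemory l = mem l [] [] [] [] := by
  funext i; rcases i with _ | _ | _ | _ | _ | i <;> simp [initMemory, Function.update, mem]

end mem

namespace Run

variable {f : List Bool → List Bool} {c d : Cmd} {m m' m'' : Memory} {T T' : ℕ}

theorem mono (h : Run f c m m' T) (hT : T ≤ T') : Run f c m m' T' :=
  let ⟨t, ht, h⟩ := h
  ⟨t, ht.trans hT, h⟩

theorem skip (m : Memory) : Run f .skip m m 0 := ⟨0, le_rfl, .skip m⟩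

theorem push (s : ℕ) (b : Bool) (m : Memory) :
    Run f (.push s b) m (Function.update m s (b :: m s)) 1 := ⟨1, le_rfl, .push s b m⟩

theorem seq (h : Run f c m m' T) (h' : Run f d m' m'' T') : Run f (.seq c d) m m'' (T + T') :=
  let ⟨t, ht, h⟩ := h
  let ⟨t', ht', h'⟩ := h'
  ⟨t + t', by omega, h.seq h'⟩

theorem pop {s : ℕ} {c : Option Bool → Cmd}
    (h : Run f (c (m s).head?) (Function.update m s (m s).tail) m' T) :
    Run f (.pop s c) m m' (T + 1) :=
  let ⟨t, ht, h⟩ := h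
  ⟨t + 1, by omega, h.pop⟩

theorem loop_nil {s : ℕ} {c : Bool → Cmd} (h : m s = []) : Run f (.loop s c) m m 1 :=
  ⟨1, le_rfl, .loop_nil h⟩

theorem loop_cons {s : ℕ} {c : Bool → Cmd} {b : Bool} {l : List Bool} (hm : m s = b :: l)
    (h : Run f (c b) (Function.update m s l) m' T) (h' : Run f (.loop s c) m' m'' T') :
    Run f (.loop s c) m m'' (T + T' + 1) :=
  let ⟨t, ht, h⟩ := h
  let ⟨t', ht', h'⟩ := h'
  ⟨t + t' + 1, by omega, .loop_cons hm h h'⟩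

theorem query (m : Memory) :
    Run f .query m (Function.update (Function.update m 2 (f (m 1))) 1 []) 1 :=
  ⟨1, le_rfl, .query m⟩

end Run

/-! ## Binary trees as universal data -/

/-- The prefix code of a tree is self-delimiting, so several data can lie on one stack without
separators or length counters. -/
inductive Bin : Type
  | leaf
  | node (a b : Bin)

/-- The prefix code of a binary tree. -/
def Bin.bits : Bin → List Bool
  | leaf => [false]
  | node a b => true :: (a.bits ++ b.bits)

/-- Types whose elements are represented by binary trees. -/
class Coded (α : Type) where
  toBin : α → Bin

/-- The bit string that represents `a` on a stack. -/
def bits {α : Type} [Coded α] (a : α) : List Bool := (Coded.toBin a).bits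

/-- The length of the representation. -/
def sz {α : Type} [Coded α] (a : α) : ℕ := (bits a).length

section instances

variable {α β : Type} [Coded α] [Coded β]

/-- The codes overlap on purpose: a nonempty list has the code of the pair of its head and tail,
`true` that of `[()]`, and `n` that of a list of `n` units. Conversions between these need no
computation at all (`PT.of_bits_eq`). -/
instance : Coded Unit := ⟨fun _ => .leaf⟩
instance : Coded Bool := ⟨fun b => cond b (.node .leaf .leaf) .leaf⟩
instance : Coded (α × β) := ⟨fun p => .node (Coded.toBin p.1) (Coded.toBin p.2)⟩
instance : Coded (List α) := ⟨fun l => l.foldr (fun a t => .node (Coded.toBin a) t) .leaf⟩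
-- Numbers are kept in unary. This is affordable for indices, colours and orbit lengths; payoffs and
-- group orders, which may be exponentially large, are only handled as bit strings.
instance : Coded ℕ := ⟨fun n => Coded.toBin (List.replicate n ())⟩

theorem bits_false : bits false = [false] := rfl
theorem bits_true : bits true = [true, false, false] := rfl
theorem bits_pair (a : α) (b : β) : bits (a, b) = true :: (bits a ++ bits b) := rfl
theorem bits_nil : bits ([] : List α) = [false] := rfl
theorem bits_cons (a : α) (l : List α) : bits (a :: l) = true :: (bits a ++ bits l) := rfl
theorem bits_nat (n : ℕ) : bits n = bits (List.replicate n ()) := rfl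

theorem sz_unit (u : Unit) : sz u = 1 := rfl
theorem sz_bool_le (b : Bool) : sz b ≤ 3 := by cases b <;> decide
theorem sz_pair (a : α) (b : β) : sz (a, b) = sz a + sz b + 1 := by
  simp [sz, bits_pair]
theorem sz_nil : sz ([] : List α) = 1 := rfl
theorem sz_cons (a : α) (l : List α) : sz (a :: l) = sz a + sz l + 1 := by
  simp [sz, bits_cons]
theorem sz_pos (a : α) : 0 < sz a := by
  unfold sz bits
  cases Coded.toBin a <;> simp [Bin.bits]
theorem sz_nat (n : ℕ) : sz n = 2 * n + 1 := by
  induction n with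
  | zero => rfl
  | succ n ih =>
    have h : sz (n + 1) = sz () + sz n + 1 := sz_cons () (List.replicate n ())
    rw [h, ih, sz_unit]; ring

theorem length_le_sz (l : List α) : l.length ≤ sz l := by
  induction l with
  | nil => simp
  | cons a l ih => rw [sz_cons, List.length_cons]; omega

theorem sz_le_of_mem {a : α} {l : List α} (h : a ∈ l) : sz a ≤ sz l := by
  induction l with
  | nil => simp at h
  | cons b l ih =>
    rw [sz_cons]
    rcases List.mem_cons.1 h with rfl | h
    · omega
    · have := ih h; omega

end instances

/-! ## Basic stack operations -/

namespace Cmd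

/-- Move the tree on top of stack `0` to stack `k`, reversing its code. -/
def move (k : ℕ) : Cmd :=
  .seq (.push 1 true) (.loop 1 fun _ => .pop 0 fun o => o.elim .skip fun b =>
    bif b then .seq (.push k true) (.seq (.push 1 true) (.push 1 true)) else .push k false)

/-- Pour stack `k` on stack `j`. -/
def pour (k j : ℕ) : Cmd := .loop k fun b => .push j b

def drop : Cmd := .seq (.move 3) (.loop 3 fun _ => .skip)

def swap : Cmd := .seq (.move 3) (.seq (.move 4) (.seq (.pour 3 0) (.pour 4 0)))

/-- Moving and pouring each reverse a string. The copy on stack `4` already has the right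
orientation, so it takes the detour over stack `3` to be reversed twice. -/
def dup : Cmd :=
  .seq (.move 3) (.seq (.loop 3 fun b => .seq (.push 0 b) (.push 4 b))
    (.seq (.pour 4 3) (.pour 3 0)))

end Cmd

variable {f : List Bool → List Bool}

theorem run_pour {k j : ℕ} (hkj : j ≠ k) (l : List Bool) : ∀ m : Memory, m k = l →
    Run f (.pour k j) m (Function.update (Function.update m k []) j (l.reverse ++ m j))
      (2 * l.length + 1) := by
  induction l with
  | nil =>
    intro m hm
    have h1 : Function.update m k [] = m := by rw [← hm, Function.update_eq_self]
    have h2 : Function.update m j (m j) = m := Function.update_eq_self _ _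
    simpa [h1, h2, Cmd.pour] using Run.loop_nil (f := f) (s := k) (c := fun b => .push j b) hm
  | cons b l ih =>
    intro m hm
    have h1 := ih (Function.update (Function.update m k l) j (b :: m j)) (by
      rw [Function.update_of_ne hkj.symm, Function.update_self])
    have h2 := Run.push (f := f) j b (Function.update m k l)
    rw [Function.update_of_ne hkj] at h2
    have h3 := (Run.loop_cons (c := fun b => .push j b) hm h2 h1).mono
      (show _ ≤ 2 * (b :: l).length + 1 by simp only [List.length_cons]; omega)
    rw [Cmd.pour]
    convert h3 using 1
    funext i
    by_cases hj : i = j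
    · subst hj; simp
    · by_cases hk : i = k
      · subst hk; simp [Function.update, hj]
      · simp [Function.update, hj, hk]

theorem run_pour_3_0 (l₀ l₁ l₂ l₃ l₄ : List Bool) : Run f (.pour 3 0) (mem l₀ l₁ l₂ l₃ l₄)
    (mem (l₃.reverse ++ l₀) l₁ l₂ [] l₄) (2 * l₃.length + 1) := by
  simpa using run_pour (f := f) (k := 3) (j := 0) (by decide) l₃ (mem l₀ l₁ l₂ l₃ l₄) rfl

theorem run_pour_4_0 (l₀ l₁ l₂ l₃ l₄ : List Bool) : Run f (.pour 4 0) (mem l₀ l₁ l₂ l₃ l₄)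
    (mem (l₄.reverse ++ l₀) l₁ l₂ l₃ []) (2 * l₄.length + 1) := by
  simpa using run_pour (f := f) (k := 4) (j := 0) (by decide) l₄ (mem l₀ l₁ l₂ l₃ l₄) rfl

theorem run_pour_4_3 (l₀ l₁ l₂ l₃ l₄ : List Bool) : Run f (.pour 4 3) (mem l₀ l₁ l₂ l₃ l₄)
    (mem l₀ l₁ l₂ (l₄.reverse ++ l₃) []) (2 * l₄.length + 1) := by
  simpa using run_pour (f := f) (k := 4) (j := 3) (by decide) l₄ (mem l₀ l₁ l₂ l₃ l₄) rfl

theorem run_pour_3_1 (l₀ l₁ l₂ l₃ l₄ : List Bool) : Run f (.pour 3 1) (mem l₀ l₁ l₂ l₃ l₄)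
    (mem l₀ (l₃.reverse ++ l₁) l₂ [] l₄) (2 * l₃.length + 1) := by
  simpa using run_pour (f := f) (k := 3) (j := 1) (by decide) l₃ (mem l₀ l₁ l₂ l₃ l₄) rfl

theorem run_pour_2_3 (l₀ l₁ l₂ l₃ l₄ : List Bool) : Run f (.pour 2 3) (mem l₀ l₁ l₂ l₃ l₄)
    (mem l₀ l₁ [] (l₂.reverse ++ l₃) l₄) (2 * l₂.length + 1) := by
  simpa using run_pour (f := f) (k := 2) (j := 3) (by decide) l₂ (mem l₀ l₁ l₂ l₃ l₄) rfl

theorem run_pour_0_3 (l₀ l₁ l₂ l₃ l₄ : List Bool) : Run f (.pour 0 3) (mem l₀ l₁ l₂ l₃ l₄)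
    (mem [] l₁ l₂ (l₀.reverse ++ l₃) l₄) (2 * l₀.length + 1) := by
  simpa using run_pour (f := f) (k := 0) (j := 3) (by decide) l₀ (mem l₀ l₁ l₂ l₃ l₄) rfl

/-- Stack `1` holds one bit for each subtree that is still to be read: a node replaces its own bit
by two, a leaf removes it, so the loop stops exactly at the end of the tree. The auxiliary claim
`key` is stated relative to the run on the remaining subtrees, which makes the induction over trees
go through. Each bit costs at most five steps: two pops and three pushes. -/
theorem run_move {k : ℕ} (hk : k = 3 ∨ k = 4) (a : Bin) (r l₂ l₃ l₄ : List Bool) :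
    Run f (.move k) (mem (a.bits ++ r) [] l₂ l₃ l₄)
      (if k = 3 then mem r [] l₂ (a.bits.reverse ++ l₃) l₄
        else mem r [] l₂ l₃ (a.bits.reverse ++ l₄)) (5 * a.bits.length + 2) := by
  have key : ∀ (a : Bin) (r l₁ l₃ l₄ : List Bool) (m' : Memory) (T : ℕ),
      Run f (.loop 1 fun _ => .pop 0 fun o => o.elim .skip fun b =>
        bif b then .seq (.push k true) (.seq (.push 1 true) (.push 1 true)) else .push k false)
        (if k = 3 then mem r l₁ l₂ (a.bits.reverse ++ l₃) l₄
          else mem r l₁ l₂ l₃ (a.bits.reverse ++ l₄)) m' T →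
      Run f (.loop 1 fun _ => .pop 0 fun o => o.elim .skip fun b =>
        bif b then .seq (.push k true) (.seq (.push 1 true) (.push 1 true)) else .push k false)
        (mem (a.bits ++ r) (true :: l₁) l₂ l₃ l₄) m' (5 * a.bits.length + T) := by
    intro a
    induction a with
    | leaf =>
      intro r l₁ l₃ l₄ m' T h
      refine (Run.loop_cons (b := true) (l := l₁) (T := 2) rfl ?_ h).mono ?_
      · refine Run.pop (T := 1) ?_
        rcases hk with rfl | rfl
        · simpa [Bin.bits] using Run.push (f := f) 3 false (mem r l₁ l₂ l₃ l₄)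
        · simpa [Bin.bits] using Run.push (f := f) 4 false (mem r l₁ l₂ l₃ l₄)
      · simp [Bin.bits]
    | node a b iha ihb =>
      intro r l₁ l₃ l₄ m' T h
      rcases hk with rfl | rfl
      · simp only [if_true] at h ihb iha ⊢
        have h3 := iha (b.bits ++ r) (true :: l₁) (true :: l₃) l₄ m' _
          (ihb r l₁ _ _ m' T (by simpa [Bin.bits] using h))
        refine (Run.loop_cons (b := true) (l := l₁) (T := 4)
          (m' := mem (a.bits ++ (b.bits ++ r)) (true :: true :: l₁) l₂ (true :: l₃) l₄)
          rfl ?_ h3).mono ?_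
        · refine Run.pop (T := 3) ?_
          have h4 := (Run.push (f := f) 3 true (mem (a.bits ++ (b.bits ++ r)) l₁ l₂ l₃ l₄)).seq
            ((Run.push 1 true _).seq (Run.push 1 true _))
          simpa [Bin.bits] using h4
        · simp [Bin.bits]; omega
      · have h5 : ¬ (4 = 3) := by decide
        simp only [h5, if_false] at h ihb iha ⊢
        have h3 := iha (b.bits ++ r) (true :: l₁) l₃ (true :: l₄) m' _
          (ihb r l₁ _ _ m' T (by simpa [Bin.bits] using h))
        refine (Run.loop_cons (b := true) (l := l₁) (T := 4)
          (m' := mem (a.bits ++ (b.bits ++ r)) (true :: true :: l₁) l₂ l₃ (true :: l₄))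
          rfl ?_ h3).mono ?_
        · refine Run.pop (T := 3) ?_
          have h4 := (Run.push (f := f) 4 true (mem (a.bits ++ (b.bits ++ r)) l₁ l₂ l₃ l₄)).seq
            ((Run.push 1 true _).seq (Run.push 1 true _))
          simpa [Bin.bits] using h4
        · simp [Bin.bits]; omega
  have h := Run.push (f := f) 1 true (mem (a.bits ++ r) [] l₂ l₃ l₄)
  simp only [update_mem_one, mem_one] at h
  refine (h.seq (key a r [] l₃ l₄ _ 1 (Run.loop_nil ?_))).mono (by omega)
  split_ifs <;> rfl

theorem run_move_3 (a : Bin) (r l₂ l₃ l₄ : List Bool) :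
    Run f (.move 3) (mem (a.bits ++ r) [] l₂ l₃ l₄) (mem r [] l₂ (a.bits.reverse ++ l₃) l₄)
      (5 * a.bits.length + 2) :=
  run_move (.inl rfl) a r l₂ l₃ l₄

theorem run_move_4 (a : Bin) (r l₂ l₃ l₄ : List Bool) :
    Run f (.move 4) (mem (a.bits ++ r) [] l₂ l₃ l₄) (mem r [] l₂ l₃ (a.bits.reverse ++ l₄))
      (5 * a.bits.length + 2) :=
  run_move (.inr rfl) a r l₂ l₃ l₄

theorem run_drop (a : Bin) (r : List Bool) :
    Run f .drop (mem (a.bits ++ r) [] [] [] []) (mem r [] [] [] []) (7 * a.bits.length + 4) := by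
  have key : ∀ l : List Bool, Run f (.loop 3 fun _ => .skip) (mem r [] [] l [])
      (mem r [] [] [] []) (l.length + 1) := by
    intro l
    induction l with
    | nil => exact Run.loop_nil rfl
    | cons b l ih =>
      have h := Run.skip (f := f) (mem r [] [] l [])
      exact (Run.loop_cons (c := fun _ => .skip) (m := mem r [] [] (b :: l) []) (b := b) (l := l)
        rfl (by simpa using h) ih).mono (by simp)
  have := (run_move_3 (f := f) a r [] [] []).seq (key _)
  exact this.mono (by simp; omega)

theorem run_swap (a b : Bin) (r : List Bool) :
    Run f .swap (mem (a.bits ++ (b.bits ++ r)) [] [] [] [])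
      (mem (b.bits ++ (a.bits ++ r)) [] [] [] []) (7 * (a.bits.length + b.bits.length) + 10) := by
  have := (run_move_3 (f := f) a (b.bits ++ r) [] [] []).seq ((run_move_4 b r [] _ []).seq
    ((run_pour_3_0 _ _ _ _ _).seq (run_pour_4_0 _ _ _ _ _)))
  simp only [List.append_nil, List.reverse_reverse, List.length_reverse] at this
  exact this.mono (by omega)

theorem run_dup (a : Bin) (r : List Bool) :
    Run f .dup (mem (a.bits ++ r) [] [] [] [])
      (mem (a.bits ++ (a.bits ++ r)) [] [] [] []) (12 * a.bits.length + 10) := by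
  have key : ∀ l l₀ l₄ : List Bool, Run f (.loop 3 fun b => .seq (.push 0 b) (.push 4 b))
      (mem l₀ [] [] l l₄) (mem (l.reverse ++ l₀) [] [] [] (l.reverse ++ l₄))
      (3 * l.length + 1) := by
    intro l
    induction l with
    | nil => intro l₀ l₄; exact Run.loop_nil rfl
    | cons b l ih =>
      intro l₀ l₄
      have h := (Run.push (f := f) 0 b (mem l₀ [] [] l l₄)).seq (Run.push 4 b _)
      simp only [update_mem_zero, update_mem_four, mem_zero, mem_four] at h
      refine (Run.loop_cons (b := b) (l := l) (m := mem l₀ [] [] (b :: l) l₄) rfl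
        (by simpa using h) (by simpa using ih (b :: l₀) (b :: l₄))).mono ?_
      simp; omega
  have := (run_move_3 (f := f) a r [] [] []).seq ((key _ _ _).seq
    ((run_pour_4_3 _ _ _ _ _).seq (run_pour_3_0 _ _ _ _ _)))
  simp only [List.append_nil, List.reverse_reverse, List.length_reverse] at this
  exact this.mono (by omega)

end GameSym

namespace GameSym

open Polynomial (X C)

/-! ## Polynomial-time functions on coded data -/

theorem eval_mono (p : Polynomial ℕ) {a b : ℕ} (h : a ≤ b) : p.eval a ≤ p.eval b := by
  rw [Polynomial.eval_eq_sum_range, Polynomial.eval_eq_sum_range]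
  gcongr

/-- The memory with the given content of stack `0`, and all other stacks empty. -/
abbrev st (l : List Bool) : Memory := mem l [] [] [] []

theorem run_push_zero {f : List Bool → List Bool} (b : Bool) (l₀ : List Bool) :
    Run f (.push 0 b) (st l₀) (st (b :: l₀)) 1 := by
  simpa using Run.push (f := f) 0 b (st l₀)

theorem run_push_three {f : List Bool → List Bool} (b : Bool) (l₀ : List Bool) :
    Run f (.push 3 b) (st l₀) (mem l₀ [] [] [b] []) 1 := by
  simpa using Run.push (f := f) 3 b (st l₀)

variable {α β γ δ σ τ : Type} [Coded α] [Coded β] [Coded γ] [Coded δ] [Coded σ] [Coded τ]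

section

variable {f : List Bool → List Bool}

theorem run_drop' (a : α) (rest : List Bool) :
    Run f .drop (st (bits a ++ rest)) (st rest) (7 * sz a + 4) :=
  run_drop (Coded.toBin a) rest

theorem run_swap' (a : α) (b : β) (rest : List Bool) :
    Run f .swap (st (bits a ++ (bits b ++ rest))) (st (bits b ++ (bits a ++ rest)))
      (7 * (sz a + sz b) + 10) :=
  run_swap (Coded.toBin a) (Coded.toBin b) rest

theorem run_dup' (a : α) (rest : List Bool) :
    Run f .dup (st (bits a ++ rest)) (st (bits a ++ (bits a ++ rest))) (12 * sz a + 10) :=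
  run_dup (Coded.toBin a) rest

end

/-- `F`, a function that may depend on an oracle, is computed in polynomial time by an oracle
program. -/
def PTO (F : (List Bool → List Bool) → α → β) : Prop :=
  ∃ c : Cmd, ∀ r : Polynomial ℕ, ∃ p : Polynomial ℕ, ∀ f, LengthBounded r f → ∀ a rest,
    Run f c (st (bits a ++ rest)) (st (bits (F f a) ++ rest)) (p.eval (sz a))

/-- `F` is computable in polynomial time. -/
@[fun_prop]
def PT (F : α → β) : Prop := PTO fun _ => F

/-- At most one bit per step is written on stack `0` (`Exec.length_le`), so the time bound also
bounds the size of the value; the summand `X` accounts for the input, which lies on the same stack.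
-/
theorem PTO.exists_bound {F : (List Bool → List Bool) → α → β} (hF : PTO F) :
    ∃ c : Cmd, ∀ r : Polynomial ℕ, ∃ p : Polynomial ℕ, ∀ f, LengthBounded r f →
      (∀ a, sz (F f a) ≤ p.eval (sz a)) ∧ ∀ a rest,
        Run f c (st (bits a ++ rest)) (st (bits (F f a) ++ rest)) (p.eval (sz a)) := by
  obtain ⟨c, hc⟩ := hF
  refine ⟨c, fun r => ?_⟩
  obtain ⟨p, hp⟩ := hc r
  refine ⟨X + p, fun f hf => ⟨fun a => ?_, fun a rest => ?_⟩⟩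
  · obtain ⟨t, ht, h⟩ := hp f hf a []
    have := h.length_le
    simp only [List.append_nil, mem_zero] at this
    simp only [Polynomial.eval_add, Polynomial.eval_X]
    exact this.trans (Nat.add_le_add_left ht _)
  · exact (hp f hf a rest).mono (by simp)

theorem lengthBounded_nil (r : Polynomial ℕ) : LengthBounded r fun _ => [] := fun _ => by simp

/-- The values of a polynomial-time function have polynomial size. -/
theorem PT.sz_le {F : α → β} (hF : PT F) : ∃ p : Polynomial ℕ, ∀ a, sz (F a) ≤ p.eval (sz a) := by
  obtain ⟨c, hc⟩ := PTO.exists_bound hF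
  -- `F` does not depend on the oracle, so the oracle with empty answers serves to read off the
  -- bound.
  obtain ⟨p, hp⟩ := hc 0
  exact ⟨p, (hp _ (lengthBounded_nil 0)).1⟩

theorem PTO.comp {G : (List Bool → List Bool) → β → γ} {F : (List Bool → List Bool) → α → β}
    (hG : PTO G) (hF : PTO F) : PTO fun f a => G f (F f a) := by
  obtain ⟨c, hc⟩ := hF.exists_bound
  obtain ⟨d, hd⟩ := hG
  refine ⟨.seq c d, fun r => ?_⟩
  obtain ⟨p, hp⟩ := hc r
  obtain ⟨q, hq⟩ := hd r
  refine ⟨p + q.comp p, fun f hf a rest => ?_⟩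
  refine (((hp f hf).2 a rest).seq (hq f hf _ rest)).mono ?_
  rw [Polynomial.eval_add, Polynomial.eval_comp]
  gcongr
  exact eval_mono q ((hp f hf).1 a)

@[fun_prop]
theorem PT.comp {G : β → γ} {F : α → β} (hG : PT G) (hF : PT F) : PT fun a => G (F a) :=
  PTO.comp hG hF

/-- A function that does not change the representation is computable. -/
theorem PT.of_bits_eq {F : α → β} (h : ∀ a, bits (F a) = bits a) : PT F :=
  ⟨.skip, fun _ => ⟨0, fun f _ a rest => by simpa [h a] using Run.skip _⟩⟩

@[fun_prop]
theorem PT.id : PT fun a : α => a := .of_bits_eq fun _ => rfl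

/-- Push the bits of a list, the last one first. -/
def Cmd.pushList : List Bool → Cmd
  | [] => .skip
  | b :: l => .seq (pushList l) (.push 0 b)

theorem run_pushList {f : List Bool → List Bool} (l l₀ : List Bool) :
    Run f (.pushList l) (st l₀) (st (l ++ l₀)) l.length := by
  induction l with
  | nil => exact Run.skip _
  | cons b l ih => exact ih.seq (run_push_zero b _)

@[fun_prop]
theorem PT.const (b : β) : PT fun _ : α => b := by
  refine ⟨.seq .drop (.pushList (bits b)), fun _ => ⟨7 * X + 4 + C (sz b), fun f _ a rest => ?_⟩⟩
  exact ((run_drop' a rest).seq (run_pushList (bits b) rest)).mono (by simp [sz])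

@[fun_prop]
theorem PT.fst : PT fun p : α × β => p.1 := by
  refine ⟨.pop 0 fun _ => .seq .swap .drop, fun _ => ⟨14 * X + 15, fun f _ a rest => ?_⟩⟩
  have h0 : bits a = true :: (bits a.1 ++ bits a.2) := rfl
  have h := (run_swap' (f := f) a.1 a.2 rest).seq (run_drop' a.2 _)
  have h' := Run.pop (f := f) (s := 0) (c := fun _ => .seq .swap .drop) (m := st (bits a ++ rest))
    (by simpa [h0] using h)
  refine h'.mono ?_
  have := sz_pair a.1 a.2
  simp at this ⊢
  omega

@[fun_prop]
theorem PT.snd : PT fun p : α × β => p.2 := by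
  refine ⟨.pop 0 fun _ => .drop, fun _ => ⟨7 * X + 5, fun f _ a rest => ?_⟩⟩
  have h0 : bits a = true :: (bits a.1 ++ bits a.2) := rfl
  have h := run_drop' (f := f) a.1 (bits a.2 ++ rest)
  have h' := Run.pop (f := f) (s := 0) (c := fun _ => .drop) (m := st (bits a ++ rest))
    (by simpa [h0] using h)
  refine h'.mono ?_
  have := sz_pair a.1 a.2
  simp at this ⊢
  omega

theorem PTO.prodMk {F : (List Bool → List Bool) → α → β} {G : (List Bool → List Bool) → α → γ}
    (hF : PTO F) (hG : PTO G) : PTO fun f a => (F f a, G f a) := by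
  obtain ⟨c, hc⟩ := hF
  obtain ⟨d, hd⟩ := hG.exists_bound
  -- `G` is computed first, so that after the swap the value of `F` ends up on top of it; the final
  -- `true` is the tag of a pair.
  refine ⟨.seq .dup (.seq d (.seq .swap (.seq c (.push 0 true)))), fun r => ?_⟩
  obtain ⟨p, hp⟩ := hc r
  obtain ⟨q, hq⟩ := hd r
  refine ⟨(12 * X + 10) + (q + ((7 * (q + X) + 10) + (p + 1))), fun f hf a rest => ?_⟩
  have h := (run_dup' (f := f) a rest).seq (((hq f hf).2 a (bits a ++ rest)).seq
    ((run_swap' (G f a) a rest).seq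
      ((hp f hf a (bits (G f a) ++ rest)).seq (run_push_zero true _))))
  have h1 := (hq f hf).1 a
  rw [bits_pair, List.cons_append, List.append_assoc]
  refine h.mono ?_
  simp only [Polynomial.eval_add, Polynomial.eval_mul, Polynomial.eval_ofNat, Polynomial.eval_X,
    Polynomial.eval_one]
  gcongr

@[fun_prop]
theorem PT.prodMk {F : α → β} {G : α → γ} (hF : PT F) (hG : PT G) : PT fun a => (F a, G a) :=
  PTO.prodMk hF hG

/-- Case distinction on a list. -/
theorem PT.listCases {L : α → List β} {F : α → γ} {G : α → β → List β → γ} (hL : PT L) (hF : PT F)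
    (hG : PT fun p : α × β × List β => G p.1 p.2.1 p.2.2) :
    PT fun a => match L a with
      | [] => F a
      | x :: t => G a x t := by
  obtain ⟨cL, hL⟩ := PTO.exists_bound hL
  obtain ⟨cF, hF⟩ := hF
  obtain ⟨cG, hG⟩ := hG
  -- The first bit of the code of `L a` decides. For the empty list it is the whole code. Otherwise
  -- pushing it back yields the code of the pair of head and tail, which is swapped with `a` and
  -- tagged to form the argument of `G`.
  refine ⟨.seq .dup (.seq cL (.pop 0 fun o => bif o == some true then
    .seq (.push 0 true) (.seq .swap (.seq (.push 0 true) cG)) else cF)), fun r => ?_⟩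
  obtain ⟨p, hp⟩ := hL r
  obtain ⟨q, hq⟩ := hF r
  obtain ⟨q', hq'⟩ := hG r
  refine ⟨(12 * X + 10) + (p + (q + (1 + ((7 * (p + X) + 10) + (1 + q'.comp (X + p + 1))) + 1))),
    fun f hf a rest => ?_⟩
  have h1 := (hp f hf).2 a (bits a ++ rest)
  have h0 := (hp f hf).1 a
  have h2 := fun {m' T} h => (run_dup' (f := f) a rest).seq (h1.seq
    (Run.pop (s := 0) (m' := m') (T := T) (c := fun o => bif o == some true then
    .seq (.push 0 true) (.seq .swap (.seq (.push 0 true) cG)) else cF) h))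
  rcases hl : L a with _ | ⟨x, t⟩
  · rw [hl] at h2
    simp only [hl]
    refine (h2 (by simpa [bits_nil] using hq f hf a rest)).mono ?_
    simp only [Polynomial.eval_add, Polynomial.eval_mul, Polynomial.eval_ofNat, Polynomial.eval_X,
      Polynomial.eval_one]
    omega
  · rw [hl] at h2 h0
    simp only [hl]
    have e : bits (x, t) ++ (bits a ++ rest) =
        true :: (bits x ++ (bits t ++ (bits a ++ rest))) := by
      simp [bits_pair]
    have hs := run_swap' (f := f) (x, t) a rest
    rw [e] at hs
    have e' : bits (a, x, t) ++ rest = true :: (bits a ++ (bits (x, t) ++ rest)) := by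
      simp [bits_pair]
    have hG := hq' f hf (a, x, t) rest
    rw [e'] at hG
    have h3 := (run_push_zero (f := f) true (bits x ++ (bits t ++ (bits a ++ rest)))).seq
      (hs.seq
        ((run_push_zero true _).seq hG))
    refine (h2 (by simpa [bits_cons] using h3)).mono ?_
    have h4 := eval_mono q' (show sz (a, x, t) ≤ sz a + p.eval (sz a) + 1 by
      rw [sz_pair, sz_pair]; rw [sz_cons] at h0; omega)
    have h5 : sz (x, t) = sz (x :: t) := rfl
    simp only [Polynomial.eval_add, Polynomial.eval_mul, Polynomial.eval_ofNat, Polynomial.eval_X,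
      Polynomial.eval_one, Polynomial.eval_comp]
    rw [← h5] at h0
    omega

/-- Computability of iterations over a list, with polynomially bounded intermediate results. -/
theorem PTO.foldl_of_bound {L : α → List τ} {S : α → σ}
    {g : (List Bool → List Bool) → σ → τ → σ} (hL : PT L) (hS : PT S)
    (hg : PTO fun f (p : σ × τ) => g f p.1 p.2)
    (hB : ∀ r : Polynomial ℕ, ∃ p : Polynomial ℕ, ∀ f, LengthBounded r f → ∀ a l, l <+: L a →
      sz (l.foldl (g f) (S a)) ≤ p.eval (sz a)) :
    PTO fun f a => (L a).foldl (g f) (S a) := by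
  have hstep : PTO fun f (p : (τ × List τ) × σ) => (p.1.2, g f p.2 p.1.1) := by
    have h1 : PT fun p : (τ × List τ) × σ => p.1.2 := by fun_prop
    have h2 : PT fun p : (τ × List τ) × σ => (p.2, p.1.1) := by fun_prop
    exact PTO.prodMk h1 (PTO.comp hg h2)
  obtain ⟨c, hc⟩ := hstep
  obtain ⟨cI, hI⟩ := PTO.exists_bound (PT.prodMk hL hS)
  -- A single bit on stack `3` says that the loop has to go on. It is removed before the body runs
  -- and restored after `c`, since `c` expects all auxiliary stacks to be empty. Popping the tags of
  -- the pair and of the list and pushing two tags back regroups `(x :: l, s)` as `((x, l), s)`.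
  set body : Cmd := .pop 0 fun _ => .pop 0 fun o => bif o == some true then
    .seq (.push 0 true) (.seq (.push 0 true) (.seq c (.push 3 true))) else .skip with hbody
  refine ⟨.seq cI (.seq (.push 3 true) (.loop 3 fun _ => body)), fun r => ?_⟩
  obtain ⟨p, hp⟩ := hc r
  obtain ⟨q, hq⟩ := hB r
  obtain ⟨pI, hpI⟩ := hI r
  refine ⟨pI + (1 + (pI + 1) * (p.comp (pI + q + 1) + 8)), fun f hf a rest => ?_⟩
  have key : ∀ (A B : ℕ) (l : List τ) (s : σ), sz l ≤ A →
      (∀ l', l' <+: l → sz (l'.foldl (g f) s) ≤ B) →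
      Run f (.loop 3 fun _ => body) (mem (bits (l, s) ++ rest) [] [] [true] [])
        (st (bits (l.foldl (g f) s) ++ rest))
        ((l.length + 1) * (p.eval (A + B + 1) + 8)) := by
    intro A B l
    induction l with
    | nil =>
      intro s _ _
      refine (Run.loop_cons (b := true) (l := []) (m' := st (bits s ++ rest)) (T := 2) rfl ?_
        (Run.loop_nil rfl)).mono (by simp)
      refine Run.pop (Run.pop ?_)
      simpa [bits_pair, bits_nil] using Run.skip (f := f) _
    | cons x l ih =>
      intro s hA hs
      have h1 := ih (g f s x) (by rw [sz_cons] at hA; omega) fun l' hl' =>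
        hs (x :: l') (List.cons_prefix_cons.2 ⟨rfl, hl'⟩)
      have h0 : bits ((x, l), s) ++ rest =
          true :: true :: (bits x ++ (bits l ++ (bits s ++ rest))) := by
        simp [bits_pair]
      have hp1 := hp f hf ((x, l), s) rest
      rw [h0] at hp1
      have h2 := (run_push_zero (f := f) true (bits x ++ (bits l ++ (bits s ++ rest)))).seq
        ((run_push_zero true _).seq (hp1.seq (run_push_three true _)))
      have h3 : Run f body (st (bits (x :: l, s) ++ rest))
          (mem (bits (l, g f s x) ++ rest) [] [] [true] []) (p.eval (A + B + 1) + 5) := by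
        have h4 := eval_mono p (show sz ((x, l), s) ≤ A + B + 1 by
          have h5 : sz (x, l) = sz (x :: l) := rfl
          have h6 := hs [] List.nil_prefix
          rw [sz_pair, h5]
          simp only [List.foldl_nil] at h6
          omega)
        refine (Run.pop (Run.pop ?_)).mono
          (show 1 + (1 + (p.eval (sz ((x, l), s)) + 1)) + 1 + 1 ≤ _ by omega)
        simpa [bits_pair, bits_cons] using h2
      refine (Run.loop_cons (b := true) (l := [])
        (m := mem (bits (x :: l, s) ++ rest) [] [] [true] []) rfl (by simpa using h3) h1).mono ?_
      rw [List.length_cons, Nat.succ_mul (l.length + 1)]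
      omega
  have h0 := (hpI f hf).1 a
  have h1 := ((hpI f hf).2 a rest).seq ((run_push_three (f := f) true _).seq
    (key (pI.eval (sz a)) (q.eval (sz a)) (L a) (S a) (by rw [sz_pair] at h0; omega) (hq f hf a)))
  refine h1.mono ?_
  simp only [Polynomial.eval_add, Polynomial.eval_mul, Polynomial.eval_ofNat, Polynomial.eval_one,
    Polynomial.eval_comp]
  have h2 : (L a).length ≤ pI.eval (sz a) := by
    have := length_le_sz (L a); rw [sz_pair] at h0; omega
  gcongr

end GameSym

namespace GameSym

open Polynomial (X)

/-! ## Oracle queries, input and output -/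

/-- Replace the bit string on stack `3`, which is in reverse order, by its code on stack `0`. -/
def Cmd.encode : Cmd :=
  .seq (.push 0 false) (.loop 3 fun b => .pushList (true :: bits b))

/-- Replace the code of a bit string on stack `0` by the string, in reverse order, on stack `3`. -/
def Cmd.decode : Cmd :=
  .seq (.push 4 true) (.loop 4 fun _ => .pop 0 fun o => bif o == some true then
    .pop 0 fun o' => bif o' == some true then
      .pop 0 fun _ => .pop 0 fun _ => .seq (.push 3 true) (.push 4 true)
      else .seq (.push 3 false) (.push 4 true)
    else .skip)

section

variable {f : List Bool → List Bool}

theorem run_encode (l rest : List Bool) :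
    Run f .encode (mem rest [] [] l.reverse []) (st (bits l ++ rest)) (5 * l.length + 2) := by
  have key : ∀ l t rest : List Bool, Run f (.loop 3 fun b => .pushList (true :: bits b))
      (mem (bits t ++ rest) [] [] l []) (st (bits (l.reverse ++ t) ++ rest))
      (5 * l.length + 1) := by
    intro l
    induction l with
    | nil => intro t rest; exact Run.loop_nil rfl
    | cons b l ih =>
      intro t rest
      have h1 := ih (b :: t) rest
      have h2 : Run f (.pushList (true :: bits b)) (mem (bits t ++ rest) [] [] l [])
          (mem (bits (b :: t) ++ rest) [] [] l []) 4 := by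
        have push0 : ∀ (b : Bool) (l₀ : List Bool), Run f (.push 0 b) (mem l₀ [] [] l [])
            (mem (b :: l₀) [] [] l []) 1 := fun b l₀ => by
          simpa using Run.push (f := f) 0 b (mem l₀ [] [] l [])
        cases b with
        | false =>
          exact (((Run.skip (mem (bits t ++ rest) [] [] l [])).seq (push0 _ _)).seq
            (push0 _ _)).mono (by omega)
        | true =>
          exact (((((Run.skip (mem (bits t ++ rest) [] [] l [])).seq (push0 _ _)).seq
            (push0 _ _)).seq (push0 _ _)).seq (push0 _ _)).mono (by omega)
      have h3 := (Run.loop_cons (m := mem (bits t ++ rest) [] [] (b :: l) []) (b := b) (l := l)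
        (c := fun b => .pushList (true :: bits b)) rfl (by simpa using h2) h1).mono
        (show _ ≤ 5 * (b :: l).length + 1 by simp; omega)
      simpa using h3
  have h := Run.push (f := f) 0 false (mem rest [] [] l.reverse [])
  have h' := key l.reverse [] rest
  simp only [bits_nil, List.reverse_reverse, List.append_nil, List.length_reverse] at h'
  exact (h.seq (by simpa using h')).mono (by omega)

theorem run_decode (l rest : List Bool) :
    Run f .decode (st (bits l ++ rest)) (mem rest [] [] l.reverse []) (8 * l.length + 5) := by
  set body : Cmd := .pop 0 fun o => bif o == some true then
    .pop 0 fun o' => bif o' == some true then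
      .pop 0 fun _ => .pop 0 fun _ => .seq (.push 3 true) (.push 4 true)
      else .seq (.push 3 false) (.push 4 true)
    else .skip with hbody
  have key : ∀ l t : List Bool, Run f (.loop 4 fun _ => body)
      (mem (bits l ++ rest) [] [] t [true]) (mem rest [] [] (l.reverse ++ t) [])
      (8 * l.length + 4) := by
    intro l
    induction l with
    | nil =>
      intro t
      refine (Run.loop_cons (b := true) (l := []) (T := 1) (m' := mem rest [] [] t []) rfl ?_
        (Run.loop_nil rfl)).mono (by simp)
      refine Run.pop ?_
      simpa [bits_nil] using Run.skip _
    | cons b l ih =>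
      intro t
      have h2 : Run f body (mem (bits (b :: l) ++ rest) [] [] t [])
          (mem (bits l ++ rest) [] [] (b :: t) [true]) 6 := by
        have h3 : ∀ b, Run f (.seq (.push 3 b) (.push 4 true)) (mem (bits l ++ rest) [] [] t [])
            (mem (bits l ++ rest) [] [] (b :: t) [true]) 2 := fun b => by
          simpa using (Run.push (f := f) 3 b (mem (bits l ++ rest) [] [] t [])).seq
            (Run.push 4 true _)
        cases b with
        | false =>
          refine (Run.pop (Run.pop (T := 2) ?_)).mono (by omega)
          simpa [bits_cons, bits_false] using h3 false
        | true =>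
          refine (Run.pop (Run.pop (Run.pop (Run.pop (T := 2) ?_)))).mono (by omega)
          simpa [bits_cons, bits_true] using h3 true
      have h3 := (Run.loop_cons (m := mem (bits (b :: l) ++ rest) [] [] t [true]) (b := true)
        (l := []) (c := fun _ => body) rfl (by simpa using h2) (ih (b :: t))).mono
        (show _ ≤ 8 * (b :: l).length + 4 by simp; omega)
      simpa using h3
  have h := Run.push (f := f) 4 true (st (bits l ++ rest))
  have h' := key l []
  rw [List.append_nil] at h'
  exact (h.seq (by simpa using h')).mono (by omega)

end

/-- Oracle queries. -/
theorem PTO.query : PTO fun f (x : List Bool) => f x := by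
  refine ⟨.seq .decode (.seq (.pour 3 1) (.seq .query (.seq (.pour 2 3) .encode))), fun r =>
    ⟨10 * X + 7 * r + 10, fun f hf a rest => ?_⟩⟩
  have h1 : Run f .query (mem rest a [] [] []) (mem rest [] (f a) [] []) 1 := by
    simpa using Run.query (f := f) (mem rest a [] [] [])
  have h2 := run_pour_3_1 (f := f) rest [] [] a.reverse []
  have h3 := run_pour_2_3 (f := f) rest [] (f a) [] []
  simp only [List.append_nil, List.reverse_reverse, List.length_reverse] at h2 h3
  refine ((run_decode a rest).seq (h2.seq (h1.seq (h3.seq (run_encode (f a) rest))))).mono ?_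
  have h4 := (hf a).trans (eval_mono r (length_le_sz a))
  have h5 := length_le_sz a
  simp only [Polynomial.eval_add, Polynomial.eval_mul, Polynomial.eval_ofNat, Polynomial.eval_X]
  omega

theorem sz_bits_le (l : List Bool) : sz l ≤ 4 * l.length + 1 := by
  induction l with
  | nil => simp [sz_nil]
  | cons b l ih => rw [sz_cons, List.length_cons]; have := sz_bool_le b; omega

/-- The representation of the instances of a problem by their codes. -/
abbrev Problem.coded (P : Problem) : Coded P.Inst := ⟨fun x => Coded.toBin (P.encode x)⟩

/-- The input string is converted into a tree, the program for `F` runs on it, and its value is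
converted back. The first conversion increases the length at most linearly (`sz_bits_le`), so the
bound stays polynomial. The program is fixed before the polynomial `r` in `PTO`, as required of a
reduction. -/
theorem TuringReducible.of_pto {P Q : Problem} (F : (List Bool → List Bool) → P.Inst → List Bool)
    (hF : @PTO _ _ P.coded _ F) (h : ∀ f, Q.SolvedBy f → ∀ x, P.IsSolution x (F f x)) :
    TuringReducible P Q := by
  let _ := P.coded
  obtain ⟨c, hc⟩ := hF.exists_bound
  refine ⟨Cmd.machine (.seq (.pour 0 3) (.seq .encode (.seq c (.seq .decode (.pour 3 0))))),
    fun r => ?_⟩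
  obtain ⟨p, hp⟩ := hc r
  refine ⟨7 * X + 11 * p.comp (4 * X + 1) + 10, fun f hf hQ x => ⟨F f x, ?_, h f hQ x⟩⟩
  have h1 := run_pour_0_3 (f := f) (P.encode x) [] [] [] []
  have h2 := run_encode (f := f) (P.encode x) []
  have h3 := (hp f hf).2 x []
  have h4 := run_decode (f := f) (F f x) []
  have h5 := run_pour_3_0 (f := f) [] [] [] (F f x).reverse []
  simp only [List.append_nil, List.reverse_reverse, List.length_reverse] at h1 h2 h3 h4 h5
  obtain ⟨t, ht, h6⟩ := h1.seq (h2.seq (h3.seq (h4.seq h5)))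
  rw [← initMemory_eq_mem] at h6
  refine h6.run_machine (lt_of_le_of_lt ht ?_)
  have h7 : sz x ≤ 4 * (P.encode x).length + 1 := sz_bits_le _
  have h8 := eval_mono p h7
  have h9 := (length_le_sz (F f x)).trans ((hp f hf).1 x)
  simp only [Polynomial.eval_add, Polynomial.eval_mul, Polynomial.eval_ofNat, Polynomial.eval_X,
    Polynomial.eval_one, Polynomial.eval_comp]
  omega

end GameSym

namespace GameSym

open Polynomial (X)

/-! ## A library of polynomial-time functions -/

variable {α β γ δ σ τ : Type} [Coded α] [Coded β] [Coded γ] [Coded δ] [Coded σ] [Coded τ]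

/-- The step of `PTO.foldl_of_bound` sees only the state and the current entry. A step that depends
on the parameter `a` is obtained by carrying `a` along in the state. -/
theorem PT.foldl_of_bound {L : α → List τ} {S : α → σ} {g : α → σ → τ → σ} (hL : PT L) (hS : PT S)
    (hg : PT fun p : α × σ × τ => g p.1 p.2.1 p.2.2)
    (hB : ∃ p : Polynomial ℕ, ∀ a l, l <+: L a → sz (l.foldl (g a) (S a)) ≤ p.eval (sz a)) :
    PT fun a => (L a).foldl (g a) (S a) := by
  have e : ∀ (l : List τ) (a : α) (s : σ),
      l.foldl (fun (p : α × σ) x => (p.1, g p.1 p.2 x)) (a, s) = (a, l.foldl (g a) s) := by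
    intro l
    induction l with
    | nil => intro a s; rfl
    | cons x l ih => intro a s; simp [ih]
  obtain ⟨p, hp⟩ := hB
  have h1 : PT fun a => (L a).foldl (fun (p : α × σ) x => (p.1, g p.1 p.2 x)) (a, S a) := by
    refine PTO.foldl_of_bound (g := fun _ (p : α × σ) x => (p.1, g p.1 p.2 x)) hL
      (PT.prodMk PT.id hS) ?_ fun r => ⟨X + p + 1, fun f _ a l hl => ?_⟩
    · have h2 : PT fun q : (α × σ) × τ => (q.1.1, q.1.2, q.2) := by fun_prop
      have h3 : PT fun q : (α × σ) × τ => q.1.1 := by fun_prop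
      exact PT.prodMk h3 (PT.comp hg h2)
    · rw [e, sz_pair]
      have := hp a l hl
      simp only [Polynomial.eval_add, Polynomial.eval_X, Polynomial.eval_one]
      omega
  simp only [e] at h1
  exact PT.snd.comp h1

/-- Iteration over a list with additive growth of the intermediate results. -/
theorem PT.foldl {L : α → List τ} {S : α → σ} {g : α → σ → τ → σ} (hL : PT L) (hS : PT S)
    (hg : PT fun p : α × σ × τ => g p.1 p.2.1 p.2.2)
    (hB : ∃ p : Polynomial ℕ, ∀ a s x, sz (g a s x) ≤ sz s + p.eval (sz (a, x))) :
    PT fun a => (L a).foldl (g a) (S a) := by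
  refine PT.foldl_of_bound hL hS hg ?_
  obtain ⟨p, hp⟩ := hB
  obtain ⟨pL, hpL⟩ := hL.sz_le
  obtain ⟨pS, hpS⟩ := hS.sz_le
  refine ⟨pS + pL * p.comp (X + pL + 1), fun a l hl => ?_⟩
  have key : ∀ l : List τ, (∀ x ∈ l, x ∈ L a) → ∀ s,
      sz (l.foldl (g a) s) ≤ sz s + l.length * p.eval (sz a + pL.eval (sz a) + 1) := by
    intro l
    induction l with
    | nil => intro _ s; simp
    | cons x l ih =>
      intro h s
      have h1 := ih (fun y hy => h y (by simp [hy])) (g a s x)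
      have h2 := hp a s x
      have h3 := eval_mono p (show sz (a, x) ≤ sz a + pL.eval (sz a) + 1 by
        have := (sz_le_of_mem (h x (by simp))).trans (hpL a)
        rw [sz_pair]; omega)
      rw [List.foldl_cons, List.length_cons, Nat.succ_mul]
      omega
  have h1 := key l (fun x hx => hl.subset hx) (S a)
  have h2 := hpS a
  have h3 : l.length ≤ pL.eval (sz a) :=
    hl.length_le.trans ((length_le_sz _).trans (hpL a))
  have h4 := Nat.mul_le_mul_right (p.eval (sz a + pL.eval (sz a) + 1)) h3
  simp only [Polynomial.eval_add, Polynomial.eval_mul, Polynomial.eval_X, Polynomial.eval_one,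
    Polynomial.eval_comp]
  omega

/-! ### Booleans -/

@[fun_prop]
theorem PT.bif {c : α → Bool} {F G : α → β} (hc : PT c) (hF : PT F) (hG : PT G) :
    PT fun a => cond (c a) (F a) (G a) := by
  have h1 : PT fun a => (cond (c a) [()] [] : List Unit) :=
    PT.comp (G := fun b : Bool => (cond b [()] [] : List Unit))
      (.of_bits_eq fun b => by cases b <;> rfl) hc
  have h2 : PT fun p : α × Unit × List Unit => F p.1 := hF.comp PT.fst
  have h3 := PT.listCases (G := fun a _ _ => F a) h1 hG h2
  convert h3 using 2 with a
  cases c a <;> rfl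

@[fun_prop]
theorem PT.and {F G : α → Bool} (hF : PT F) (hG : PT G) : PT fun a => F a && G a := by
  have h : PT fun a => cond (F a) (G a) false := by fun_prop
  convert h using 2 with a
  cases F a <;> rfl

@[fun_prop]
theorem PT.or {F G : α → Bool} (hF : PT F) (hG : PT G) : PT fun a => F a || G a := by
  have h : PT fun a => cond (F a) true (G a) := by fun_prop
  convert h using 2 with a
  cases F a <;> rfl

@[fun_prop]
theorem PT.not {F : α → Bool} (hF : PT F) : PT fun a => !(F a) := by
  have h : PT fun a => cond (F a) false true := by fun_prop
  convert h using 2 with a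
  cases F a <;> rfl

@[fun_prop]
theorem PT.beq_bool {F G : α → Bool} (hF : PT F) (hG : PT G) : PT fun a => F a == G a := by
  have h : PT fun a => cond (F a) (G a) (!(G a)) := by fun_prop
  convert h using 2 with a
  cases F a <;> cases G a <;> rfl

/-! ### Lists -/

@[fun_prop]
theorem PT.list_cons {F : α → β} {G : α → List β} (hF : PT F) (hG : PT G) :
    PT fun a => F a :: G a :=
  PT.comp (G := fun p : β × List β => p.1 :: p.2) (.of_bits_eq fun _ => rfl) (PT.prodMk hF hG)

@[fun_prop]
theorem PT.isEmpty {L : α → List β} (hL : PT L) : PT fun a => (L a).isEmpty := by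
  have h := PT.listCases (F := fun _ => true) (G := fun _ _ _ => false) hL (by fun_prop)
    (by fun_prop)
  convert h using 2 with a
  cases L a <;> rfl

@[fun_prop]
theorem PT.tail {L : α → List β} (hL : PT L) : PT fun a => (L a).tail := by
  have h := PT.listCases (F := fun _ => []) (G := fun _ _ t => t) hL (by fun_prop) (by fun_prop)
  convert h using 2 with a
  cases L a <;> rfl

@[fun_prop]
theorem PT.headD {L : α → List β} {D : α → β} (hL : PT L) (hD : PT D) :
    PT fun a => (L a).headD (D a) := by
  have h := PT.listCases (G := fun _ x _ => x) hL hD (by fun_prop)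
  convert h using 2 with a
  cases L a <;> rfl

theorem sz_tail_le (l : List β) : sz l.tail ≤ sz l := by
  cases l with
  | nil => exact le_rfl
  | cons x l => rw [sz_cons, List.tail_cons]; omega

theorem sz_append_le (l t : List β) : sz (l ++ t) ≤ sz l + sz t := by
  induction l with
  | nil => simp
  | cons x l ih => rw [List.cons_append, sz_cons, sz_cons]; omega

theorem foldl_cons_eq {β : Type} (l t : List β) : l.foldl (fun acc x => x :: acc) t = l.reverse ++ t := by
  induction l generalizing t with
  | nil => rfl
  | cons x l ih => simp [ih]

@[fun_prop]
theorem PT.reverse {L : α → List β} (hL : PT L) : PT fun a => (L a).reverse := by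
  have h : PT fun a => (L a).foldl (fun acc x => x :: acc) [] := by
    refine PT.foldl hL (by fun_prop) (by fun_prop) ⟨X, fun a s x => ?_⟩
    rw [sz_cons, sz_pair, Polynomial.eval_X]; omega
  simpa only [foldl_cons_eq, List.append_nil] using h

@[fun_prop]
theorem PT.append {L M : α → List β} (hL : PT L) (hM : PT M) : PT fun a => L a ++ M a := by
  have h : PT fun a => (L a).reverse.foldl (fun acc x => x :: acc) (M a) := by
    refine PT.foldl (by fun_prop) hM (by fun_prop) ⟨X, fun a s x => ?_⟩
    rw [sz_cons, sz_pair, Polynomial.eval_X]; omega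
  simpa only [foldl_cons_eq, List.reverse_reverse] using h

@[fun_prop]
theorem PT.map {L : α → List β} {g : α → β → γ} (hL : PT L) (hg : PT fun p : α × β => g p.1 p.2) :
    PT fun a => (L a).map fun x => g a x := by
  have h : PT fun a => ((L a).foldl (fun acc x => g a x :: acc) []).reverse := by
    refine PT.reverse (PT.foldl hL (by fun_prop) ?_ ?_)
    · have h1 : PT fun p : α × List γ × β => g p.1 p.2.2 :=
        hg.comp (F := fun p : α × List γ × β => (p.1, p.2.2)) (by fun_prop)
      fun_prop
    · obtain ⟨p, hp⟩ := hg.sz_le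
      refine ⟨p + 1, fun a s x => ?_⟩
      have := hp (a, x)
      rw [sz_cons, Polynomial.eval_add, Polynomial.eval_one]
      simp only at this
      omega
  convert h using 2 with a
  have : ∀ (l : List β) (t : List γ), l.foldl (fun acc x => g a x :: acc) t =
      (l.map (g a)).reverse ++ t := by
    intro l
    induction l with
    | nil => intro t; rfl
    | cons x l ih => intro t; simp [ih]
  simp [this]

@[fun_prop]
theorem PT.flatMap {L : α → List β} {g : α → β → List γ} (hL : PT L)
    (hg : PT fun p : α × β => g p.1 p.2) : PT fun a => (L a).flatMap fun x => g a x := by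
  have h : PT fun a => (L a).reverse.foldl (fun acc x => g a x ++ acc) [] := by
    refine PT.foldl (by fun_prop) (by fun_prop) ?_ ?_
    · have h1 : PT fun p : α × List γ × β => g p.1 p.2.2 :=
        hg.comp (F := fun p : α × List γ × β => (p.1, p.2.2)) (by fun_prop)
      fun_prop
    · obtain ⟨p, hp⟩ := hg.sz_le
      refine ⟨p, fun a s x => ?_⟩
      have := hp (a, x)
      have := sz_append_le (g a x) s
      simp only at *
      omega
  convert h using 2 with a
  rw [List.foldl_reverse]
  induction L a with
  | nil => rfl
  | cons x l ih => simp [ih]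

/-! ### Natural numbers -/

@[fun_prop]
theorem PT.replicate_unit {n : α → ℕ} (hn : PT n) : PT fun a => List.replicate (n a) () :=
  PT.comp (G := fun n : ℕ => List.replicate n ()) (.of_bits_eq fun _ => rfl) hn

theorem PT.length_unit {L : α → List Unit} (hL : PT L) : PT fun a => (L a).length := by
  refine PT.comp (G := fun l : List Unit => l.length) (.of_bits_eq fun l => ?_) hL
  rw [bits_nat]
  congr 1
  exact (List.eq_replicate_of_mem fun _ _ => rfl).symm

@[fun_prop]
theorem PT.length {L : α → List β} (hL : PT L) : PT fun a => (L a).length := by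
  have h : PT fun a => ((L a).map fun _ => ()).length := PT.length_unit (by fun_prop)
  simpa using h

@[fun_prop]
theorem PT.replicate {n : α → ℕ} {b : α → β} (hn : PT n) (hb : PT b) :
    PT fun a => List.replicate (n a) (b a) := by
  have h : PT fun a => (List.replicate (n a) ()).map fun _ => b a := by fun_prop
  simpa using h

@[fun_prop]
theorem PT.add {m n : α → ℕ} (hm : PT m) (hn : PT n) : PT fun a => m a + n a := by
  have h : PT fun a => (List.replicate (m a) () ++ List.replicate (n a) ()).length := by fun_prop
  simpa using h

@[fun_prop]
theorem PT.mul {m n : α → ℕ} (hm : PT m) (hn : PT n) : PT fun a => m a * n a := by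
  have h : PT fun a => ((List.replicate (m a) ()).flatMap fun _ =>
    List.replicate (n a) ()).length := by fun_prop
  simpa [List.length_flatMap] using h

/-- Iteration of a function with additive growth. -/
theorem PT.iterate {n : α → ℕ} {S : α → σ} {g : α → σ → σ} (hn : PT n) (hS : PT S)
    (hg : PT fun p : α × σ => g p.1 p.2)
    (hB : ∃ p : Polynomial ℕ, ∀ a s, sz (g a s) ≤ sz s + p.eval (sz a)) :
    PT fun a => (g a)^[n a] (S a) := by
  have h : PT fun a => (List.replicate (n a) ()).foldl (fun s _ => g a s) (S a) := by
    refine PT.foldl (by fun_prop) hS ?_ ?_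
    · exact hg.comp (F := fun p : α × σ × Unit => (p.1, p.2.1)) (by fun_prop)
    · obtain ⟨p, hp⟩ := hB
      refine ⟨p, fun a s x => (hp a s).trans (Nat.add_le_add_left (eval_mono p ?_) _)⟩
      rw [sz_pair]; omega
  convert h using 2 with a
  generalize S a = s
  induction n a generalizing s with
  | zero => rfl
  | succ n ih => rw [Function.iterate_succ_apply, List.replicate_succ, List.foldl_cons, ih]

theorem iterate_tail_eq {β : Type} (l : List β) (n : ℕ) : List.tail^[n] l = l.drop n := by
  induction n generalizing l with
  | zero => rfl
  | succ n ih => rw [Function.iterate_succ_apply, ih, List.drop_tail]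

@[fun_prop]
theorem PT.drop {n : α → ℕ} {L : α → List β} (hn : PT n) (hL : PT L) :
    PT fun a => (L a).drop (n a) := by
  have h : PT fun a => (fun l : List β => l.tail)^[n a] (L a) :=
    PT.iterate (g := fun _ l => l.tail) hn hL (by fun_prop) ⟨0, fun a s => by simpa using sz_tail_le s⟩
  simpa only [iterate_tail_eq] using h

@[fun_prop]
theorem PT.sub {m n : α → ℕ} (hm : PT m) (hn : PT n) : PT fun a => m a - n a := by
  have h : PT fun a => ((List.replicate (m a) ()).drop (n a)).length := by fun_prop
  simpa using h

@[fun_prop]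
theorem PT.take {n : α → ℕ} {L : α → List β} (hn : PT n) (hL : PT L) :
    PT fun a => (L a).take (n a) := by
  have h : PT fun a => ((L a).reverse.drop ((L a).length - n a)).reverse := by fun_prop
  convert h using 2 with a
  rw [← List.reverse_take, List.reverse_reverse]

@[fun_prop]
theorem PT.getD {L : α → List β} {n : α → ℕ} {D : α → β} (hL : PT L) (hn : PT n) (hD : PT D) :
    PT fun a => (L a).getD (n a) (D a) := by
  have h : PT fun a => ((L a).drop (n a)).headD (D a) := by fun_prop
  convert h using 2 with a
  simp [List.getD_eq_getElem?_getD, List.headD_eq_head?_getD]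

@[fun_prop]
theorem PT.beq_nat {m n : α → ℕ} (hm : PT m) (hn : PT n) : PT fun a => m a == n a := by
  have h : PT fun a => (List.replicate (m a - n a) ()).isEmpty &&
    (List.replicate (n a - m a) ()).isEmpty := by fun_prop
  convert h using 2 with a
  rw [Bool.eq_iff_iff]
  simp
  omega

@[fun_prop]
theorem PT.blt {m n : α → ℕ} (hm : PT m) (hn : PT n) : PT fun a => Nat.blt (m a) (n a) := by
  have h : PT fun a => !(List.replicate (n a - m a) ()).isEmpty := by fun_prop
  convert h using 2 with a
  rw [Bool.eq_iff_iff]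
  simp [Nat.blt_eq]
  omega

theorem foldl_length_cons (l : List Unit) :
    l.foldl (fun (s : List ℕ) _ => s.length :: s) [] = (List.range l.length).reverse := by
  induction l using List.reverseRecOn with
  | nil => rfl
  | append_singleton l x ih => simp [ih, List.range_succ]

theorem sz_le_of_forall {l : List β} {B : ℕ} (h : ∀ x ∈ l, sz x ≤ B) :
    sz l ≤ l.length * (B + 1) + 1 := by
  induction l with
  | nil => simp [sz_nil]
  | cons x l ih =>
    have h1 := ih fun y hy => h y (by simp [hy])
    have h2 := h x (by simp)
    rw [sz_cons, List.length_cons, Nat.succ_mul]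
    omega

@[fun_prop]
theorem PT.range {n : α → ℕ} (hn : PT n) : PT fun a => List.range (n a) := by
  have h : PT fun a => ((List.replicate (n a) ()).foldl
      (fun (s : List ℕ) _ => s.length :: s) []).reverse := by
    refine PT.reverse (PT.foldl_of_bound (by fun_prop) (by fun_prop) (by fun_prop) ?_)
    obtain ⟨p, hp⟩ := hn.sz_le
    refine ⟨p * (2 * p + 2) + 1, fun a l hl => ?_⟩
    have h1 := hp a
    have h2 := hl.length_le
    rw [sz_nat] at h1
    rw [List.length_replicate] at h2
    rw [foldl_length_cons]
    refine (sz_le_of_forall (B := 2 * p.eval (sz a) + 1) fun x hx => ?_).trans ?_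
    · simp only [List.mem_reverse, List.mem_range] at hx
      rw [sz_nat]; omega
    · simp only [List.length_reverse, List.length_range, Polynomial.eval_add, Polynomial.eval_mul,
        Polynomial.eval_ofNat, Polynomial.eval_one]
      exact Nat.succ_le_succ (Nat.mul_le_mul (by omega) (by omega))
  simpa [foldl_length_cons] using h

/-- One step of the long division of a number in unary. -/
def divStep (m : ℕ) (s : ℕ × ℕ) : ℕ × ℕ := bif s.2 + 1 == m then (s.1 + 1, 0) else (s.1, s.2 + 1)

theorem divStep_iterate (m n : ℕ) : (divStep m)^[n] (0, 0) = (n / m, n % m) := by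
  induction n with
  | zero => simp
  | succ n ih =>
    rw [Function.iterate_succ_apply', ih, divStep]
    have h := Nat.div_add_mod n m
    -- For `m = 0` the remainder is never reset, in agreement with `n / 0 = 0` and `n % 0 = n`.
    rcases Nat.eq_zero_or_pos m with rfl | hm
    · simp
    by_cases h1 : n % m + 1 = m
    · have h2 : n + 1 = m * (n / m + 1) := by rw [Nat.mul_add]; omega
      have h3 : (n + 1) / m = n / m + 1 := by rw [h2, Nat.mul_div_cancel_left _ hm]
      have h4 : (n + 1) % m = 0 := by rw [h2, Nat.mul_mod_right]
      simp [h1, h3, h4]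
    · have h2 : n % m + 1 < m := by have := Nat.mod_lt n hm; omega
      have h3 : n + 1 = m * (n / m) + (n % m + 1) := by omega
      have h4 : (n + 1) / m = n / m := by
        rw [h3, Nat.mul_add_div hm, Nat.div_eq_of_lt h2, add_zero]
      have h5 : (n + 1) % m = n % m + 1 := by rw [h3, Nat.mul_add_mod, Nat.mod_eq_of_lt h2]
      rw [h4, h5]
      simp only [beq_false_of_ne h1, cond_false]

theorem PT.divMod {m n : α → ℕ} (hm : PT m) (hn : PT n) : PT fun a => (m a / n a, m a % n a) := by
  have h : PT fun a => (divStep (n a))^[m a] (0, 0) := by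
    refine PT.iterate hm (by fun_prop) (by unfold divStep; fun_prop) ⟨2, fun a s => ?_⟩
    unfold divStep
    have h1 := sz_nat s.1
    have h2 := sz_nat s.2
    have h3 : sz s = _ := sz_pair s.1 s.2
    cases s.2 + 1 == n a
    · simp [sz_pair, sz_nat] at *; omega
    · simp [sz_pair, sz_nat] at *; omega
  simpa only [divStep_iterate] using h

@[fun_prop]
theorem PT.div {m n : α → ℕ} (hm : PT m) (hn : PT n) : PT fun a => m a / n a :=
  PT.fst.comp (PT.divMod hm hn)

@[fun_prop]
theorem PT.mod {m n : α → ℕ} (hm : PT m) (hn : PT n) : PT fun a => m a % n a :=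
  PT.snd.comp (PT.divMod hm hn)

/-! ### Searching in lists -/

@[fun_prop]
theorem PT.all {L : α → List β} {g : α → β → Bool} (hL : PT L)
    (hg : PT fun p : α × β => g p.1 p.2) : PT fun a => (L a).all fun x => g a x := by
  have h : PT fun a => ((L a).flatMap fun x => bif g a x then [] else [()]).isEmpty := by
    fun_prop
  convert h using 2 with a
  rw [Bool.eq_iff_iff]
  simp [List.isEmpty_iff, Bool.cond_eq_ite]

/-- Lists can be compared if their entries can. -/
theorem PT.beq_list [BEq β] [LawfulBEq β] (d : β) (h : PT fun p : β × β => p.1 == p.2)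
    {L M : α → List β} (hL : PT L) (hM : PT M) : PT fun a => L a == M a := by
  have h1 : PT fun a => (L a).length == (M a).length && (List.range (L a).length).all fun i =>
      (L a).getD i d == (M a).getD i d := by
    have h2 : PT fun p : α × ℕ => (L p.1).getD p.2 d == (M p.1).getD p.2 d :=
      h.comp (F := fun p : α × ℕ => ((L p.1).getD p.2 d, (M p.1).getD p.2 d)) (by fun_prop)
    fun_prop
  convert h1 using 2 with a
  rw [Bool.eq_iff_iff]
  simp only [beq_iff_eq, Bool.and_eq_true, List.all_eq_true, List.mem_range]
  constructor
  · intro h; simp [h]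
  · rintro ⟨h2, h3⟩
    refine List.ext_getElem h2 fun i hi hi' => ?_
    simpa [hi, hi'] using h3 i hi

@[fun_prop]
theorem PT.beq_list_nat {L M : α → List ℕ} (hL : PT L) (hM : PT M) : PT fun a => L a == M a :=
  PT.beq_list 0 (by fun_prop) hL hM

@[fun_prop]
theorem PT.beq_list_bool {L M : α → List Bool} (hL : PT L) (hM : PT M) : PT fun a => L a == M a :=
  PT.beq_list false (by fun_prop) hL hM

/-- The first position with a given property, or the length of the list. -/
@[fun_prop]
theorem PT.findIdx {L : α → List β} {g : α → β → Bool} (hL : PT L)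
    (hg : PT fun p : α × β => g p.1 p.2) : PT fun a => (L a).findIdx fun x => g a x := by
  have h : PT fun a => (L a).reverse.foldl (fun n x => bif g a x then 0 else n + 1) 0 := by
    refine PT.foldl (by fun_prop) (by fun_prop) ?_ ⟨2, fun a s x => ?_⟩
    · have h1 : PT fun p : α × ℕ × β => g p.1 p.2.2 :=
        hg.comp (F := fun p : α × ℕ × β => (p.1, p.2.2)) (by fun_prop)
      fun_prop
    · cases g a x <;> simp [sz_nat]; omega
  convert h using 2 with a
  rw [List.foldl_reverse]
  induction L a with
  | nil => rfl
  | cons x l ih => simp [List.findIdx_cons, ih]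

end GameSym

namespace GameSym

/-! ## The automorphisms of the graph of a game -/

namespace Game

variable {Γ : Game}

theorem exists_action (i : Fin Γ.N) : ∃ x : Γ.Action, x.1 = i := ⟨⟨i, 0, Γ.numActions_pos i⟩, rfl⟩

theorem exists_plays (x : Γ.Action) : ∃ a : Γ.Profile, Plays a x := by
  classical
  exact ⟨Function.update (fun i => ⟨0, Γ.numActions_pos i⟩) x.1 x.2, by simp [Plays]⟩

theorem plays_iff {a : Γ.Profile} {x : Γ.Action} : Plays a x ↔ x = ⟨x.1, a x.1⟩ := by
  obtain ⟨i, k⟩ := x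
  simp [Plays, eq_comm]

theorem MapsProfile.plays {φ : Equiv.Perm Γ.Action} {a b : Γ.Profile} (h : MapsProfile φ a b)
    {x : Γ.Action} (hx : Plays a x) : Plays b (φ x) := by
  rw [plays_iff.1 hx]; exact h x.1

theorem MapsProfile.unique {φ : Equiv.Perm Γ.Action} {π : Equiv.Perm (Fin Γ.N)}
    (h : ∀ x : Γ.Action, (φ x).1 = π x.1) {a b c : Γ.Profile} (hb : MapsProfile φ a b)
    (hc : MapsProfile φ a c) : b = c := by
  funext j
  have h1 := hb (π.symm j)
  have h2 := hc (π.symm j)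
  have h3 := h ⟨π.symm j, a (π.symm j)⟩
  simp only [Equiv.apply_symm_apply] at h3
  generalize φ ⟨π.symm j, a (π.symm j)⟩ = z at h1 h2 h3
  subst h3
  exact Eq.trans h1 (Eq.symm h2)

theorem IsSymmetry.exists_mapsProfile {φ : Equiv.Perm Γ.Action} (h : IsSymmetry φ)
    (a : Γ.Profile) : ∃ b, MapsProfile φ a b :=
  let ⟨_, hπ, _⟩ := h
  Game.exists_mapsProfile hπ a

theorem IsSymmetry.unique {φ : Equiv.Perm Γ.Action} (h : IsSymmetry φ) {a b c : Γ.Profile}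
    (hb : MapsProfile φ a b) (hc : MapsProfile φ a c) : b = c :=
  let ⟨_, hπ, _⟩ := h
  hb.unique hπ hc

theorem IsSymmetry.fst_eq {φ : Equiv.Perm Γ.Action} (h : IsSymmetry φ) {x y : Γ.Action}
    (hxy : x.1 = y.1) : (φ x).1 = (φ y).1 := by
  obtain ⟨π, hπ, _⟩ := h
  rw [hπ, hπ, hxy]

theorem IsSymmetry.payoff {φ : Equiv.Perm Γ.Action} (h : IsSymmetry φ) {a b : Γ.Profile}
    (hab : MapsProfile φ a b) (x : Γ.Action) : Γ.u x.1 a = Γ.u (φ x).1 b := by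
  obtain ⟨π, hπ, hu⟩ := h
  rw [hπ]; exact hu _ _ _ hab

open Classical in
/-- The action of a symmetry on the vertices of the graph of a game. -/
noncomputable def vertexMap (φ : Equiv.Perm Γ.Action) : Γ.Vertex → Γ.Vertex
  | .player i => .player (φ ⟨i, 0, Γ.numActions_pos i⟩).1
  | .action x => .action (φ x)
  | .profile a => .profile (if h : ∃ b, MapsProfile φ a b then h.choose else a)

theorem vertexMap_player {φ : Equiv.Perm Γ.Action} (h : IsSymmetry φ) (x : Γ.Action) :
    vertexMap φ (.player x.1) = .player (φ x).1 :=
  congrArg Vertex.player (h.fst_eq rfl)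

theorem vertexMap_profile {φ : Equiv.Perm Γ.Action} (h : IsSymmetry φ) {a b : Γ.Profile}
    (hab : MapsProfile φ a b) : vertexMap φ (.profile a) = .profile b := by
  have h1 : ∃ b, MapsProfile φ a b := ⟨b, hab⟩
  rw [vertexMap, dif_pos h1, h.unique h1.choose_spec hab]

theorem vertexMap_mul {φ ψ : Equiv.Perm Γ.Action} (hφ : IsSymmetry φ) (hψ : IsSymmetry ψ)
    (v : Γ.Vertex) : vertexMap (ψ * φ) v = vertexMap ψ (vertexMap φ v) := by
  have h : IsSymmetry (ψ * φ) := Γ.symmetryGroup.mul_mem hψ hφ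
  rcases v with i | x | a
  · obtain ⟨x, rfl⟩ := exists_action i
    rw [vertexMap_player hφ, vertexMap_player hψ, vertexMap_player h, Equiv.Perm.mul_apply]
  · rfl
  · obtain ⟨b, hb⟩ := hφ.exists_mapsProfile a
    obtain ⟨c, hc⟩ := hψ.exists_mapsProfile b
    rw [vertexMap_profile hφ hb, vertexMap_profile hψ hc]
    exact vertexMap_profile h fun i => hc.plays (hb i)

theorem vertexMap_one (v : Γ.Vertex) : vertexMap 1 v = v := by
  have h : IsSymmetry (1 : Equiv.Perm Γ.Action) := Γ.symmetryGroup.one_mem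
  rcases v with i | x | a
  · obtain ⟨x, rfl⟩ := exists_action i
    rw [vertexMap_player h]; rfl
  · rfl
  · exact vertexMap_profile h fun i => rfl

variable {lam lam' : ℕ}

theorem adj_player_action {l : ℚ} {i : Fin Γ.N} {x : Γ.Action} :
    (Γ.labeledGraph lam lam' l).Adj (.player i) (.action x) ↔ x.1 = i ∧ l = lam := by
  simp [labeledGraph]

theorem adj_action_profile {l : ℚ} {x : Γ.Action} {a : Γ.Profile} :
    (Γ.labeledGraph lam lam' l).Adj (.action x) (.profile a) ↔ Plays a x ∧ l = lam' := by
  simp [labeledGraph]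

theorem adj_player_profile {l : ℚ} {i : Fin Γ.N} {a : Γ.Profile} :
    (Γ.labeledGraph lam lam' l).Adj (.player i) (.profile a) ↔ l = Γ.u i a := by
  simp [labeledGraph]

theorem adj_vertexMap {φ : Equiv.Perm Γ.Action} (h : IsSymmetry φ) {l : ℚ} {v w : Γ.Vertex}
    (hvw : (Γ.labeledGraph lam lam' l).Adj v w) :
    (Γ.labeledGraph lam lam' l).Adj (vertexMap φ v) (vertexMap φ w) := by
  have pa : ∀ i x, (Γ.labeledGraph lam lam' l).Adj (.player i) (.action x) →
      (Γ.labeledGraph lam lam' l).Adj (vertexMap φ (.player i)) (vertexMap φ (.action x)) := by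
    intro i x hix
    obtain ⟨rfl, hl⟩ := adj_player_action.1 hix
    rw [vertexMap_player h]
    exact adj_player_action.2 ⟨rfl, hl⟩
  have ap : ∀ x a, (Γ.labeledGraph lam lam' l).Adj (.action x) (.profile a) →
      (Γ.labeledGraph lam lam' l).Adj (vertexMap φ (.action x)) (vertexMap φ (.profile a)) := by
    intro x a hxa
    obtain ⟨hx, hl⟩ := adj_action_profile.1 hxa
    obtain ⟨b, hb⟩ := h.exists_mapsProfile a
    rw [vertexMap_profile h hb]
    exact adj_action_profile.2 ⟨hb.plays hx, hl⟩
  have pp : ∀ i a, (Γ.labeledGraph lam lam' l).Adj (.player i) (.profile a) →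
      (Γ.labeledGraph lam lam' l).Adj (vertexMap φ (.player i)) (vertexMap φ (.profile a)) := by
    intro i a hia
    obtain ⟨x, rfl⟩ := exists_action i
    obtain ⟨b, hb⟩ := h.exists_mapsProfile a
    rw [vertexMap_profile h hb, vertexMap_player h]
    exact adj_player_profile.2 ((adj_player_profile.1 hia).trans (h.payoff hb x))
  rcases v with i | x | a <;> rcases w with j | y | b
  · simp [labeledGraph] at hvw
  · exact pa _ _ hvw
  · exact pp _ _ hvw
  · exact (pa _ _ hvw.symm).symm
  · simp [labeledGraph] at hvw
  · exact ap _ _ hvw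
  · exact (pp _ _ hvw.symm).symm
  · exact (ap _ _ hvw.symm).symm
  · simp [labeledGraph] at hvw

variable (Γ) in
/-- The action of the symmetry group on the vertices of the graph of a game. -/
noncomputable def vertexHom : Γ.symmetryGroup →* Equiv.Perm Γ.Vertex :=
  MonoidHom.toHomPerm
    { toFun := fun φ => vertexMap φ.1
      map_one' := funext vertexMap_one
      map_mul' := fun ψ φ => funext (vertexMap_mul φ.2 ψ.2) }

theorem vertexHom_apply (φ : Γ.symmetryGroup) (v : Γ.Vertex) :
    Γ.vertexHom φ v = vertexMap φ.1 v := rfl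

theorem vertexHom_mem (φ : Γ.symmetryGroup) :
    Γ.vertexHom φ ∈ (Γ.labeledGraph lam lam').autGroup := by
  intro l v w
  refine ⟨fun h => ?_, adj_vertexMap φ.2⟩
  -- Symmetries preserve edges; applied to the inverse symmetry, this shows that they also reflect
  -- them.
  have h1 := adj_vertexMap (φ⁻¹).2 h
  have h2 : ∀ v, vertexMap (φ⁻¹).1 (Γ.vertexHom φ v) = v := fun v => by
    rw [← vertexHom_apply, ← Equiv.Perm.mul_apply, ← map_mul, inv_mul_cancel, map_one]; rfl
  rwa [h2, h2] at h1

section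

variable (hne : lam ≠ lam') (hu : ∀ i a, Γ.u i a ≠ lam ∧ Γ.u i a ≠ lam')
  {σ : Equiv.Perm Γ.Vertex} (hσ : σ ∈ (Γ.labeledGraph lam lam').autGroup)

include hne hu hσ

/-- Every action lies on an edge labeled `lam`, to its player, and on an edge labeled `lam'`, to a
profile. As payoffs avoid both labels, a player lies on no edge labeled `lam'` and a profile on none
labeled `lam`. -/
theorem autGroup_action (x : Γ.Action) : ∃ y, σ (.action x) = .action y := by
  obtain ⟨a, ha⟩ := exists_plays x
  have hne' : (lam : ℚ) ≠ lam' := by exact_mod_cast hne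
  have h1 := (hσ lam (.player x.1) (.action x)).2 (adj_player_action.2 ⟨rfl, rfl⟩)
  have h2 := (hσ lam' (.action x) (.profile a)).2 (adj_action_profile.2 ⟨ha, rfl⟩)
  rcases hx : σ (.action x) with i | y | b
  · rw [hx] at h2
    generalize σ (.profile a) = w at h2
    rcases w with j | z | c
    · simp [labeledGraph] at h2
    · exact absurd (adj_player_action.1 h2).2 hne'.symm
    · exact absurd (adj_player_profile.1 h2).symm (hu i c).2
  · exact ⟨y, rfl⟩
  · rw [hx] at h1
    generalize σ (.player x.1) = w at h1
    rcases w with j | z | c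
    · exact absurd (adj_player_profile.1 h1).symm (hu j b).1
    · exact absurd (adj_action_profile.1 h1).2 hne'
    · simp [labeledGraph] at h1

/-- The edge labeled `lam` at an action leads to its player and to nothing else, so the image of the
player is determined by the image of any of its actions. -/
theorem autGroup_player (x : Γ.Action) :
    ∃ y, σ (.action x) = .action y ∧ σ (.player x.1) = .player y.1 := by
  obtain ⟨y, hy⟩ := autGroup_action hne hu hσ x
  have hne' : (lam : ℚ) ≠ lam' := by exact_mod_cast hne
  have h1 := (hσ lam (.player x.1) (.action x)).2 (adj_player_action.2 ⟨rfl, rfl⟩)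
  refine ⟨y, hy, ?_⟩
  rw [hy] at h1
  rcases hx : σ (.player x.1) with i | z | b
  · rw [hx] at h1
    rw [(adj_player_action.1 h1).1]
  · rw [hx] at h1; simp [labeledGraph] at h1
  · rw [hx] at h1
    exact absurd (adj_action_profile.1 h1.symm).2 hne'

theorem autGroup_profile (a : Γ.Profile) : ∃ b, σ (.profile a) = .profile b ∧
    ∀ x y, Plays a x → σ (.action x) = .action y → Plays b y := by
  have hne' : (lam : ℚ) ≠ lam' := by exact_mod_cast hne
  have key : ∀ x, Plays a x → ∃ b y, σ (.profile a) = .profile b ∧ σ (.action x) = .action y ∧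
      Plays b y := by
    intro x hx
    obtain ⟨y, hy⟩ := autGroup_action hne hu hσ x
    have h1 := (hσ lam' (.action x) (.profile a)).2 (adj_action_profile.2 ⟨hx, rfl⟩)
    rw [hy] at h1
    rcases hb : σ (.profile a) with i | z | b
    · rw [hb] at h1
      exact absurd (adj_player_action.1 h1.symm).2 hne'.symm
    · rw [hb] at h1; simp [labeledGraph] at h1
    · rw [hb] at h1
      exact ⟨b, y, rfl, hy, (adj_action_profile.1 h1).1⟩
  -- In a game without players `key` is vacuous. But if the image were a player or an action, there
  -- would be a player, hence an action played in `a` to which `key` applies.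
  have h1 : ∃ b, σ (.profile a) = .profile b := by
    rcases hb : σ (.profile a) with i | x | b
    · obtain ⟨b, y, h, _⟩ := key ⟨i, a i⟩ rfl
      exact ⟨b, hb.symm.trans h⟩
    · obtain ⟨b, y, h, _⟩ := key ⟨x.1, a x.1⟩ rfl
      exact ⟨b, hb.symm.trans h⟩
    · exact ⟨b, rfl⟩
  obtain ⟨b, hb⟩ := h1
  refine ⟨b, hb, fun x y hx hy => ?_⟩
  obtain ⟨b', y', h1, h2, h3⟩ := key x hx
  rw [hb] at h1
  rw [hy] at h2
  cases h1
  cases h2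
  exact h3

theorem exists_vertexHom_eq : ∃ φ : Γ.symmetryGroup, Γ.vertexHom φ = σ := by
  have hσ' : σ⁻¹ ∈ (Γ.labeledGraph lam lam').autGroup := inv_mem hσ
  choose f hf hfp using autGroup_player hne hu hσ
  choose g hg hgp using autGroup_player hne hu hσ'
  have hfg : ∀ y, f (g y) = y := fun y => by
    have h1 := hf (g y)
    rw [← hg y, show σ (σ⁻¹ (.action y)) = .action y from σ.apply_symm_apply _] at h1
    exact (Vertex.action.inj h1).symm
  have hgf : ∀ y, g (f y) = y := fun y => by
    have h1 := hg (f y)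
    rw [← hf y, show σ⁻¹ (σ (.action y)) = .action y from σ.symm_apply_apply _] at h1
    exact (Vertex.action.inj h1).symm
  let z : Fin Γ.N → Γ.Action := fun i => ⟨i, 0, Γ.numActions_pos i⟩
  have hf1 : ∀ x, (f x).1 = (f (z x.1)).1 := fun x =>
    Vertex.player.inj ((hfp x).symm.trans (hfp (z x.1)))
  have hg1 : ∀ x, (g x).1 = (g (z x.1)).1 := fun x =>
    Vertex.player.inj ((hgp x).symm.trans (hgp (z x.1)))
  let φ : Equiv.Perm Γ.Action := ⟨f, g, hgf, hfg⟩
  let π : Equiv.Perm (Fin Γ.N) :=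
    ⟨fun i => (f (z i)).1, fun i => (g (z i)).1, fun i => by
      show (g (z (f (z i)).1)).1 = i
      rw [← hg1, hgf], fun i => by
      show (f (z (g (z i)).1)).1 = i
      rw [← hf1, hfg]⟩
  have hφ : IsSymmetry φ := by
    refine ⟨π, hf1, fun i a b hab => ?_⟩
    obtain ⟨b', hb', hp⟩ := autGroup_profile hne hu hσ a
    have h2 : MapsProfile φ a b' := fun i => hp ⟨i, a i⟩ _ rfl (hf _)
    obtain rfl := hab.unique (π := π) hf1 h2
    -- The image of the edge between `i` and `a` carries the same label, which is the required
    -- equality of payoffs.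
    have h3 := (hσ (Γ.u i a) (.player i) (.profile a)).2 (adj_player_profile.2 rfl)
    rw [hb', hfp (z i)] at h3
    exact adj_player_profile.1 h3
  refine ⟨⟨φ, hφ⟩, Equiv.ext fun v => ?_⟩
  rw [vertexHom_apply]
  rcases v with i | x | a
  · exact (hfp (z i)).symm
  · exact (hf x).symm
  · obtain ⟨b', hb', hp⟩ := autGroup_profile hne hu hσ a
    rw [hb']
    exact vertexMap_profile hφ fun i => hp ⟨i, a i⟩ _ rfl (hf _)

end

theorem vertexHom_injective : Function.Injective Γ.vertexHom := by
  intro φ ψ h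
  refine Subtype.ext (Equiv.ext fun x => ?_)
  have h1 := congrArg (fun σ => σ (.action x)) h
  exact Vertex.action.inj h1

theorem exists_symmetryGroup_mulEquiv_autGroup (hne : lam ≠ lam')
    (hu : ∀ i a, Γ.u i a ≠ lam ∧ Γ.u i a ≠ lam') :
    ∃ M : Γ.symmetryGroup ≃* (Γ.labeledGraph lam lam').autGroup,
      ∀ φ : Γ.symmetryGroup,
        (∀ x : Γ.Action, (M φ).1 (.player x.1) = .player (φ.1 x).1) ∧
        (∀ x : Γ.Action, (M φ).1 (.action x) = .action (φ.1 x)) ∧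
        (∀ a b : Γ.Profile, MapsProfile φ.1 a b → (M φ).1 (.profile a) = .profile b) := by
  refine ⟨MulEquiv.ofBijective (Γ.vertexHom.codRestrict _ vertexHom_mem) ⟨?_, ?_⟩, fun φ =>
    ⟨vertexMap_player φ.2, fun x => rfl, fun a b => vertexMap_profile φ.2⟩⟩
  · exact fun φ ψ h => vertexHom_injective (congrArg Subtype.val h)
  · rintro ⟨σ, hσ⟩
    obtain ⟨φ, rfl⟩ := exists_vertexHom_eq hne hu hσ
    exact ⟨φ, rfl⟩

end Game

end GameSym

namespace GameSym

/-! ## Two-player games -/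

/-- The two-player game with the given numbers of actions and payoffs. -/
def gridGame {m₀ m₁ : ℕ} (h₀ : 0 < m₀) (h₁ : 0 < m₁) (u : Fin 2 → Fin m₀ → Fin m₁ → ℚ) : Game where
  N := 2
  numActions := ![m₀, m₁]
  numActions_pos := fun i => by fin_cases i <;> simp [h₀, h₁]
  u := fun i a => u i (a 0) (a 1)

namespace gridGame

variable {m₀ m₁ : ℕ} {h₀ : 0 < m₀} {h₁ : 0 < m₁} {u : Fin 2 → Fin m₀ → Fin m₁ → ℚ}

def fst (v : Fin m₀) : (gridGame h₀ h₁ u).Action := ⟨(0 : Fin 2), v⟩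

def snd (w : Fin m₁) : (gridGame h₀ h₁ u).Action := ⟨(1 : Fin 2), w⟩

def profile (v : Fin m₀) (w : Fin m₁) : (gridGame h₀ h₁ u).Profile :=
  fun i : Fin 2 => match i with
    | 0 => v
    | 1 => w

theorem forall_action {P : (gridGame h₀ h₁ u).Action → Prop} :
    (∀ x, P x) ↔ (∀ v, P (fst v)) ∧ ∀ w, P (snd w) := by
  refine ⟨fun h => ⟨fun v => h _, fun w => h _⟩, fun h x => ?_⟩
  obtain ⟨i, k⟩ := x
  change Fin 2 at i
  fin_cases i
  · exact h.1 k
  · exact h.2 k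

theorem eq_fst {x : (gridGame h₀ h₁ u).Action} (h : x.1 = (0 : Fin 2)) : ∃ v, x = fst v := by
  have key : ∀ x : (gridGame h₀ h₁ u).Action, x.1 = (0 : Fin 2) → ∃ v, x = fst v := by
    refine forall_action.2 ⟨fun v _ => ⟨v, rfl⟩, fun w h => ?_⟩
    exact absurd h (by decide : ¬ (1 : Fin 2) = 0)
  exact key x h

theorem eq_snd {x : (gridGame h₀ h₁ u).Action} (h : x.1 = (1 : Fin 2)) : ∃ w, x = snd w := by
  have key : ∀ x : (gridGame h₀ h₁ u).Action, x.1 = (1 : Fin 2) → ∃ w, x = snd w := by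
    refine forall_action.2 ⟨fun v h => ?_, fun w _ => ⟨w, rfl⟩⟩
    exact absurd h (by decide : ¬ (0 : Fin 2) = 1)
  exact key x h

theorem fst_injective : Function.Injective (fst : Fin m₀ → (gridGame h₀ h₁ u).Action) :=
  fun _ _ h => by cases h; rfl

theorem snd_injective : Function.Injective (snd : Fin m₁ → (gridGame h₀ h₁ u).Action) :=
  fun _ _ h => by cases h; rfl

/-- The bijection that acts as given on the actions of each player. -/
def perm (φ₀ : Equiv.Perm (Fin m₀)) (φ₁ : Equiv.Perm (Fin m₁)) :
    Equiv.Perm (gridGame h₀ h₁ u).Action :=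
  Equiv.sigmaCongrRight fun i : Fin 2 => match i with
    | 0 => φ₀
    | 1 => φ₁

theorem isSymmetry_perm {φ₀ : Equiv.Perm (Fin m₀)} {φ₁ : Equiv.Perm (Fin m₁)}
    (h : ∀ i v w, u i (φ₀ v) (φ₁ w) = u i v w) :
    Game.IsSymmetry (perm φ₀ φ₁ : Equiv.Perm (gridGame h₀ h₁ u).Action) := by
  refine ⟨1, fun x => rfl, fun i a b hab => ?_⟩
  have h1 : b (0 : Fin 2) = φ₀ (a (0 : Fin 2)) := hab (0 : Fin 2)
  have h2 : b (1 : Fin 2) = φ₁ (a (1 : Fin 2)) := hab (1 : Fin 2)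
  exact (h i (a (0 : Fin 2)) (a (1 : Fin 2))).symm.trans (congrArg₂ (u i) h1 h2).symm

theorem exists_eq_perm {φ : Equiv.Perm (gridGame h₀ h₁ u).Action} (hφ : Game.IsSymmetry φ)
    (h : ∀ x, (φ x).1 = x.1) : ∃ φ₀ φ₁, φ = perm φ₀ φ₁ ∧ ∀ i v w, u i (φ₀ v) (φ₁ w) = u i v w := by
  have h' : ∀ x, (φ.symm x).1 = x.1 := fun x => by
    rw [← h, Equiv.apply_symm_apply]
  choose f hf using fun v : Fin m₀ => eq_fst (h (fst v))
  choose f' hf' using fun v : Fin m₀ => eq_fst (h' (fst v))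
  choose g hg using fun v : Fin m₁ => eq_snd (h (snd v))
  choose g' hg' using fun v : Fin m₁ => eq_snd (h' (snd v))
  let φ₀ : Equiv.Perm (Fin m₀) := ⟨f, f', fun v => fst_injective (h₀ := h₀) (h₁ := h₁) (u := u) (by
    rw [← hf', ← hf, Equiv.symm_apply_apply]), fun v =>
      fst_injective (h₀ := h₀) (h₁ := h₁) (u := u) (by
    rw [← hf, ← hf', Equiv.apply_symm_apply])⟩
  let φ₁ : Equiv.Perm (Fin m₁) := ⟨g, g', fun v => snd_injective (h₀ := h₀) (h₁ := h₁) (u := u) (by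
    rw [← hg', ← hg, Equiv.symm_apply_apply]), fun v =>
      snd_injective (h₀ := h₀) (h₁ := h₁) (u := u) (by
    rw [← hg, ← hg', Equiv.apply_symm_apply])⟩
  have e : φ = perm φ₀ φ₁ := Equiv.ext (forall_action.2 ⟨hf, hg⟩)
  refine ⟨φ₀, φ₁, e, fun i v w => ?_⟩
  have h1 : Game.MapsProfile φ (profile v w) (profile (φ₀ v) (φ₁ w)) := by
    intro i
    change Fin 2 at i
    rw [e]
    fin_cases i <;> rfl
  have h2 := hφ.payoff h1 ⟨i, profile v w i⟩
  rw [h] at h2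
  exact h2.symm

end gridGame

theorem perm_fin_two_eq_one {π : Equiv.Perm (Fin 2)} (h : π 0 = 0) : π = 1 := by
  refine Equiv.ext fun i => ?_
  fin_cases i
  · exact h
  · have : π 1 ≠ π 0 := fun h => by simpa using π.injective h
    show π 1 = 1
    omega

/-! ## The symmetries of the game of a graph -/

namespace graphGame

variable {n : ℕ}

/-- The permutation of `Fin (n + 1)` that extends a permutation of `Fin n`. -/
def extend (ψ : Equiv.Perm (Fin n)) : Equiv.Perm (Fin (n + 1)) :=
  finSuccEquivLast.symm.permCongr (Equiv.optionCongr ψ)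

theorem extend_castSucc (ψ : Equiv.Perm (Fin n)) (v : Fin n) :
    extend ψ v.castSucc = (ψ v).castSucc := by
  simp [extend, Equiv.permCongr_apply]

theorem extend_last (ψ : Equiv.Perm (Fin n)) : extend ψ (Fin.last n) = Fin.last n := by
  simp [extend, Equiv.permCongr_apply]

open Classical in
/-- The case distinction in the definition of the payoffs. -/
noncomputable def kind (G : SimpleGraph (Fin n)) (v : Fin n) (w : Fin (n + 1)) : Fin 4 :=
  if w = Fin.last n then 0
  else if w = v.castSucc then 3
  else if ∃ w' : Fin n, w = w'.castSucc ∧ G.Adj v w' then 2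
  else 1

theorem kind_eq_zero {G : SimpleGraph (Fin n)} {v : Fin n} {w : Fin (n + 1)} :
    kind G v w = 0 ↔ w = Fin.last n := by
  unfold kind
  split_ifs <;> simp_all

theorem kind_eq_three {G : SimpleGraph (Fin n)} {v : Fin n} {w : Fin (n + 1)} :
    kind G v w = 3 ↔ w = v.castSucc := by
  unfold kind
  split_ifs with h1 h2 h3
  · rw [h1]; simp [v.castSucc_ne_last.symm]
  · simp_all
  · simp_all
  · simp_all

theorem kind_eq_two {G : SimpleGraph (Fin n)} {v w : Fin n} :
    kind G v w.castSucc = 2 ↔ G.Adj v w := by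
  unfold kind
  rw [if_neg w.castSucc_ne_last]
  split_ifs with h2 h3
  · obtain rfl := Fin.castSucc_injective _ h2
    simp
  · obtain ⟨w', h, h'⟩ := h3
    obtain rfl := Fin.castSucc_injective _ h
    simp [h']
  · have : ¬ G.Adj v w := fun h => h3 ⟨w, rfl, h⟩
    simp [this]

theorem kind_extend {G : SimpleGraph (Fin n)} (ψ : G ≃g G) (v : Fin n) (w : Fin (n + 1)) :
    kind G (ψ v) (extend ψ.toEquiv w) = kind G v w := by
  induction w using Fin.lastCases with
  | last => rw [extend_last, kind_eq_zero.2 rfl, kind_eq_zero.2 rfl]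
  | cast w =>
    rw [extend_castSucc]
    show kind G (ψ v) (ψ w).castSucc = _
    have h1 : (ψ w).castSucc = (ψ v).castSucc ↔ w.castSucc = v.castSucc := by
      simp
    have h2 : (∃ w', (ψ w).castSucc = w'.castSucc ∧ G.Adj (ψ v) w') ↔
        ∃ w', w.castSucc = w'.castSucc ∧ G.Adj v w' := by
      simp [ψ.map_adj_iff]
    classical
    unfold kind
    exact if_congr (by simp) rfl (if_congr h1 rfl (if_congr h2 rfl rfl))

variable {hn : 0 < n} {G : SimpleGraph (Fin n)} {c d : Fin 4 → ℚ}

/-- The payoffs as functions of the two actions. -/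
noncomputable def payoff (G : SimpleGraph (Fin n)) (c d : Fin 4 → ℚ) (i : Fin 2) (v : Fin n)
    (w : Fin (n + 1)) : ℚ := if i = 0 then c (kind G v w) else d (kind G v w)

/-- The symmetry that acts as a given automorphism of the graph on the vertices. -/
noncomputable def symmetry (ψ : G ≃g G) : (graphGame hn G c d).symmetryGroup :=
  ⟨gridGame.perm (h₀ := hn) (h₁ := n.succ_pos) (u := payoff G c d)
    ψ.toEquiv (extend ψ.toEquiv), gridGame.isSymmetry_perm fun i v w => by
      have := kind_extend ψ v w
      simp only [payoff, RelIso.coe_fn_toEquiv]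
      rw [this]⟩

theorem symmetry_snd (ψ : G ≃g G) (w : Fin (n + 1)) :
    (symmetry ψ : (graphGame hn G c d).symmetryGroup).1 (snd w) = snd (extend ψ.toEquiv w) := rfl

theorem fst_injective : Function.Injective (fst : Fin n → (graphGame hn G c d).Action) :=
  gridGame.fst_injective (h₀ := hn) (h₁ := n.succ_pos) (u := payoff G c d)

theorem action_cases {P : (graphGame hn G c d).Action → Prop} (h1 : ∀ v, P (fst v))
    (h2 : ∀ v : Fin n, P (snd v.castSucc)) (h3 : P (snd (Fin.last n))) (x) : P x := by
  refine (gridGame.forall_action (h₀ := hn) (h₁ := n.succ_pos) (u := payoff G c d) (P := P)).2 ⟨h1, fun w => ?_⟩ x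
  induction w using Fin.lastCases with
  | last => exact h3
  | cast w => exact h2 w

/-- The players are not exchanged, since the second one has one action more than the first. As `c`
is injective, the payoffs of the first player determine `kind`. Kind `0` shows that the further
action is fixed, kind `3` that both players' vertices are permuted in the same way, and kind `2`
that this permutation preserves adjacency in both directions. -/
theorem symmetry_surjective (hc : Function.Injective c) :
    Function.Surjective (symmetry : G ≃g G → (graphGame hn G c d).symmetryGroup) := by
  rintro ⟨φ, hφ⟩
  have hp : ∀ x, (φ x).1 = x.1 := by
    obtain ⟨π, hπ, -⟩ := id hφ
    change Equiv.Perm (Fin 2) at π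
    suffices h : π 0 = 0 by
      obtain rfl := perm_fin_two_eq_one h
      exact hπ
    by_contra h
    have h1 : π 1 = 0 := by
      obtain ⟨j, hj⟩ := π.surjective 0
      have : j ≠ 0 := by rintro rfl; exact h hj
      obtain rfl : j = 1 := by omega
      exact hj
    choose f hf using fun w : Fin (n + 1) =>
      gridGame.eq_fst (h₀ := hn) (h₁ := n.succ_pos) (u := payoff G c d) (x := φ (snd w)) ((hπ (snd w)).trans h1)
    have hinj : Function.Injective f := by
      intro w w' hw
      have := (hf w).trans ((congrArg gridGame.fst hw).trans (hf w').symm)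
      exact gridGame.snd_injective (h₀ := hn) (h₁ := n.succ_pos) (u := payoff G c d) (φ.injective this)
    have := Fintype.card_le_of_injective f hinj
    simp at this
  obtain ⟨φ₀, φ₁, rfl, hu⟩ := gridGame.exists_eq_perm (h₀ := hn) (h₁ := n.succ_pos) (u := payoff G c d) hφ hp
  have hk : ∀ v w, kind G (φ₀ v) (φ₁ w) = kind G v w := fun v w => by
    have := hu 0 v w
    simp only [payoff, if_true] at this
    exact hc this
  have h1 : φ₁ (Fin.last n) = Fin.last n := by
    have := hk ⟨0, hn⟩ (Fin.last n)
    rwa [kind_eq_zero.2 rfl, kind_eq_zero] at this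
  have h2 : ∀ v, φ₁ v.castSucc = (φ₀ v).castSucc := fun v => by
    have := hk v v.castSucc
    rwa [kind_eq_three.2 rfl, kind_eq_three] at this
  let ψ : G ≃g G := ⟨φ₀, fun {v w} => by
    have := hk v w.castSucc
    rw [h2] at this
    rw [← kind_eq_two, ← kind_eq_two, this]⟩
  refine ⟨ψ, Subtype.ext (Equiv.ext ?_)⟩
  refine action_cases (fun v => rfl) (fun v => ?_) ?_
  · rw [symmetry_snd, extend_castSucc]
    exact congrArg snd (h2 v).symm
  · rw [symmetry_snd, extend_last]
    exact congrArg snd h1.symm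

theorem exists_mulEquiv_symmetryGroup (hc : Function.Injective c) :
    ∃ M : (G ≃g G) ≃* (graphGame hn G c d).symmetryGroup,
      ∀ ψ : G ≃g G,
        (∀ v : Fin n, (M ψ).1 (fst v) = fst (ψ v) ∧
          (M ψ).1 (snd v.castSucc) = snd (ψ v).castSucc) ∧
        (M ψ).1 (snd (Fin.last n)) = snd (Fin.last n) := by
  have hmul : ∀ ψ χ : G ≃g G, (symmetry (ψ * χ) : (graphGame hn G c d).symmetryGroup) =
      symmetry ψ * symmetry χ := by
    intro ψ χ
    refine Subtype.ext (Equiv.ext ?_)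
    rw [Subgroup.coe_mul]
    refine action_cases (fun v => rfl) (fun v => ?_) ?_
    · rw [Equiv.Perm.mul_apply]
      simp only [symmetry_snd, extend_castSucc]
      rfl
    · rw [Equiv.Perm.mul_apply]
      simp only [symmetry_snd, extend_last]
  have hinj : Function.Injective (symmetry : G ≃g G → (graphGame hn G c d).symmetryGroup) :=
    fun ψ χ h => RelIso.ext fun v => fst_injective (congrArg (fun φ => φ.1 (fst v)) h)
  refine ⟨MulEquiv.mk' (Equiv.ofBijective symmetry ⟨hinj, symmetry_surjective hc⟩) hmul,
    fun ψ => ⟨fun v => ⟨rfl, ?_⟩, ?_⟩⟩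
  · exact (symmetry_snd ψ _).trans (congrArg snd (extend_castSucc _ _))
  · exact (symmetry_snd ψ _).trans (congrArg snd (extend_last _))

end graphGame

end GameSym

namespace GameSym

/-! ## A game in which two graphs can be swapped if and only if they are isomorphic -/

section pairMatrix

open Classical in
/-- The relations between the vertices of a graph and one further vertex `none`. -/
noncomputable def pointedMatrix {n : ℕ} (G : SimpleGraph (Fin n)) (a : ℕ) :
    Option (Fin n) → Option (Fin n) → ℕ
  | none, none => a
  | none, some _ => 1
  | some _, none => 1
  | some v, some w => if v = w then 3 else if G.Adj v w then 2 else 1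

/-- The relations between the vertices of the disjoint union of two graphs, each of them with one
further vertex. -/
noncomputable def pairMatrix {n n' : ℕ} (G : SimpleGraph (Fin n)) (H : SimpleGraph (Fin n'))
    (a : ℕ) : Option (Fin n) ⊕ Option (Fin n') → Option (Fin n) ⊕ Option (Fin n') → ℕ
  | .inl v, .inl w => pointedMatrix G a v w
  | .inr v, .inr w => pointedMatrix H 4 v w
  | _, _ => 0

variable {n n' : ℕ} {G : SimpleGraph (Fin n)} {H : SimpleGraph (Fin n')} {a : ℕ}

theorem three_le_pointedMatrix (ha : 4 ≤ a) {v w : Option (Fin n)} :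
    3 ≤ pointedMatrix G a v w ↔ v = w := by
  rcases v with _ | v <;> rcases w with _ | w <;> simp only [pointedMatrix]
  · simp; omega
  · simp
  · simp
  · split_ifs with h <;> simp [h]

theorem pointedMatrix_eq_two {v w : Fin n} :
    pointedMatrix G a (some v) (some w) = 2 ↔ G.Adj v w := by
  simp only [pointedMatrix]
  split_ifs with h1 h2
  · subst h1; simp
  · simp [h2]
  · simp [h2]

/-- The entries reveal the diagonal; in the matrix game this forces the two players' permutations to
agree. -/
theorem three_le_pairMatrix (ha : 4 ≤ a) {v w : Option (Fin n) ⊕ Option (Fin n')} :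
    3 ≤ pairMatrix G H a v w ↔ v = w := by
  rcases v with v | v <;> rcases w with w | w <;> simp [pairMatrix, three_le_pointedMatrix, ha]

theorem pairMatrix_lt (ha : a ≤ 5) (v w : Option (Fin n) ⊕ Option (Fin n')) :
    pairMatrix G H a v w < 6 := by
  have h : ∀ {n} {G : SimpleGraph (Fin n)} {a} (_ : a ≤ 5) (v w : Option (Fin n)),
      pointedMatrix G a v w < 6 := by
    intro n G a ha v w
    rcases v with _ | v <;> rcases w with _ | w <;> simp only [pointedMatrix]
    · omega
    · omega
    · omega
    · split_ifs <;> omega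
  rcases v with v | v <;> rcases w with w | w <;> simp only [pairMatrix]
  · exact h ha _ _
  · omega
  · omega
  · exact h (by omega) _ _

/-- The permutations that preserve a matrix. -/
def Preserves {V : Type} (C : V → V → ℕ) (σ : Equiv.Perm V) : Prop :=
  ∀ v w, C (σ v) (σ w) = C v w

theorem Preserves.symm {V : Type} {C : V → V → ℕ} {σ : Equiv.Perm V} (h : Preserves C σ) :
    Preserves C σ.symm := fun v w => by
  simpa using (h (σ.symm v) (σ.symm w)).symm

theorem exists_preserves_of_iso (ψ : G ≃g H) :
    ∃ σ, Preserves (pairMatrix G H 4) σ ∧ σ (.inl none) ≠ .inl none := by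
  refine ⟨(Equiv.sumComm _ _).trans (Equiv.sumCongr (Equiv.optionCongr ψ.toEquiv.symm)
    (Equiv.optionCongr ψ.toEquiv)), fun v w => ?_, by simp⟩
  have h1 : ∀ v w, pointedMatrix H 4 (Equiv.optionCongr ψ.toEquiv v)
      (Equiv.optionCongr ψ.toEquiv w) = pointedMatrix G 4 v w := by
    intro v w
    rcases v with _ | v <;> rcases w with _ | w
    · rfl
    · rfl
    · rfl
    · have h2 : ψ v = ψ w ↔ v = w := ψ.injective.eq_iff
      classical
      simp only [Equiv.optionCongr_apply, Option.map_some, pointedMatrix, RelIso.coe_fn_toEquiv]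
      exact if_congr h2 rfl (if_congr ψ.map_adj_iff rfl rfl)
  rcases v with v | v <;> rcases w with w | w
  · exact h1 v w
  · rfl
  · rfl
  · have := h1 (Equiv.optionCongr ψ.toEquiv.symm v) (Equiv.optionCongr ψ.toEquiv.symm w)
    have e : ∀ v, Equiv.optionCongr ψ.toEquiv (Equiv.optionCongr ψ.toEquiv.symm v) = v := by
      intro v; cases v <;> simp
    rw [e, e] at this
    exact this.symm

/-- The entry `4` occurs on the diagonal only at the two apexes, so they are permuted among
themselves. -/
theorem preserves_inr_none {σ} (h : Preserves (pairMatrix G H 4) σ)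
    (h0 : σ (.inl none) ≠ .inl none) :
    σ (.inl none) = .inr none ∧ σ (.inr none) = .inl none := by
  have key : ∀ v, pairMatrix G H 4 v v = 4 → v = .inl none ∨ v = .inr none := by
    rintro ((_ | v) | (_ | v)) hv
    · exact .inl rfl
    · simp [pairMatrix, pointedMatrix] at hv
    · exact .inr rfl
    · simp [pairMatrix, pointedMatrix] at hv
  have h1 := (key _ (h (.inl none) (.inl none))).resolve_left h0
  refine ⟨h1, (key _ (h (.inr none) (.inr none))).resolve_right fun h2 => ?_⟩
  have := σ.injective (h1.trans h2.symm)
  simp at this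

/-- An apex has entry `1` with the vertices of its own graph and `0` with the other half. -/
theorem preserves_inl_some {σ} (h : Preserves (pairMatrix G H 4) σ)
    (h0 : σ (.inl none) = .inr none) (v : Fin n) : ∃ w, σ (.inl (some v)) = .inr (some w) := by
  have h1 := h (.inl none) (.inl (some v))
  rw [h0] at h1
  rcases hw : σ (.inl (some v)) with w | _ | w
  · rw [hw] at h1; simp [pairMatrix, pointedMatrix] at h1
  · have := σ.injective (h0.trans hw.symm)
    simp at this
  · exact ⟨w, rfl⟩

theorem preserves_inr_some {σ} (h : Preserves (pairMatrix G H 4) σ)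
    (h0 : σ (.inr none) = .inl none) (v : Fin n') : ∃ w, σ (.inr (some v)) = .inl (some w) := by
  have h1 := h (.inr none) (.inr (some v))
  rw [h0] at h1
  rcases hw : σ (.inr (some v)) with (_ | w) | w
  · have := σ.injective (h0.trans hw.symm)
    simp at this
  · exact ⟨w, rfl⟩
  · rw [hw] at h1; simp [pairMatrix, pointedMatrix] at h1

/-- If the first apex is moved, the apexes are exchanged and the vertices of the two graphs with
them. The resulting bijection is an isomorphism, because entry `2` between distinguished halves
means adjacency. Conversely, an isomorphism and its inverse together form a swap. -/
theorem nonempty_iso_iff : Nonempty (G ≃g H) ↔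
    ∃ σ, Preserves (pairMatrix G H 4) σ ∧ σ (.inl none) ≠ .inl none := by
  refine ⟨fun ⟨ψ⟩ => exists_preserves_of_iso ψ, ?_⟩
  rintro ⟨σ, h, h0⟩
  obtain ⟨h1, h2⟩ := preserves_inr_none h h0
  choose f hf using preserves_inl_some h h1
  choose g hg using preserves_inr_some h.symm (σ.symm_apply_eq.2 h1.symm)
  refine ⟨⟨⟨f, g, fun v => ?_, fun v => ?_⟩, fun {v w} => ?_⟩⟩
  · have := hg (f v)
    rw [← hf, Equiv.symm_apply_apply] at this
    simpa using this.symm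
  · have := hf (g v)
    rw [← hg, Equiv.apply_symm_apply] at this
    simpa using this.symm
  · have := h (.inl (some v)) (.inl (some w))
    rw [hf, hf] at this
    simp only [pairMatrix] at this
    show H.Adj (f v) (f w) ↔ G.Adj v w
    rw [← pointedMatrix_eq_two (a := 4), ← pointedMatrix_eq_two (a := 4), this]

/-- Entry `5` occurs exactly once, at the first apex, and truncation at `4` recovers the other
matrix. Thus changing this entry cuts the automorphism group down to the stabilizer of the first
apex. -/
theorem preserves_five_iff {σ : Equiv.Perm (Option (Fin n) ⊕ Option (Fin n'))} :
    Preserves (pairMatrix G H 5) σ ↔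
      Preserves (pairMatrix G H 4) σ ∧ σ (.inl none) = .inl none := by
  have e1 : ∀ v w, pairMatrix G H 4 v w = min 4 (pairMatrix G H 5 v w) := by
    intro v w
    rcases v with (_ | v) | (_ | v) <;> rcases w with (_ | w) | (_ | w) <;>
      simp only [pairMatrix, pointedMatrix] <;> (try split_ifs) <;> simp
  have e2 : ∀ v w, pairMatrix G H 5 v w = 5 ↔ v = .inl none ∧ w = .inl none := by
    intro v w
    rcases v with (_ | v) | (_ | v) <;> rcases w with (_ | w) | (_ | w) <;>
      simp only [pairMatrix, pointedMatrix] <;> (try split_ifs) <;> simp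
  constructor
  · refine fun h => ⟨fun v w => by rw [e1, e1, h], ?_⟩
    have := h (.inl none) (.inl none)
    rw [(e2 (.inl none) (.inl none)).2 ⟨rfl, rfl⟩, e2] at this
    exact this.1
  · rintro ⟨h, h0⟩ v w
    have h1 := h v w
    rw [e1, e1] at h1
    have h2 : ∀ v, σ v = .inl none ↔ v = .inl none := fun v =>
      ⟨fun hv => σ.injective (hv.trans h0.symm), fun hv => hv ▸ h0⟩
    have h3 : pairMatrix G H 5 (σ v) (σ w) = 5 ↔ pairMatrix G H 5 v w = 5 := by
      rw [e2, e2, h2, h2]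
    have h4 := pairMatrix_lt (G := G) (H := H) (le_refl 5) v w
    have h5 := pairMatrix_lt (G := G) (H := H) (le_refl 5) (σ v) (σ w)
    omega

end pairMatrix

/-- The two-player game in which player `0` receives the entries of a matrix, and player `1` receives
a constant. -/
def matrixGame {m : ℕ} (hm : 0 < m) (D : Fin m → Fin m → ℕ) : Game :=
  gridGame hm hm fun i v w => if i = 0 then (D v w : ℚ) else ((6 : ℕ) : ℚ)

namespace matrixGame

variable {m : ℕ} {hm : 0 < m} {D : Fin m → Fin m → ℕ}

/-- The symmetry that acts as `σ` on the actions of both players. -/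
def perm (σ : Equiv.Perm (Fin m)) : Equiv.Perm (matrixGame hm D).Action := gridGame.perm σ σ

theorem perm_injective :
    Function.Injective (perm : _ → Equiv.Perm (matrixGame hm D).Action) := by
  intro σ τ h
  refine Equiv.ext fun v => ?_
  exact gridGame.fst_injective (h₀ := hm) (h₁ := hm)
    (u := fun i v w => if i = 0 then (D v w : ℚ) else ((6 : ℕ) : ℚ))
    (congrArg (fun φ => φ (gridGame.fst v)) h)

/-- Exchanging the players would equate some entry with the constant `6`. Otherwise the two players'
actions are permuted by some `σ` and `τ` with `D (σ v) (τ w) = D v w`, and comparing diagonal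
entries gives `σ = τ`. -/
theorem isSymmetry_iff (h1 : ∀ v w, D v w < 6) (h2 : ∀ v w, 3 ≤ D v w ↔ v = w)
    {φ : Equiv.Perm (matrixGame hm D).Action} :
    Game.IsSymmetry φ ↔ ∃ σ, Preserves D σ ∧ φ = perm σ := by
  constructor
  · intro hφ
    have hp : ∀ x, (φ x).1 = x.1 := by
      obtain ⟨π, hπ, hu⟩ := id hφ
      change Equiv.Perm (Fin 2) at π
      suffices h : π 0 = 0 by
        obtain rfl := perm_fin_two_eq_one h
        exact hπ
      by_contra h
      let a : (matrixGame hm D).Profile := gridGame.profile ⟨0, hm⟩ ⟨0, hm⟩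
      obtain ⟨b, hb⟩ := hφ.exists_mapsProfile a
      have h3 := hu (0 : Fin 2) a b hb
      have h4 : (D ⟨0, hm⟩ ⟨0, hm⟩ : ℚ) = ((6 : ℕ) : ℚ) := h3.trans (if_neg h)
      have h5 := h1 ⟨0, hm⟩ ⟨0, hm⟩
      rw [Nat.cast_inj] at h4
      omega
    obtain ⟨σ, τ, rfl, hu⟩ := gridGame.exists_eq_perm (h₀ := hm) (h₁ := hm) hφ hp
    have h3 : ∀ v w, D (σ v) (τ w) = D v w := fun v w => by simpa using hu 0 v w
    obtain rfl : σ = τ := Equiv.ext fun v => by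
      rw [← h2, h3, h2]
    exact ⟨σ, h3, rfl⟩
  · rintro ⟨σ, hσ, rfl⟩
    exact gridGame.isSymmetry_perm fun i v w => by rw [hσ v w]

theorem card_symmetryGroup (h1 : ∀ v w, D v w < 6) (h2 : ∀ v w, 3 ≤ D v w ↔ v = w) :
    Nat.card (matrixGame hm D).symmetryGroup = {σ | Preserves D σ}.ncard := by
  have h : ((matrixGame hm D).symmetryGroup : Set (Equiv.Perm (matrixGame hm D).Action)) =
      perm '' {σ | Preserves D σ} := by
    ext φ
    refine (isSymmetry_iff h1 h2).trans ⟨?_, ?_⟩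
    · rintro ⟨σ, hσ, rfl⟩; exact ⟨σ, hσ, rfl⟩
    · rintro ⟨σ, hσ, rfl⟩; exact ⟨σ, hσ, rfl⟩
  rw [← Set.ncard_image_of_injective _ (perm_injective (hm := hm) (D := D)), ← h]
  rfl

end matrixGame

/-- The vertices of two graphs, each of them with one further vertex in front, as an initial
segment of the natural numbers. -/
def pairEquiv (n n' : ℕ) : Fin (n + 1 + (n' + 1)) ≃ Option (Fin n) ⊕ Option (Fin n') :=
  finSumFinEquiv.symm.trans (Equiv.sumCongr (finSuccEquiv n) (finSuccEquiv n'))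

/-- The game of two graphs. -/
noncomputable def pairGame {n n' : ℕ} (G : SimpleGraph (Fin n)) (H : SimpleGraph (Fin n'))
    (a : ℕ) : Game :=
  matrixGame (m := n + 1 + (n' + 1)) (by omega)
    fun i j => pairMatrix G H a (pairEquiv n n' i) (pairEquiv n n' j)

section pairGame

variable {n n' : ℕ} {G : SimpleGraph (Fin n)} {H : SimpleGraph (Fin n')} {a : ℕ}

theorem pairEquiv_zero : pairEquiv n n' ⟨0, by omega⟩ = .inl none := by
  rw [← Equiv.eq_symm_apply]; rfl

theorem preserves_conj {V W : Type} (e : V ≃ W) {C : W → W → ℕ} {σ : Equiv.Perm V} :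
    Preserves (fun i j => C (e i) (e j)) σ ↔ Preserves C (e.permCongr σ) := by
  simp only [Preserves, Equiv.permCongr_apply]
  refine ⟨fun h v w => ?_, fun h i j => ?_⟩
  · simpa using h (e.symm v) (e.symm w)
  · simpa using h (e i) (e j)

theorem pairGame_isSymmetry_iff (ha : 4 ≤ a) (ha' : a ≤ 5)
    {φ : Equiv.Perm (pairGame G H a).Action} : Game.IsSymmetry φ ↔
      ∃ σ, Preserves (fun i j => pairMatrix G H a (pairEquiv n n' i) (pairEquiv n n' j)) σ ∧
        φ = matrixGame.perm σ :=
  matrixGame.isSymmetry_iff (fun v w => pairMatrix_lt ha' _ _) fun v w => by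
    rw [three_le_pairMatrix ha, Equiv.apply_eq_iff_eq]

theorem nonempty_iso_iff_exists_symmetry : Nonempty (G ≃g H) ↔
    ∃ σ : Equiv.Perm (Fin (n + 1 + (n' + 1))),
      Preserves (fun i j => pairMatrix G H 4 (pairEquiv n n' i) (pairEquiv n n' j)) σ ∧
        σ ⟨0, by omega⟩ ≠ ⟨0, by omega⟩ := by
  rw [nonempty_iso_iff, ((pairEquiv n n').permCongr).surjective.exists]
  simp only [preserves_conj]
  refine exists_congr fun σ => and_congr_right fun _ => not_congr ?_
  rw [← pairEquiv_zero, Equiv.permCongr_apply, Equiv.symm_apply_apply, Equiv.apply_eq_iff_eq]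

/-- The second group corresponds to the stabilizer of the first apex in the first one. These are
finite, so their orders differ if and only if some automorphism moves the apex. -/
theorem nonempty_iso_iff_card_ne : Nonempty (G ≃g H) ↔
    Nat.card (pairGame G H 4).symmetryGroup ≠ Nat.card (pairGame G H 5).symmetryGroup := by
  have h : ∀ a, 4 ≤ a → a ≤ 5 → _ := fun a ha ha' =>
    matrixGame.card_symmetryGroup (hm := (by omega : 0 < n + 1 + (n' + 1)))
      (D := fun i j => pairMatrix G H a (pairEquiv n n' i) (pairEquiv n n' j))
      (fun v w => pairMatrix_lt ha' _ _) fun v w => by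
        rw [three_le_pairMatrix ha, Equiv.apply_eq_iff_eq]
  rw [pairGame, pairGame, h 4 (by omega) (by omega), h 5 (by omega) (by omega),
    nonempty_iso_iff_exists_symmetry]
  set S4 := {σ | Preserves
    (fun i j => pairMatrix G H 4 (pairEquiv n n' i) (pairEquiv n n' j)) σ} with hS4
  set S5 := {σ | Preserves
    (fun i j => pairMatrix G H 5 (pairEquiv n n' i) (pairEquiv n n' j)) σ} with hS5
  have h5 : ∀ σ, σ ∈ S5 ↔ σ ∈ S4 ∧ σ ⟨0, by omega⟩ = ⟨0, by omega⟩ := by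
    intro σ
    simp only [hS4, hS5, Set.mem_ofPred_eq, preserves_conj, preserves_five_iff]
    refine and_congr_right fun _ => ?_
    rw [← pairEquiv_zero, Equiv.permCongr_apply, Equiv.symm_apply_apply, Equiv.apply_eq_iff_eq]
  have hsub : S5 ⊆ S4 := fun σ hσ => ((h5 σ).1 hσ).1
  constructor
  · rintro ⟨σ, hσ, h0⟩ hcard
    have := Set.eq_of_subset_of_ncard_le hsub hcard.le (Set.toFinite _)
    exact h0 ((h5 σ).1 (this ▸ hσ)).2
  · intro hne
    by_contra! hcon
    refine hne (congrArg _ (Set.Subset.antisymm (fun σ hσ => (h5 σ).2 ⟨hσ, hcon σ hσ⟩) hsub))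

end pairGame

end GameSym

namespace GameSym

/-! ## Reductions from graph isomorphism -/

section encodings

variable {α : Type} [Coded α]

@[fun_prop]
theorem PT.encUnary {n : α → ℕ} (hn : PT n) : PT fun a => encUnary (n a) := by
  unfold GameSym.encUnary; fun_prop

theorem flatMap_finRange {n : ℕ} (g : Fin n → List Bool) (h : ℕ → List Bool)
    (hgh : ∀ k : Fin n, g k = h k) : (List.finRange n).flatMap g = (List.range n).flatMap h := by
  rw [← List.map_coe_finRange_eq_range, List.flatMap_map]
  congr 1
  exact funext hgh

/-- The position of the first `false` in a string that begins with a unary code. -/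
def unaryLen (x : List Bool) : ℕ := x.findIdx fun b => !b

theorem unaryLen_encUnary (n : ℕ) (s : List Bool) : unaryLen (encUnary n ++ s) = n := by
  induction n with
  | zero => rfl
  | succ n ih =>
    unfold unaryLen at *
    simpa [encUnary, List.replicate_succ, List.findIdx_cons] using ih

theorem drop_encUnary (n : ℕ) (s : List Bool) : (encUnary n ++ s).drop (n + 1) = s := by
  have : (encUnary n).length = n + 1 := by simp [encUnary]
  rw [← this, List.drop_left]

@[fun_prop]
theorem PT.unaryLen {x : α → List Bool} (hx : PT x) : PT fun a => unaryLen (x a) := by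
  unfold GameSym.unaryLen; fun_prop

end encodings

/-! ### Entries of adjacency matrices, and the code of the game of two graphs -/

section table

theorem getD_flatMap {β : Type} (d : β) (m : ℕ) : ∀ (l : List ℕ) (g : ℕ → List β) (s : List β),
    (∀ i ∈ l, (g i).length = m) → ∀ i j, i < l.length → j < m →
    ((l.flatMap g) ++ s).getD (i * m + j) d = (g (l.getD i 0)).getD j d := by
  intro l g s
  induction l with
  | nil => intro _ i j hi; simp at hi
  | cons x l ih =>
    intro h i j hi hj
    have hx := h x (by simp)
    rcases i with _ | i
    · simp only [List.flatMap_cons, List.append_assoc, zero_mul, zero_add]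
      rw [List.getD_append _ _ _ _ (by omega)]
      rfl
    · simp only [List.flatMap_cons, List.append_assoc]
      rw [List.getD_append_right _ _ _ _ (by rw [hx, Nat.succ_mul]; omega)]
      rw [show (i + 1) * m + j - (g x).length = i * m + j by rw [hx, Nat.succ_mul]; omega]
      rw [ih (fun y hy => h y (by simp [hy])) i j (by simpa using hi) hj]
      rfl

open Classical in
/-- The rows of the adjacency matrix of a graph. -/
noncomputable def adjBits {n : ℕ} (G : SimpleGraph (Fin n)) : List Bool :=
  (List.finRange n).flatMap fun v => (List.finRange n).flatMap fun w => [decide (G.Adj v w)]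

variable {n : ℕ} (G : SimpleGraph (Fin n))

theorem encGraph_eq : encGraph ⟨n, G⟩ = encUnary n ++ adjBits G := rfl

theorem length_adjBits : (adjBits G).length = n * n := by
  simp [adjBits, List.length_flatMap]

theorem getD_adjBits (s : List Bool) (v w : Fin n) :
    (adjBits G ++ s).getD (v * n + w) false = true ↔ G.Adj v w := by
  classical
  -- The entries are extended to all natural indices by `false`, so that `getD_flatMap` applies.
  have e : adjBits G = (List.range n).flatMap fun i => (List.range n).flatMap fun j =>
      [decide (∃ (hi : i < n) (hj : j < n), G.Adj ⟨i, hi⟩ ⟨j, hj⟩)] := by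
    refine flatMap_finRange _ _ fun v => flatMap_finRange _ _ fun w => ?_
    simp
  rw [e, getD_flatMap false n _ _ _ (fun i _ => by simp [List.length_flatMap]) v w (by simp)
    w.2]
  -- A row is itself a table, with blocks of length `1`.
  have h2 := getD_flatMap false 1 (List.range n)
    (fun j => [decide (∃ (hi : (List.range n).getD v 0 < n) (hj : j < n),
      G.Adj ⟨(List.range n).getD v 0, hi⟩ ⟨j, hj⟩)]) [] (fun _ _ => rfl) w 0 (by simp) one_pos
  simp only [List.append_nil, mul_one, add_zero] at h2
  rw [h2]
  simp

end table

/-- The entries of the matrix of two graphs that are given by their sizes `n` and `n'` and their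
adjacency matrices `x` and `y`. -/
def pairEntry (n n' : ℕ) (x y : List Bool) (a i j : ℕ) : ℕ :=
  bif i == j then bif i == 0 then a else bif i == n + 1 then 4 else 3
  else bif Nat.blt n i then
    bif Nat.blt n j then
      bif !(i == n + 1) && !(j == n + 1) && y.getD ((i - (n + 2)) * n' + (j - (n + 2))) false
      then 2 else 1
    else 0
  else bif Nat.blt n j then 0
  else bif !(i == 0) && !(j == 0) && x.getD ((i - 1) * n + (j - 1)) false then 2 else 1

/-- The indices are ordered as follows: `0` is the first apex, then come the vertices of `G`, then
at `n + 1` the second apex, then the vertices of `H`. The strings `s` and `t` are allowed because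
`pairString` does not cut off what follows an adjacency matrix in the input. -/
theorem pairEntry_eq {n n' : ℕ} (G : SimpleGraph (Fin n)) (H : SimpleGraph (Fin n'))
    (s t : List Bool) (a : ℕ) (i j : Fin (n + 1 + (n' + 1))) :
    pairEntry n n' (adjBits G ++ s) (adjBits H ++ t) a i j =
      pairMatrix G H a (pairEquiv n n' i) (pairEquiv n n' j) := by
  obtain ⟨v, rfl⟩ := (pairEquiv n n').symm.surjective i
  obtain ⟨w, rfl⟩ := (pairEquiv n n').symm.surjective j
  rw [Equiv.apply_symm_apply, Equiv.apply_symm_apply]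
  have e1 : ((pairEquiv n n').symm (.inl none) : ℕ) = 0 := rfl
  have e2 : ∀ v : Fin n, ((pairEquiv n n').symm (.inl (some v)) : ℕ) = v + 1 := fun v => rfl
  have e3 : ((pairEquiv n n').symm (.inr none) : ℕ) = n + 1 := rfl
  have e4 : ∀ v : Fin n', ((pairEquiv n n').symm (.inr (some v)) : ℕ) = n + 1 + (v + 1) :=
    fun v => rfl
  have l1 : ∀ v : Fin n, Nat.blt n (v + 1) = false := fun v => by
    rw [← Bool.not_eq_true, Nat.blt_eq]; omega
  have l2 : ∀ k, Nat.blt n (n + 1 + k) = true := fun k => by rw [Nat.blt_eq]; omega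
  have l3 : Nat.blt n (n + 1) = true := by rw [Nat.blt_eq]; omega
  have l4 : Nat.blt n 0 = false := by rw [← Bool.not_eq_true, Nat.blt_eq]; omega
  have hne : ∀ {a b : ℕ}, a ≠ b → (a == b) = false := fun h => beq_false_of_ne h
  rcases v with (_ | v) | (_ | v) <;> rcases w with (_ | w) | (_ | w) <;>
    simp only [e1, e2, e3, e4, pairMatrix, pointedMatrix, pairEntry]
  · simp
  · rw [hne (by omega)]; simp [l1, l4]
  · rw [hne (by omega)]; simp [l3, l4]
  · rw [hne (by omega)]; simp [l2, l4]
  · rw [hne (by omega)]; simp [l1, l4]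
  · by_cases h : v = w
    · subst h
      rw [hne (show (v : ℕ) + 1 ≠ 0 by omega), hne (show (v : ℕ) + 1 ≠ n + 1 by omega)]
      simp
    · have h' : (v : ℕ) + 1 ≠ w + 1 := fun h' => h (Fin.ext (by omega))
      have := getD_adjBits G s v w
      rw [hne h', hne (show (v : ℕ) + 1 ≠ 0 by omega), hne (show (w : ℕ) + 1 ≠ 0 by omega),
        if_neg h]
      simp only [l1, cond_false, Bool.not_false, Bool.true_and, Nat.add_sub_cancel]
      by_cases hA : G.Adj v w
      · rw [this.2 hA, if_pos hA]; rfl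
      · rw [(Bool.not_eq_true _).mp (mt this.1 hA), if_neg hA]; rfl
  · rw [hne (by omega)]; simp [l1, l3]
  · rw [hne (by omega)]; simp [l1, l2]
  · rw [hne (by omega)]; simp [l3, l4]
  · rw [hne (by omega)]; simp [l1, l3]
  · simp
  · rw [hne (by omega)]; simp [l3, l2]
  · rw [hne (by omega)]; simp [l2, l4]
  · rw [hne (by omega)]; simp [l2, l1]
  · rw [hne (by omega)]; simp [l2, l3]
  · by_cases h : v = w
    · subst h
      rw [hne (show n + 1 + ((v : ℕ) + 1) ≠ 0 by omega),
        hne (show n + 1 + ((v : ℕ) + 1) ≠ n + 1 by omega)]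
      simp
    · have h' : n + 1 + ((v : ℕ) + 1) ≠ n + 1 + (w + 1) := fun h' => h (Fin.ext (by omega))
      have := getD_adjBits H t v w
      have es : ∀ k, n + 1 + (k + 1) - (n + 2) = k := fun k => by omega
      rw [hne h', hne (show n + 1 + ((v : ℕ) + 1) ≠ n + 1 by omega),
        hne (show n + 1 + ((w : ℕ) + 1) ≠ n + 1 by omega), if_neg h]
      simp only [l2, cond_false, cond_true, Bool.not_false, Bool.true_and, es]
      by_cases hA : H.Adj v w
      · rw [this.2 hA, if_pos hA]; rfl
      · rw [(Bool.not_eq_true _).mp (mt this.1 hA), if_neg hA]; rfl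

/-- Codes of small natural numbers as rational numbers. -/
def ratCode (k : ℕ) : List Bool := ((List.range 7).map fun k : ℕ => encRat (k : ℚ)).getD k []

theorem ratCode_eq {k : ℕ} (hk : k < 7) : ratCode k = encRat (k : ℚ) := by
  simp [ratCode, hk]

/-- The code of the game of two graphs with given codes. -/
def pairString (a : ℕ) (z : List Bool) : List Bool :=
  let n := unaryLen z
  let x := z.drop (n + 1)
  let z' := x.drop (n * n)
  let n' := unaryLen z'
  let y := z'.drop (n' + 1)
  let m := n + 1 + (n' + 1)
  (true :: encUnary m) ++ (true :: encUnary m) ++ [false] ++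
    ((List.range (m * m)).flatMap fun k => ratCode (pairEntry n n' x y a (k % m) (k / m))) ++
    (List.range (m * m)).flatMap fun _ => ratCode 6

theorem PT.pairString (a : ℕ) : PT (pairString a) := by
  unfold GameSym.pairString pairEntry ratCode
  fun_prop

/-- In the mixed-radix order the action of player `0` varies fastest, so the profile with number `k`
consists of `k % m` and `k / m`. -/
theorem encGame_matrixGame {m : ℕ} (hm : 0 < m) (D : Fin m → Fin m → ℕ) (E : ℕ → ℕ → ℕ)
    (hE : ∀ i j : Fin m, E i j = D i j) (hD : ∀ i j, D i j < 6) : encGame (matrixGame hm D) =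
    (true :: encUnary m) ++ (true :: encUnary m) ++ [false] ++
    ((List.range (m * m)).flatMap fun k => ratCode (E (k % m) (k / m))) ++
    (List.range (m * m)).flatMap fun _ => ratCode 6 := by
  have hp : ∏ j, (matrixGame hm D).numActions j = m * m :=
    (Fin.prod_univ_two (![m, m] : Fin 2 → ℕ))
  have h0 : ∀ k, (((finPiFinEquiv.symm k : (matrixGame hm D).Profile) (0 : Fin 2) : Fin m) : ℕ) =
      k % m := by
    intro k
    show ((k : ℕ) / 1) % m = _
    rw [Nat.div_one]
  have h1 : ∀ k, (((finPiFinEquiv.symm k : (matrixGame hm D).Profile) (1 : Fin 2) : Fin m) : ℕ) =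
      k / m := by
    intro k
    show ((k : ℕ) / (∏ j : Fin 1, _)) % m = _
    rw [Fin.prod_univ_one]
    refine Nat.mod_eq_of_lt (Nat.div_lt_of_lt_mul ?_)
    exact lt_of_lt_of_eq k.2 hp
  have e1 : encList encUnary (List.ofFn (matrixGame hm D).numActions) =
      (true :: encUnary m) ++ (true :: encUnary m) ++ [false] := by
    show encList encUnary (List.ofFn (![m, m] : Fin 2 → ℕ)) = _
    simp [encList, List.ofFn_succ]
  have e2 : ∀ g : Fin 2 → List Bool, (List.finRange 2).flatMap g = g 0 ++ g 1 := fun g => by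
    simp [List.finRange_succ]
  rw [encGame, e1]
  refine Eq.trans ?_ (List.append_assoc _ _ _).symm
  refine congrArg (fun s => (true :: encUnary m) ++ (true :: encUnary m) ++ [false] ++ s) ((e2 _).trans (congrArg₂ (· ++ ·) ?_ ?_))
  · rw [← hp]
    refine flatMap_finRange _ _ fun k => ?_
    have h2 := hE ((finPiFinEquiv.symm k : (matrixGame hm D).Profile) (0 : Fin 2))
      ((finPiFinEquiv.symm k : (matrixGame hm D).Profile) (1 : Fin 2))
    rw [h0, h1] at h2
    rw [h2]
    refine Eq.trans ?_ (ratCode_eq ((hD _ _).trans (by norm_num))).symm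
    rfl
  · rw [← hp]
    refine flatMap_finRange _ _ fun k => ?_
    rw [ratCode_eq (by norm_num)]
    rfl

theorem pairString_eq {n n' : ℕ} (G : SimpleGraph (Fin n)) (H : SimpleGraph (Fin n')) {a : ℕ}
    (ha : a ≤ 5) : pairString a (encGraph ⟨n, G⟩ ++ encGraph ⟨n', H⟩) =
      encGame (pairGame G H a) := by
  rw [pairGame, encGame_matrixGame _ _ (pairEntry n n' (adjBits G ++ encGraph ⟨n', H⟩)
    (adjBits H) a) (fun i j => ?_) fun i j => pairMatrix_lt ha _ _]
  · have h1 : ∀ s, (adjBits G ++ s).drop (n * n) = s := fun s => by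
      rw [← length_adjBits G, List.drop_left]
    rw [encGraph_eq, encGraph_eq, List.append_assoc]
    simp only [pairString, unaryLen_encUnary, drop_encUnary, h1]
  · simpa using pairEntry_eq G H (encGraph ⟨n', H⟩) [] a i j

theorem bits_injective : Function.Injective Nat.bits := by
  intro x y h
  have h3 := congrArg (fun l => Nat.ofDigits 2 (l.map fun b => cond b 1 0)) h
  simpa [← Nat.digits_two_eq_bits, Nat.ofDigits_digits] using h3

/-- Graph isomorphism reduces to counting symmetries. -/
theorem graphIsomorphism_reducible_symmetryCounting :
    TuringReducible graphIsomorphism symmetryCounting := by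
  refine TuringReducible.of_pto
    (fun f x => [!(f (pairString 4 (graphIsomorphism.encode x)) ==
      f (pairString 5 (graphIsomorphism.encode x)))]) ?_ ?_
  · let _ := graphIsomorphism.coded
    have h0 : PT graphIsomorphism.encode := .of_bits_eq fun _ => rfl
    have h1 : ∀ a, PTO fun f x => f (pairString a (graphIsomorphism.encode x)) := fun a =>
      PTO.query.comp (PT.comp (PT.pairString a) h0)
    have h2 : PT fun p : List Bool × List Bool => [!(p.1 == p.2)] := by fun_prop
    exact PTO.comp h2 (PTO.prodMk (h1 4) (h1 5))
  · classical
    rintro f hf ⟨⟨n, G⟩, ⟨n', H⟩⟩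
    have h1 : ∀ a, a ≤ 5 → f (pairString a (encGraph ⟨n, G⟩ ++ encGraph ⟨n', H⟩)) =
        (Nat.card (pairGame G H a).symmetryGroup).bits := fun a ha => by
      rw [pairString_eq G H ha]
      exact hf (pairGame G H a)
    show [!(f (pairString 4 (encGraph ⟨n, G⟩ ++ encGraph ⟨n', H⟩)) ==
      f (pairString 5 (encGraph ⟨n, G⟩ ++ encGraph ⟨n', H⟩)))] = [decide (Nonempty (G ≃g H))]
    rw [h1 4 (by norm_num), h1 5 (by norm_num), nonempty_iso_iff_card_ne]
    congr 1
    rw [Bool.eq_iff_iff]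
    simp [bits_injective.eq_iff]

/-- One step of a search in a list of symmetries, each coded by `m` unary numbers: the first
component of the state counts the numbers, the second one indicates whether some symmetry has a
nonzero number in the second position. -/
def scanStep (m : ℕ) (s : ℕ × Bool) (b : Bool) : ℕ × Bool :=
  bif b then (s.1, s.2 || s.1 == 1) else (bif s.1 + 1 == m then 0 else s.1 + 1, s.2)

theorem scan_true (m : ℕ) (k c : ℕ) (r : Bool) :
    (List.replicate k true).foldl (scanStep m) (c, r) = (c, r || c == 1 && !(k == 0)) := by
  induction k generalizing r with
  | zero => simp
  | succ k ih =>
    rw [List.replicate_succ, List.foldl_cons]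
    simp only [scanStep, cond_true]
    rw [ih]
    cases r <;> cases (c == 1) <;> simp

theorem scan_encUnary (m : ℕ) (k c : ℕ) (r : Bool) :
    (encUnary k).foldl (scanStep m) (c, r) =
      (bif c + 1 == m then 0 else c + 1, r || c == 1 && !(k == 0)) := by
  rw [encUnary, List.foldl_append, scan_true]
  rfl

theorem scan_rest (m : ℕ) (ks : List ℕ) : ∀ (c : ℕ) (r : Bool), 2 ≤ c → c < m →
    c + ks.length = m → (ks.flatMap encUnary).foldl (scanStep m) (c, r) = (0, r) := by
  induction ks with
  | nil => intro c r h1 h2 h3; simp at h3; omega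
  | cons k ks ih =>
    intro c r h1 h2 h3
    rw [List.flatMap_cons, List.foldl_append, scan_encUnary,
      beq_false_of_ne (show c ≠ 1 by omega)]
    simp only [Bool.false_and, Bool.or_false]
    rw [List.length_cons] at h3
    by_cases h : c + 1 = m
    · have : ks = [] := List.length_eq_zero_iff.1 (by omega)
      subst this
      simp [h]
    · rw [beq_false_of_ne h, cond_false]
      exact ih _ _ (by omega) (by omega) (by omega)

/-- The bit `true` in front of each table is read while the counter is `0`. It does no harm there,
as only the bits at counter `1` are inspected. -/
theorem scan_table (m k : ℕ) (ks : List ℕ) (r : Bool) (h : ks.length + 2 = m) (h3 : 3 ≤ m) :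
    (true :: (0 :: k :: ks).flatMap encUnary).foldl (scanStep m) (0, r) =
      (0, r || !(k == 0)) := by
  have h1 : scanStep m (0, r) true = (0, r) := by simp [scanStep]
  have h2 : (encUnary 0).foldl (scanStep m) (0, r) = (1, r) := by
    rw [scan_encUnary, beq_false_of_ne (show 0 + 1 ≠ m by omega)]
    simp
  have h4 : (encUnary k).foldl (scanStep m) (1, r) = (2, r || !(k == 0)) := by
    rw [scan_encUnary, beq_false_of_ne (show 1 + 1 ≠ m by omega)]
    simp
  rw [List.foldl_cons, h1, List.flatMap_cons, List.flatMap_cons, List.foldl_append,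
    List.foldl_append, h2, h4, scan_rest m ks _ _ (by omega) (by omega) (by omega)]

/-- There are `2 * m` actions, and the image of each is given by two unary numbers, its player and
its position. The image of the very first action belongs to player `0`, hence the leading `0`. -/
theorem encPerm_matrixGame {m : ℕ} {hm : 0 < m} {D : Fin m → Fin m → ℕ}
    (σ : Equiv.Perm (Fin m)) : ∃ ks : List ℕ, ks.length + 2 = 4 * m ∧
      encPerm (matrixGame.perm σ : Equiv.Perm (matrixGame hm D).Action) =
        (0 :: (σ ⟨0, hm⟩ : ℕ) :: ks).flatMap encUnary := by
  obtain ⟨m, rfl⟩ : ∃ k, m = k + 1 := ⟨m - 1, by omega⟩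
  have e : encPerm (matrixGame.perm σ : Equiv.Perm (matrixGame hm D).Action) =
      ((List.finRange (m + 1)).flatMap fun k => [0, (σ k : ℕ)]).flatMap encUnary ++
      ((List.finRange (m + 1)).flatMap fun k => [1, (σ k : ℕ)]).flatMap encUnary := by
    show ((List.finRange 2).flatMap fun i : Fin 2 =>
      (List.finRange ((![m + 1, m + 1] : Fin 2 → ℕ) i)).flatMap _) = _
    rw [show List.finRange 2 = [0, 1] from rfl]
    simp only [List.flatMap_cons, List.flatMap_nil, List.append_nil, List.flatMap_assoc]
    rfl
  rw [e]
  refine ⟨((List.finRange m).flatMap fun k : Fin m => [0, (σ k.succ : ℕ)]) ++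
    (List.finRange (m + 1)).flatMap fun k => [1, (σ k : ℕ)], ?_, ?_⟩
  · simp [List.length_flatMap]
    ring
  · rw [← List.flatMap_append, List.finRange_succ]
    simp [List.flatMap_map]

theorem scan_encList {m : ℕ} {hm : 0 < m} {D : Fin m → Fin m → ℕ}
    (L : List (Equiv.Perm (matrixGame hm D).Action)) (hL : ∀ φ ∈ L, ∃ σ, φ = matrixGame.perm σ)
    (r : Bool) : ((encList encPerm L).foldl (scanStep (4 * m)) (0, r)).2 = true ↔
      r = true ∨ ∃ σ : Equiv.Perm (Fin m), matrixGame.perm σ ∈ L ∧ σ ⟨0, hm⟩ ≠ ⟨0, hm⟩ := by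
  induction L generalizing r with
  | nil => simp [encList, scanStep]
  | cons φ L ih =>
    obtain ⟨σ, rfl⟩ := hL φ (by simp)
    obtain ⟨ks, h1, h2⟩ := encPerm_matrixGame (hm := hm) (D := D) σ
    have h3 : encList encPerm (matrixGame.perm σ :: L) =
        (true :: encPerm (matrixGame.perm σ : Equiv.Perm (matrixGame hm D).Action)) ++
          encList encPerm L := by
      simp [encList]
    rw [h3, List.foldl_append, h2, scan_table _ _ _ _ h1 (by omega),
      ih fun φ hφ => hL φ (by simp [hφ])]
    have h4 : (!((σ ⟨0, hm⟩ : ℕ) == 0)) = true ↔ σ ⟨0, hm⟩ ≠ ⟨0, hm⟩ := by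
      simp [Fin.ext_iff]
    rw [Bool.or_eq_true, h4, or_assoc]
    refine or_congr_right ⟨?_, ?_⟩
    · rintro (h | ⟨τ, h, h'⟩)
      · exact ⟨σ, by simp, h⟩
      · exact ⟨τ, by simp [h], h'⟩
    · rintro ⟨τ, h, h'⟩
      rcases List.mem_cons.1 h with h | h
      · obtain rfl := matrixGame.perm_injective h
        exact .inl h'
      · exact .inr ⟨τ, h, h'⟩

/-- The number of unary numbers in the code of a symmetry of the game of two graphs. -/
def pairScanLen (z : List Bool) : ℕ :=
  let n := unaryLen z
  4 * (n + 1 + (unaryLen ((z.drop (n + 1)).drop (n * n)) + 1))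

theorem PT.pairScanLen : PT pairScanLen := by
  unfold GameSym.pairScanLen; fun_prop

/-- The result of the search. -/
def scan (y : List Bool) (m : ℕ) : List Bool := [(y.foldl (scanStep m) (0, false)).2]

theorem PT.scan : PT fun p : List Bool × ℕ => scan p.1 p.2 := by
  unfold GameSym.scan
  have h : PT fun p : List Bool × ℕ => p.1.foldl (scanStep p.2) (0, false) := by
    refine PT.foldl (by fun_prop) (by fun_prop) (by unfold scanStep; fun_prop)
      ⟨5, fun a s x => ?_⟩
    obtain ⟨c, r⟩ := s
    have h1 := sz_pos r
    have h2 := sz_bool_le (r || c == 1)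
    have h3 : ((5 : Polynomial ℕ).eval (sz (a, x))) = 5 := Polynomial.eval_ofNat _ _
    rw [h3]
    cases x
    · cases h : c + 1 == a.2 <;> simp only [scanStep, h, sz_pair, sz_nat, cond_false, cond_true] <;>
        omega
    · simp only [scanStep, sz_pair, sz_nat, cond_true]; omega
  fun_prop

theorem PTO.scan_query : PTO fun f z => scan (f (pairString 4 z)) (pairScanLen z) := by
  have h1 : PTO fun f z => f (pairString 4 z) := PTO.query.comp (PT.pairString 4)
  have h2 : PTO fun (_ : List Bool → List Bool) z => pairScanLen z := PT.pairScanLen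
  have h3 : PTO fun (_ : List Bool → List Bool) (p : List Bool × ℕ) => scan p.1 p.2 := PT.scan
  exact PTO.comp (G := fun _ (p : List Bool × ℕ) => scan p.1 p.2)
    (F := fun f z => (f (pairString 4 z), pairScanLen z)) h3 (PTO.prodMk h1 h2)

/-- Graph isomorphism reduces to computing generators of the symmetry group. -/
theorem graphIsomorphism_reducible_symmetryGenerators :
    TuringReducible graphIsomorphism symmetryGenerators := by
  refine TuringReducible.of_pto
    (fun f x => (fun f z => scan (f (pairString 4 z)) (pairScanLen z)) f
      (graphIsomorphism.encode x)) ?_ ?_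
  · let _ := graphIsomorphism.coded
    have h0 : PT graphIsomorphism.encode := .of_bits_eq fun _ => rfl
    exact PTO.comp PTO.scan_query h0
  · classical
    rintro f hf ⟨⟨n, G⟩, ⟨n', H⟩⟩
    obtain ⟨L, hL, hy⟩ : ∃ L : List (Equiv.Perm (pairGame G H 4).Action),
        Subgroup.closure {φ | φ ∈ L} = (pairGame G H 4).symmetryGroup ∧
        f (encGame (pairGame G H 4)) = encList encPerm L := hf (pairGame G H 4)
    have hlen : pairScanLen (encGraph ⟨n, G⟩ ++ encGraph ⟨n', H⟩) = 4 * (n + 1 + (n' + 1)) := by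
      have h1 : ∀ s, (adjBits G ++ s).drop (n * n) = s := fun s => by
        rw [← length_adjBits G, List.drop_left]
      rw [encGraph_eq, encGraph_eq, List.append_assoc]
      simp only [pairScanLen, unaryLen_encUnary, drop_encUnary, h1]
    show scan (f (pairString 4 (encGraph ⟨n, G⟩ ++ encGraph ⟨n', H⟩)))
      (pairScanLen (encGraph ⟨n, G⟩ ++ encGraph ⟨n', H⟩)) = [decide (Nonempty (G ≃g H))]
    rw [hlen, pairString_eq G H (by norm_num), hy, scan]
    congr 1
    have hmem : ∀ φ ∈ L, Game.IsSymmetry φ := fun φ hφ => by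
      have : φ ∈ (pairGame G H 4).symmetryGroup := hL ▸ Subgroup.subset_closure hφ
      exact this
    rw [Bool.eq_iff_iff, decide_eq_true_iff, nonempty_iso_iff_exists_symmetry]
    refine (scan_encList L (fun φ hφ => ?_) false).trans ?_
    · obtain ⟨σ, _, h⟩ := (pairGame_isSymmetry_iff (by norm_num) (by norm_num)).1 (hmem φ hφ)
      exact ⟨σ, h⟩
    constructor
    · rintro (h | ⟨σ, hσ, h⟩)
      · simp at h
      · obtain ⟨τ, hτ, h'⟩ :=
          (pairGame_isSymmetry_iff (by norm_num) (by norm_num)).1 (hmem _ hσ)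
        obtain rfl := matrixGame.perm_injective h'
        exact ⟨σ, hτ, h⟩
    · rintro ⟨σ, hσ, h⟩
      refine .inr ?_
      by_contra! hcon
      have h1 : matrixGame.perm σ ∈ (pairGame G H 4).symmetryGroup :=
        (pairGame_isSymmetry_iff (by norm_num) (by norm_num)).2 ⟨σ, hσ, rfl⟩
      rw [← hL] at h1
      let x : (pairGame G H 4).Action := gridGame.fst ⟨0, by omega⟩
      -- If all generators fix the first action, then so does the group that they generate, which
      -- contains the symmetry given by `σ`.
      have h2 : Subgroup.closure {φ | φ ∈ L} ≤ MulAction.stabilizer _ x := by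
        rw [Subgroup.closure_le]
        intro φ hφ
        obtain ⟨τ, _, rfl⟩ :=
          (pairGame_isSymmetry_iff (by norm_num) (by norm_num)).1 (hmem _ hφ)
        exact congrArg gridGame.fst (hcon τ hφ)
      exact h (gridGame.fst_injective (h2 h1))

end GameSym

namespace GameSym

theorem idxOf_map_of_injective {α β : Type} [BEq α] [LawfulBEq α] [BEq β] [LawfulBEq β] {g : α → β}
    (hg : Function.Injective g) (l : List α) (x : α) : (l.map g).idxOf (g x) = l.idxOf x := by
  induction l with
  | nil => rfl
  | cons y l ih =>
    have h : (g y == g x) = (y == x) := by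
      rw [Bool.eq_iff_iff, beq_iff_eq, beq_iff_eq, hg.eq_iff]
    simp [List.idxOf_cons, ih, h]

/-! ## Coloured graphs as graphs with pendant vertices -/

section leaves

variable {W W' : Type}

/-- The graph `B` with infinitely many pendant vertices `(w, 1), (w, 2), …` at each vertex
`w = (w, 0)`. -/
def leafGraph (B : SimpleGraph W) : SimpleGraph (W × ℕ) where
  Adj v w := (B.Adj v.1 w.1 ∧ v.2 = 0 ∧ w.2 = 0) ∨
    (v.1 = w.1 ∧ (v.2 = 0 ∧ w.2 ≠ 0 ∨ v.2 ≠ 0 ∧ w.2 = 0))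
  symm := ⟨by
    rintro v w (⟨h, h1, h2⟩ | ⟨h, h1⟩)
    · exact .inl ⟨h.symm, h2, h1⟩
    · exact .inr ⟨h.symm, by tauto⟩⟩
  loopless := ⟨by
    rintro v (⟨h, -⟩ | ⟨-, h⟩)
    · exact B.irrefl h
    · tauto⟩

/-- The graph `B` with `c w + 2` pendant vertices at each vertex `w`. -/
abbrev colouredGraph (B : SimpleGraph W) (c : W → ℕ) : SimpleGraph {v : W × ℕ // v.2 < c v.1 + 3} :=
  (leafGraph B).comap Subtype.val

variable {B : SimpleGraph W} {B' : SimpleGraph W'} {c : W → ℕ} {c' : W' → ℕ}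

/-- A pendant vertex has a single neighbour, whereas a base vertex has at least its two guaranteed
pendant vertices. This is the reason for adding `2` to each colour: base vertices are recognized by
their degree. -/
theorem snd_eq_zero_iff (v : {v : W × ℕ // v.2 < c v.1 + 3}) : v.1.2 = 0 ↔
    ∃ x y, x ≠ y ∧ (colouredGraph B c).Adj v x ∧ (colouredGraph B c).Adj v y := by
  constructor
  · intro h
    refine ⟨⟨(v.1.1, 1), by simp⟩, ⟨(v.1.1, 2), by simp⟩, by simp, ?_, ?_⟩
    · exact .inr ⟨rfl, .inl ⟨h, by simp⟩⟩
    · exact .inr ⟨rfl, .inl ⟨h, by simp⟩⟩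
  · rintro ⟨x, y, hxy, hx, hy⟩
    by_contra h
    have key : ∀ z, (colouredGraph B c).Adj v z → z.1 = (v.1.1, 0) := by
      rintro z (⟨-, h', -⟩ | ⟨h1, ⟨h', -⟩ | ⟨-, h2⟩⟩)
      · exact absurd h' h
      · exact absurd h' h
      · exact Prod.ext h1.symm h2
    exact hxy (Subtype.ext ((key x hx).trans (key y hy).symm))

/-- An isomorphism of the base graphs that is induced by an isomorphism of coloured graphs. -/
def baseMap (f : colouredGraph B c ≃g colouredGraph B' c') (w : W) : W' :=
  (f ⟨(w, 0), by simp⟩).1.1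

theorem iso_base (f : colouredGraph B c ≃g colouredGraph B' c') (w : W) :
    f ⟨(w, 0), by simp⟩ = ⟨(baseMap f w, 0), by simp⟩ := by
  refine Subtype.ext (Prod.ext rfl ?_)
  obtain ⟨x, y, h, hx, hy⟩ := (snd_eq_zero_iff (B := B) (c := c) ⟨(w, 0), by simp⟩).1 rfl
  exact (snd_eq_zero_iff (B := B') _).2 ⟨f x, f y, f.injective.ne h, f.map_adj_iff.2 hx,
    f.map_adj_iff.2 hy⟩

theorem baseMap_symm (f : colouredGraph B c ≃g colouredGraph B' c') (w : W) :
    baseMap f.symm (baseMap f w) = w := by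
  have h1 := iso_base f.symm (baseMap f w)
  rw [← iso_base f w, RelIso.symm_apply_apply] at h1
  exact (congrArg (fun v => v.1.1) h1).symm

/-- The pendant vertices at `w` are mapped injectively to pendant vertices at the image of `w`.
Together with the same inequality for the inverse, this yields equality of the colours. -/
theorem colour_le (f : colouredGraph B c ≃g colouredGraph B' c') (w : W) :
    c w ≤ c' (baseMap f w) := by
  have key : ∀ j : Fin (c w + 2), ∃ k : Fin (c' (baseMap f w) + 2),
      (f ⟨(w, j + 1), by simp⟩).1 = (baseMap f w, (k : ℕ) + 1) := by
    intro j
    have h1 : (colouredGraph B c).Adj ⟨(w, 0), by simp⟩ ⟨(w, j + 1), by simp⟩ :=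
      .inr ⟨rfl, .inl ⟨rfl, by simp⟩⟩
    have h2 := f.map_adj_iff.2 h1
    rw [iso_base] at h2
    have hne : (f ⟨(w, (j : ℕ) + 1), by simp⟩).1.2 ≠ 0 := by
      intro h
      obtain ⟨x, y, hxy, hx, hy⟩ := (snd_eq_zero_iff (B := B') _).1 h
      have := (snd_eq_zero_iff (B := B) (c := c) ⟨(w, (j : ℕ) + 1), by simp⟩).2
        ⟨f.symm x, f.symm y, f.symm.injective.ne hxy, by
          rw [← f.map_adj_iff]; simpa using hx, by rw [← f.map_adj_iff]; simpa using hy⟩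
      simp at this
    generalize f ⟨(w, (j : ℕ) + 1), by simp⟩ = z at h2 hne
    obtain ⟨⟨z1, z2⟩, hz⟩ := z
    rcases h2 with ⟨-, -, h⟩ | ⟨h, -⟩
    · exact absurd h hne
    · obtain rfl : baseMap f w = z1 := h
      simp only at hz hne
      exact ⟨⟨z2 - 1, by omega⟩, Prod.ext rfl (by simp; omega)⟩
  choose g hg using key
  have hinj : Function.Injective g := by
    intro j j' h
    have h1 := Subtype.ext ((hg j).trans ((congrArg (fun k : Fin _ => (baseMap f w, (k : ℕ) + 1))
      h).trans (hg j').symm))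
    have h2 := congrArg (fun v => v.1.2) (f.injective h1)
    exact Fin.ext (by simpa using h2)
  have := Fintype.card_le_of_injective g hinj
  simp only [Fintype.card_fin] at this
  omega

theorem nonempty_colouredGraph_iso_iff : Nonempty (colouredGraph B c ≃g colouredGraph B' c') ↔
    ∃ σ : B ≃g B', ∀ w, c' (σ w) = c w := by
  constructor
  · rintro ⟨f⟩
    refine ⟨⟨⟨baseMap f, baseMap f.symm, baseMap_symm f, baseMap_symm f.symm⟩, ?_⟩, fun w => ?_⟩
    · intro v w
      have h := f.map_adj_iff (v := ⟨(v, 0), by simp⟩) (w := ⟨(w, 0), by simp⟩)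
      rw [iso_base, iso_base] at h
      simpa [leafGraph] using! h
    · have h := colour_le f.symm (baseMap f w)
      rw [baseMap_symm] at h
      exact le_antisymm h (colour_le f w)
  · rintro ⟨σ, h⟩
    refine ⟨⟨(Equiv.prodCongr σ.toEquiv (Equiv.refl ℕ)).subtypeEquiv fun v => ?_, ?_⟩⟩
    · simp [h]
    · intro v w
      simp [leafGraph, σ.map_adj_iff]

end leaves

/-! ## The coloured graph of a game with marked actions -/

namespace Game

variable (Γ : Game)

/-- The vertices of the coloured graph of a game: players, actions, and entries of the payoff
tables. -/
inductive Node : Type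
  | player (i : Fin Γ.N)
  | action (x : Γ.Action)
  | cell (i : Fin Γ.N) (a : Γ.Profile)

/-- The graph in which each player is adjacent to their actions and payoffs, and each payoff is
adjacent to the actions played. -/
def nodeGraph : SimpleGraph Γ.Node := SimpleGraph.fromRel fun v w =>
  match v, w with
  | .player i, .action x => x.1 = i
  | .player i, .cell j _ => j = i
  | .action x, .cell _ a => Plays a x
  | _, _ => False

variable {Γ}

/-- The colours of the vertices, given colours of the payoffs. Each action in the list `xs` has a
colour of its own, the other actions have the same colour. -/
def nodeColour (c : ℚ → ℕ) (xs : List Γ.Action) : Γ.Node → ℕ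
  | .player _ => 0
  | .action x => 3 * xs.idxOf x + 1
  | .cell i a => 3 * c (Γ.u i a) + 2

variable {c : ℚ → ℕ} {xs ys : List Γ.Action}

theorem nodeGraph_adj_player_action {i : Fin Γ.N} {x : Γ.Action} :
    Γ.nodeGraph.Adj (.player i) (.action x) ↔ x.1 = i := by simp [nodeGraph]

theorem nodeGraph_adj_player_cell {i j : Fin Γ.N} {a : Γ.Profile} :
    Γ.nodeGraph.Adj (.player i) (.cell j a) ↔ j = i := by simp [nodeGraph]

theorem nodeGraph_adj_action_cell {i : Fin Γ.N} {x : Γ.Action} {a : Γ.Profile} :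
    Γ.nodeGraph.Adj (.action x) (.cell i a) ↔ Plays a x := by simp [nodeGraph]

/-- Colours modulo 3 separate players, actions and cells. Adjacency of players and actions makes the
player map compatible with the action map, adjacency at a cell identifies the image of its profile
and player, and the colour of the cell preserves the payoff. The colours of the actions give the
statement about positions in the lists. -/
theorem exists_isSymmetry_of_iso (hc : ∀ i a j b, c (Γ.u i a) = c (Γ.u j b) → Γ.u i a = Γ.u j b)
    (σ : Γ.nodeGraph ≃g Γ.nodeGraph) (hσ : ∀ w, nodeColour c ys (σ w) = nodeColour c xs w) :
    ∃ φ : Equiv.Perm Γ.Action, IsSymmetry φ ∧ ∀ x, ys.idxOf (φ x) = xs.idxOf x := by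
  have hσ' : ∀ w, nodeColour c xs (σ.symm w) = nodeColour c ys w := fun w => by
    rw [← hσ, RelIso.apply_symm_apply]
  have player : ∀ {zs ws : List Γ.Action} (τ : Γ.nodeGraph ≃g Γ.nodeGraph),
      (∀ w, nodeColour c zs (τ w) = nodeColour c ws w) → ∀ i, ∃ j, τ (.player i) = .player j := by
    intro zs ws τ hτ i
    have h := hτ (.player i)
    cases hw : τ (.player i) with
    | player j => exact ⟨j, rfl⟩
    | action x => rw [hw] at h; simp [nodeColour] at h
    | cell j a => rw [hw] at h; simp [nodeColour] at h
  have action : ∀ {zs ws : List Γ.Action} (τ : Γ.nodeGraph ≃g Γ.nodeGraph),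
      (∀ w, nodeColour c zs (τ w) = nodeColour c ws w) → ∀ x, ∃ y, τ (.action x) = .action y := by
    intro zs ws τ hτ x
    have h := hτ (.action x)
    cases hw : τ (.action x) with
    | player j => rw [hw] at h; simp [nodeColour] at h
    | action y => exact ⟨y, rfl⟩
    | cell j a => rw [hw] at h; simp only [nodeColour] at h; omega
  have cell : ∀ i a, ∃ j b, σ (.cell i a) = .cell j b ∧ Γ.u i a = Γ.u j b := by
    intro i a
    have h := hσ (.cell i a)
    cases hw : σ (.cell i a) with
    | player j => rw [hw] at h; simp [nodeColour] at h
    | action x => rw [hw] at h; simp only [nodeColour] at h; omega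
    | cell j b =>
      rw [hw] at h; simp only [nodeColour] at h
      exact ⟨j, b, rfl, hc _ _ _ _ (by omega)⟩
  choose π hπ using player σ hσ
  choose π' hπ' using player σ.symm hσ'
  choose φ hφ using action σ hσ
  choose φ' hφ' using action σ.symm hσ'
  let φe : Equiv.Perm Γ.Action := ⟨φ, φ', fun x => by
    have h := hφ' (φ x)
    rw [← hφ, RelIso.symm_apply_apply] at h
    exact (Node.action.inj h).symm, fun x => by
    have h := hφ (φ' x)
    rw [← hφ', RelIso.apply_symm_apply] at h
    exact (Node.action.inj h).symm⟩
  let πe : Equiv.Perm (Fin Γ.N) := ⟨π, π', fun x => by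
    have h := hπ' (π x)
    rw [← hπ, RelIso.symm_apply_apply] at h
    exact (Node.player.inj h).symm, fun x => by
    have h := hπ (π' x)
    rw [← hπ', RelIso.apply_symm_apply] at h
    exact (Node.player.inj h).symm⟩
  have hfst : ∀ x : Γ.Action, (φe x).1 = πe x.1 := fun x => by
    have h := σ.map_adj_iff.2 (nodeGraph_adj_player_action.2 (rfl : x.1 = x.1))
    rw [hπ, hφ] at h
    exact nodeGraph_adj_player_action.1 h
  refine ⟨φe, ⟨πe, hfst, fun i a b hab => ?_⟩, fun x => ?_⟩
  · obtain ⟨j, b', h1, h2⟩ := cell i a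
    have h3 := σ.map_adj_iff.2 (nodeGraph_adj_player_cell (a := a).2 (rfl : i = i))
    rw [hπ, h1] at h3
    obtain rfl : j = π i := nodeGraph_adj_player_cell.1 h3
    have h4 : MapsProfile φe a b' := fun k => by
      have h5 := σ.map_adj_iff.2 (nodeGraph_adj_action_cell (i := i).2
        (show Plays a ⟨k, a k⟩ from rfl))
      rw [hφ, h1] at h5
      exact nodeGraph_adj_action_cell.1 h5
    obtain rfl := hab.unique hfst h4
    exact h2
  · have h := hσ (.action x)
    rw [hφ] at h
    simp only [nodeColour] at h
    show ys.idxOf (φ x) = xs.idxOf x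
    omega

theorem IsSymmetry.exists_nodeGraph_iso {φ : Equiv.Perm Γ.Action} (h : IsSymmetry φ) :
    ∃ σ : Γ.nodeGraph ≃g Γ.nodeGraph, ∀ w,
      nodeColour c (xs.map φ) (σ w) = nodeColour c xs w := by
  obtain ⟨π, hπ, hu⟩ := id h
  choose P hP using fun a => Game.exists_mapsProfile hπ a
  have hinv : ∀ x : Γ.Action, (φ⁻¹ x).1 = π⁻¹ x.1 := fun x => by
    have h1 := hπ (φ⁻¹ x)
    rw [show φ (φ⁻¹ x) = x from φ.apply_symm_apply x] at h1
    rw [h1]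
    exact (π.symm_apply_apply _).symm
  choose P' hP' using fun a => Game.exists_mapsProfile hinv a
  have hPP' : ∀ a, P' (P a) = a := fun a => (hP' (P a)).unique hinv ((hP a).symm hπ)
  have hP'P : ∀ a, P (P' a) = a := fun a => by
    have h1 : MapsProfile φ (P' a) a := by simpa using (hP' a).symm hinv
    exact (hP (P' a)).unique hπ h1
  have hplays : ∀ a x, Plays (P a) (φ x) ↔ Plays a x := fun a x => by
    refine ⟨fun h1 => ?_, (hP a).plays⟩
    have h2 := (hP' (P a)).plays h1
    rwa [hPP', show φ⁻¹ (φ x) = x from φ.symm_apply_apply x] at h2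
  let e : Equiv.Perm Γ.Node :=
    { toFun := fun
        | .player i => .player (π i)
        | .action x => .action (φ x)
        | .cell i a => .cell (π i) (P a)
      invFun := fun
        | .player i => .player (π.symm i)
        | .action x => .action (φ.symm x)
        | .cell i a => .cell (π.symm i) (P' a)
      left_inv := by rintro (i | x | ⟨i, a⟩) <;> simp [hPP']
      right_inv := by rintro (i | x | ⟨i, a⟩) <;> simp [hP'P] }
  refine ⟨⟨e, ?_⟩, ?_⟩
  · intro v w
    rcases v with i | x | ⟨i, a⟩ <;> rcases w with j | y | ⟨j, b⟩ <;>
      simp [e, nodeGraph, hπ, hplays]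
  · rintro (i | x | ⟨i, a⟩)
    · rfl
    · show 3 * (xs.map φ).idxOf (φ x) + 1 = 3 * xs.idxOf x + 1
      rw [idxOf_map_of_injective φ.injective]
    · show 3 * c (Γ.u (π i) (P a)) + 2 = 3 * c (Γ.u i a) + 2
      rw [hu i a (P a) (hP a)]

/-- Without repetitions, `xs[i]` has position `i`, so its image first occurs in `ys` at position
`i`. Equal lengths ensure that this position is within `ys`. -/
theorem map_eq_of_idxOf_eq (hx : xs.Nodup) (hlen : xs.length = ys.length)
    {φ : Equiv.Perm Γ.Action} (h : ∀ x, ys.idxOf (φ x) = xs.idxOf x) : xs.map φ = ys := by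
  refine List.ext_getElem (by simpa using hlen) fun i h1 h2 => ?_
  have h3 : i < xs.length := by simpa using h1
  have h4 := h xs[i]
  rw [hx.idxOf_getElem] at h4
  have h5 : ys.idxOf (φ xs[i]) < ys.length := by omega
  have h6 := List.getElem_idxOf h5
  rw [List.getElem_map, ← h6]
  congr 1

/-- A symmetry that maps `xs` to `ys` exists if and only if the coloured graphs of the game with
these marked actions are isomorphic. -/
theorem nonempty_iso_iff_exists_map_eq
    (hc : ∀ i a j b, c (Γ.u i a) = c (Γ.u j b) → Γ.u i a = Γ.u j b)
    (hx : xs.Nodup) (hlen : xs.length = ys.length) :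
    Nonempty (colouredGraph Γ.nodeGraph (nodeColour c xs) ≃g
      colouredGraph Γ.nodeGraph (nodeColour c ys)) ↔
    ∃ φ : Equiv.Perm Γ.Action, φ ∈ Γ.symmetryGroup ∧ xs.map φ = ys := by
  rw [nonempty_colouredGraph_iso_iff]
  constructor
  · rintro ⟨σ, hσ⟩
    obtain ⟨φ, h1, h2⟩ := exists_isSymmetry_of_iso hc σ hσ
    exact ⟨φ, h1, map_eq_of_idxOf_eq hx hlen h2⟩
  · rintro ⟨φ, hφ, rfl⟩
    exact IsSymmetry.exists_nodeGraph_iso hφ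

end Game

end GameSym

namespace GameSym

open Polynomial (X)

/-! ## Reading the code of a game -/

section parsing

variable {α : Type} [Coded α]

/-- A step in reading the code of a game. The state consists of the phase, the bits of the current
item, the numbers of actions, and the codes of the payoffs. -/
def parseStep (s : ℕ × List Bool × List ℕ × List (List Bool)) (b : Bool) :
    ℕ × List Bool × List ℕ × List (List Bool) :=
  let cur := s.2.1
  let ms := s.2.2.1
  let us := s.2.2.2
  -- Phases `0` and `1` read the list of unary numbers, `1` being inside a number. Phase `2` expects
  -- the sign of a payoff, `3` and `4` a continuation mark and a bit of the numerator, and `5` and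
  -- `6` the same for the denominator.
  bif s.1 == 0 then (bif b then 1 else 2, [], ms, us)
  else bif s.1 == 1 then bif b then (1, b :: cur, ms, us) else (0, [], ms ++ [cur.length], us)
  else bif s.1 == 2 then (3, cur ++ [b], ms, us)
  else bif s.1 == 3 then (bif b then 4 else 5, cur ++ [b], ms, us)
  else bif s.1 == 4 then (3, cur ++ [b], ms, us)
  else bif s.1 == 5 then
    bif b then (6, cur ++ [b], ms, us) else (2, [], ms, us ++ [cur ++ [b]])
  else (5, cur ++ [b], ms, us)

/-- The numbers of actions, and the codes of the payoffs, of a game with a given code. -/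
def parse (z : List Bool) : List ℕ × List (List Bool) := (z.foldl parseStep (0, [], [], [])).2.2

theorem length_succ_le_sz {β : Type} [Coded β] (l : List β) : 2 * l.length + 1 ≤ sz l := by
  induction l with
  | nil => simp [sz_nil]
  | cons x l ih => have := sz_pos x; rw [sz_cons, List.length_cons]; omega

theorem sz_concat_le {β : Type} [Coded β] (l : List β) (x : β) :
    sz (l ++ [x]) ≤ sz l + sz x + 2 :=
  (sz_append_le l [x]).trans (by rw [sz_cons, sz_nil]; omega)

/-- When an item is completed, it is appended to one of the two lists, but at the same time the
current item is emptied. Hence a step increases the size by a constant only, as iteration in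
polynomial time requires. -/
theorem sz_parseStep_le (s : ℕ × List Bool × List ℕ × List (List Bool)) (b : Bool) :
    sz (parseStep s b) ≤ sz s + 30 := by
  obtain ⟨ph, cur, ms, us⟩ := s
  have h1 := sz_concat_le cur b
  have h2 := sz_concat_le ms cur.length
  have h3 := sz_concat_le us (cur ++ [b])
  have h4 := length_succ_le_sz cur
  have h5 := sz_bool_le b
  have h6 : sz (b :: cur) = _ := sz_cons b cur
  rw [sz_nat] at h2
  unfold parseStep
  rcases Nat.lt_or_ge ph 6 with h | h
  · interval_cases ph <;> cases b <;>
      simp only [sz_pair, sz_nat, cond_true, cond_false, beq_self_eq_true, Nat.reduceBEq, sz_nil]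
        at * <;> omega
  · have e : ∀ k, k < 6 → (ph == k) = false := fun k hk => beq_false_of_ne (by omega)
    simp only [e 0 (by omega), e 1 (by omega), e 2 (by omega), e 3 (by omega), e 4 (by omega),
      e 5 (by omega), cond_false, sz_pair, sz_nat]
    omega

@[fun_prop]
theorem PT.parse {z : α → List Bool} (hz : PT z) : PT fun a => parse (z a) := by
  have h : PT fun a => (z a).foldl parseStep (0, [], [], []) := by
    refine PT.foldl (g := fun _ => parseStep) hz (by fun_prop) (by unfold parseStep; fun_prop)
      ⟨30, fun a s x => ?_⟩
    rw [show ((30 : Polynomial ℕ).eval (sz (a, x))) = 30 from Polynomial.eval_ofNat _ _]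
    exact sz_parseStep_le s x
  exact PT.comp (G := fun s : ℕ × List Bool × List ℕ × List (List Bool) => s.2.2) (by fun_prop) h

theorem foldl_parseStep_header (ns : List ℕ) : ∀ (ms : List ℕ) (us : List (List Bool)),
    (encList encUnary ns).foldl parseStep (0, [], ms, us) = (2, [], ms ++ ns, us) := by
  have h : ∀ n cur ms us, (encUnary n).foldl parseStep (1, cur, ms, us) =
      (0, [], ms ++ [n + cur.length], us) := by
    intro n
    induction n with
    | zero => intro cur ms us; simp [encUnary, parseStep]
    | succ n ih =>
      intro cur ms us
      have := ih (true :: cur) ms us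
      rw [show encUnary (n + 1) = true :: encUnary n by simp [encUnary, List.replicate_succ]]
      rw [List.foldl_cons, show parseStep (1, cur, ms, us) true = (1, true :: cur, ms, us) from rfl,
        this]
      simp; omega
  induction ns with
  | nil => intro ms us; simp [encList, parseStep]
  | cons n ns ih =>
    intro ms us
    rw [show encList encUnary (n :: ns) = true :: (encUnary n ++ encList encUnary ns) by
      simp [encList], List.foldl_cons, List.foldl_append,
      show parseStep (0, [], ms, us) true = (1, [], ms, us) from rfl, h, ih]
    simp

theorem foldl_parseStep_encRat (q : ℚ) (ms : List ℕ) (us : List (List Bool)) :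
    (encRat q).foldl parseStep (2, [], ms, us) = (2, [], ms, us ++ [encRat q]) := by
  have h1 : ∀ (l : List Bool) cur, (encList (fun b => [b]) l).foldl parseStep (3, cur, ms, us) =
      (5, cur ++ encList (fun b => [b]) l, ms, us) := by
    intro l
    induction l with
    | nil => intro cur; simp [encList, parseStep]
    | cons b l ih =>
      intro cur
      rw [show encList (fun b => [b]) (b :: l) = true :: b :: encList (fun b => [b]) l by
        simp [encList], List.foldl_cons, List.foldl_cons,
        show parseStep (parseStep (3, cur, ms, us) true) b =
          (3, (cur ++ [true]) ++ [b], ms, us) from rfl, ih]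
      simp
  have h2 : ∀ (l : List Bool) cur, (encList (fun b => [b]) l).foldl parseStep (5, cur, ms, us) =
      (2, [], ms, us ++ [cur ++ encList (fun b => [b]) l]) := by
    intro l
    induction l with
    | nil => intro cur; simp [encList, parseStep]
    | cons b l ih =>
      intro cur
      rw [show encList (fun b => [b]) (b :: l) = true :: b :: encList (fun b => [b]) l by
        simp [encList], List.foldl_cons, List.foldl_cons,
        show parseStep (parseStep (5, cur, ms, us) true) b =
          (5, (cur ++ [true]) ++ [b], ms, us) from rfl, ih]
      simp
  rw [encRat, encInt, encNat, encNat, List.cons_append, List.foldl_cons, List.foldl_append,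
    show parseStep (2, [], ms, us) (decide (q.num < 0)) =
      (3, [decide (q.num < 0)], ms, us) from rfl, h1, h2]
  simp

theorem parse_eq (ns : List ℕ) (qs : List ℚ) :
    parse (encList encUnary ns ++ qs.flatMap encRat) = (ns, qs.map encRat) := by
  have h : ∀ (qs : List ℚ) us, (qs.flatMap encRat).foldl parseStep (2, [], ns, us) =
      (2, [], ns, us ++ qs.map encRat) := by
    intro qs
    induction qs with
    | nil => intro us; simp
    | cons q qs ih =>
      intro us
      rw [List.flatMap_cons, List.foldl_append, foldl_parseStep_encRat, ih]
      simp
  rw [parse, List.foldl_append, foldl_parseStep_header, List.nil_append, h]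
  simp

/-- A step in computing the digits of a number in a mixed radix system. -/
def digitStep (s : ℕ × List ℕ) (m : ℕ) : ℕ × List ℕ := (s.1 / m, s.2 ++ [s.1 % (m - 1 + 1)])

/-- The digits of `k` in the mixed radix system with bases `ms`. -/
def digitList (ms : List ℕ) (k : ℕ) : List ℕ := (ms.foldl digitStep (k, [])).2

@[fun_prop]
theorem PT.digitList {ms : α → List ℕ} {k : α → ℕ} (hm : PT ms) (hk : PT k) :
    PT fun a => digitList (ms a) (k a) := by
  have h : PT fun a => (ms a).foldl digitStep (k a, []) := by
    refine PT.foldl (g := fun _ => digitStep) hm (by fun_prop) (by unfold digitStep; fun_prop)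
      ⟨2 * X + 10, fun a s x => ?_⟩
    have h1 := sz_concat_le s.2 (s.1 % (x - 1 + 1))
    -- The modulus `x - 1 + 1` equals `x` for positive bases, and bounds the digit in terms of `x`
    -- even for `x = 0`, which can occur for lists that do not come from a game.
    have h2 := Nat.mod_lt s.1 (show 0 < x - 1 + 1 by omega)
    have h3 := Nat.div_le_self s.1 x
    have h4 : sz s = _ := sz_pair s.1 s.2
    simp only [digitStep, sz_pair, sz_nat, Polynomial.eval_add, Polynomial.eval_mul,
      Polynomial.eval_ofNat, Polynomial.eval_X] at *
    omega
  exact PT.comp (G := fun s : ℕ × List ℕ => s.2) (by fun_prop) h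

/-- Repeated division by the bases is division by their product. This gives the digits in the form
in which `finPiFinEquiv.symm` computes them. -/
theorem foldl_digitStep {N : ℕ} (n : Fin N → ℕ) (hn : ∀ i, 0 < n i) (q : ℕ) (acc : List ℕ) :
    ((List.ofFn n).foldl digitStep (q, acc)).2 =
      acc ++ List.ofFn fun j => q / (∏ i : Fin j, n ⟨i, i.2.trans j.2⟩) % n j := by
  induction N generalizing q acc with
  | zero => simp
  | succ N ih =>
    rw [List.ofFn_succ, List.foldl_cons, digitStep, ih _ fun i => hn _, List.ofFn_succ,
      Nat.sub_add_cancel (hn 0), List.append_assoc]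
    congr 2
    simp only [List.singleton_append, List.cons.injEq]
    constructor
    · rw [show (∏ i : Fin ((0 : Fin (N + 1)) : ℕ), n ⟨i, i.2.trans (0 : Fin (N + 1)).2⟩) = 1 from
        Finset.prod_empty, Nat.div_one]
    · congr 1
      funext j
      rw [Nat.div_div_eq_div_mul]
      congr 2
      exact (Fin.prod_univ_succ (fun i : Fin (j.1 + 1) =>
        n ⟨i, i.2.trans (Nat.succ_lt_succ j.2)⟩)).symm

theorem digitList_eq {N : ℕ} {n : Fin N → ℕ} (hn : ∀ i, 0 < n i) (k : Fin (∏ i, n i)) :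
    digitList (List.ofFn n) k = List.ofFn fun j => (finPiFinEquiv.symm k j : ℕ) := by
  rw [digitList, foldl_digitStep n hn, List.nil_append]
  rfl

end parsing

/-! ## The graph that is given by a list of vertices -/

section listGraph

variable {V : Type}

/-- The code of a graph on the entries of a list. -/
def graphString (adj : V → V → Bool) (l : List V) : List Bool :=
  encUnary l.length ++ l.flatMap fun v => l.flatMap fun w => [adj v w]

-- The oracle accepts only graphs on an initial segment of the natural numbers; positions in the
-- list serve as the names of the vertices.
open Classical in
theorem graphString_eq {A : SimpleGraph V} {adj : V → V → Bool} (l : List V)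
    (h : ∀ v w, adj v w = true ↔ A.Adj v w) :
    graphString adj l = encGraph ⟨l.length, A.comap l.get⟩ := by
  have e : ∀ g : V → List Bool, l.flatMap g = (List.finRange l.length).flatMap (g ∘ l.get) :=
    fun g => by
      conv_lhs => rw [← List.map_get_finRange l]
      rw [List.flatMap_map]
      rfl
  rw [graphString, encGraph, e]
  congr 2
  funext v
  rw [Function.comp_apply, e]
  congr 1
  funext w
  rw [Function.comp_apply, Bool.eq_iff_iff.2 ((h _ _).trans decide_eq_true_iff.symm)]
  rfl

theorem nonempty_iso_of_list {A : SimpleGraph V} {l : List V} (hl : l.Nodup) {p : V → Prop}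
    (h : ∀ v, v ∈ l ↔ p v) :
    Nonempty (A.comap l.get ≃g A.comap (Subtype.val : {v // p v} → V)) := by
  classical
  exact ⟨⟨(hl.getEquiv l).trans (Equiv.subtypeEquivRight h), by
    intro v w
    rfl⟩⟩

theorem graphString_map {V' : Type} (g : V' → V) (adj : V → V → Bool) (l : List V') :
    graphString adj (l.map g) = graphString (fun v w => adj (g v) (g w)) l := by
  simp [graphString, List.flatMap_map]

end listGraph

end GameSym

namespace GameSym

/-! ## Computing the coloured graph of a game -/

section machine

variable {α : Type} [Coded α]

/-- The codes of all actions. -/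
def actionList (ms : List ℕ) : List (List ℕ) :=
  (List.range ms.length).flatMap fun i => (List.range (ms.getD i 0)).map fun k => [1, i, k]

@[fun_prop]
theorem PT.actionList {ms : α → List ℕ} (h : PT ms) : PT fun a => actionList (ms a) := by
  unfold GameSym.actionList; fun_prop

/-- The codes of the vertices of the graph of a game with their colours. -/
def nodeList (D : List ℕ × List (List Bool)) (xs : List (List ℕ)) : List (List ℕ × ℕ) :=
  ((List.range D.1.length).map fun i => ([0, i], 0)) ++
  (((actionList D.1).map fun x => (x, 3 * xs.findIdx (fun y => y == x) + 1)) ++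
  (List.range D.1.length).flatMap fun i =>
    (List.range (D.2.length / D.1.length)).map fun k => (2 :: i :: digitList D.1 k,
      3 * D.2.findIdx (fun y => y == D.2.getD (i * (D.2.length / D.1.length) + k) []) + 2))

@[fun_prop]
theorem PT.nodeList {D : α → List ℕ × List (List Bool)} {xs : α → List (List ℕ)} (hD : PT D)
    (hx : PT xs) : PT fun a => nodeList (D a) (xs a) := by
  have h : PT fun p : (List ℕ × List (List Bool)) × List (List ℕ) => GameSym.nodeList p.1 p.2 := by
    have h0 : ∀ {β : Type} [Coded β] {F G : β → List ℕ}, PT F → PT G → PT fun a => F a == G a :=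
      PT.beq_list_nat
    unfold GameSym.nodeList
    fun_prop
  exact h.comp (PT.prodMk hD hx)

/-- Expands each vertex to the vertex and the pendant vertices at it. -/
def leafList (l : List (List ℕ × ℕ)) : List (List ℕ × ℕ) :=
  l.flatMap fun p => (List.range (p.2 + 3)).map fun j => (p.1, j)

/-- Adjacency of vertices that are given by their codes, in one direction. -/
def codeRel (v w : List ℕ) : Bool :=
  bif v.getD 0 0 == 0 then (w.getD 0 0 == 1 || w.getD 0 0 == 2) && w.getD 1 0 == v.getD 1 0
  -- The code of a cell begins with its tag and its player, so the action of player `i` in the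
  -- profile is entry `2 + i`.
  else v.getD 0 0 == 1 && (w.getD 0 0 == 2 && w.getD (2 + v.getD 1 0) 0 == v.getD 2 0)

/-- Adjacency of vertices of the coloured graph that are given by their codes. -/
def codeAdj (v w : List ℕ × ℕ) : Bool :=
  bif v.2 == 0 && w.2 == 0 then codeRel v.1 w.1 || codeRel w.1 v.1
  else v.1 == w.1 && (v.2 == 0 || w.2 == 0)

theorem PT.codeAdj : PT fun p : (List ℕ × ℕ) × (List ℕ × ℕ) => codeAdj p.1 p.2 := by
  unfold GameSym.codeAdj codeRel; fun_prop

/-- The code of the coloured graph of a game. -/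
def gameGraphString (D : List ℕ × List (List Bool)) (xs : List (List ℕ)) : List Bool :=
  graphString codeAdj (leafList (nodeList D xs))

@[fun_prop]
theorem PT.gameGraphString {D : α → List ℕ × List (List Bool)} {xs : α → List (List ℕ)} (hD : PT D)
    (hx : PT xs) : PT fun a => gameGraphString (D a) (xs a) := by
  have h1 : PT fun l => graphString GameSym.codeAdj l := by
    unfold graphString
    have h2 : PT fun p : (List (List ℕ × ℕ) × (List ℕ × ℕ)) × (List ℕ × ℕ) =>
        GameSym.codeAdj p.1.2 p.2 :=
      PT.codeAdj.comp (F := fun p : (List (List ℕ × ℕ) × (List ℕ × ℕ)) × (List ℕ × ℕ) =>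
        (p.1.2, p.2)) (by fun_prop)
    fun_prop
  have h2 : PT fun a => leafList (GameSym.nodeList (D a) (xs a)) := by
    unfold leafList; fun_prop
  exact PT.comp h1 h2

end machine

namespace Game

variable (Γ : Game)

/-- The list of all actions. -/
def actions : List Γ.Action :=
  (List.finRange Γ.N).flatMap fun i => (List.finRange (Γ.numActions i)).map fun k => ⟨i, k⟩

/-- The list of all payoffs. -/
def payoffs : List ℚ := (List.finRange Γ.N).flatMap fun i =>
  (List.finRange (∏ j, Γ.numActions j)).map fun k => Γ.u i (finPiFinEquiv.symm k)

/-- The list of all vertices of the graph of a game. -/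
def nodes : List Γ.Node :=
  (List.finRange Γ.N).map .player ++ (Γ.actions.map .action ++
  (List.finRange Γ.N).flatMap fun i =>
    (List.finRange (∏ j, Γ.numActions j)).map fun k => .cell i (finPiFinEquiv.symm k))

/-- The numbers of actions and the codes of the payoffs. -/
def table : List ℕ × List (List Bool) := (List.ofFn Γ.numActions, Γ.payoffs.map encRat)

theorem parse_encGame : parse (encGame Γ) = Γ.table := by
  rw [encGame, table, ← parse_eq, payoffs]
  simp [List.flatMap_assoc, List.flatMap_map]

variable {Γ}

theorem mem_actions (x : Γ.Action) : x ∈ Γ.actions := by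
  obtain ⟨i, k⟩ := x
  simp [actions]

theorem nodup_actions : Γ.actions.Nodup := by
  refine List.nodup_flatMap.2 ⟨fun i _ => (List.nodup_finRange _).map fun k l h => ?_, ?_⟩
  · simpa using h
  · refine (List.nodup_finRange _).imp fun {i j} hij => ?_
    simp only [Function.onFun, List.disjoint_left, List.mem_map]
    rintro _ ⟨k, -, rfl⟩ ⟨l, -, h⟩
    exact hij (congrArg Sigma.fst h).symm

theorem mem_nodes (v : Γ.Node) : v ∈ Γ.nodes := by
  rcases v with i | x | ⟨i, a⟩
  · simp [nodes]
  · simp [nodes, mem_actions]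
  · simp only [nodes, List.mem_append, List.mem_flatMap, List.mem_map]
    exact .inr (.inr ⟨i, by simp, finPiFinEquiv a, by simp, by simp⟩)

theorem nodup_nodes : Γ.nodes.Nodup := by
  refine List.Nodup.append ((List.nodup_finRange _).map fun _ _ => Node.player.inj)
    (List.Nodup.append (nodup_actions.map fun _ _ => Node.action.inj) ?_ ?_) ?_
  · refine List.nodup_flatMap.2 ⟨fun i _ => (List.nodup_finRange _).map fun k l h => ?_, ?_⟩
    · simpa using h
    · refine (List.nodup_finRange _).imp fun {i j} hij => ?_
      simp only [Function.onFun, List.disjoint_left, List.mem_map]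
      rintro _ ⟨k, -, rfl⟩ ⟨l, -, h⟩
      exact hij (Node.cell.inj h).1.symm
  · simp only [List.disjoint_left, List.mem_map, List.mem_flatMap]
    rintro _ ⟨x, -, rfl⟩ ⟨i, -, k, -, h⟩
    cases h
  · simp [List.disjoint_left]

theorem length_payoffs : Γ.payoffs.length = Γ.N * ∏ j, Γ.numActions j := by
  simp [payoffs, List.length_flatMap]

/-- The code of an action. -/
def actionCode (x : Γ.Action) : List ℕ := [1, x.1, x.2]

/-- The code of a vertex of the graph of a game. -/
def nodeCode : Γ.Node → List ℕ
  | .player i => [0, i]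
  | .action x => actionCode x
  | .cell i a => 2 :: i :: List.ofFn fun j => (a j : ℕ)

theorem actionCode_injective : Function.Injective (actionCode (Γ := Γ)) := by
  rintro ⟨i, k⟩ ⟨j, l⟩ h
  simp only [actionCode, List.cons.injEq, true_and, and_true] at h
  obtain ⟨h1, h2⟩ := h
  obtain rfl := Fin.ext h1
  rw [Fin.ext h2]

theorem nodeCode_injective : Function.Injective (nodeCode (Γ := Γ)) := by
  rintro (i | x | ⟨i, a⟩) (j | y | ⟨j, b⟩) h
  · simp only [nodeCode, List.cons.injEq, true_and, and_true] at h
    rw [Fin.ext h]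
  · simp [nodeCode, actionCode] at h
  · simp [nodeCode] at h
  · simp [nodeCode, actionCode] at h
  · rw [actionCode_injective (show actionCode x = actionCode y from h)]
  · simp [nodeCode, actionCode] at h
  · simp [nodeCode] at h
  · simp [nodeCode, actionCode] at h
  · simp only [nodeCode, List.cons.injEq, true_and] at h
    obtain ⟨h1, h2⟩ := h
    obtain rfl := Fin.ext h1
    have h3 := List.ofFn_injective h2
    rw [show a = b from funext fun j => Fin.ext (congrFun h3 j)]

/-- Payoffs are coloured by the position of their code in the payoff table. -/
def payoffColour (Γ : Game) (q : ℚ) : ℕ := (Γ.payoffs.map encRat).idxOf (encRat q)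

theorem mem_payoffs (i : Fin Γ.N) (a : Γ.Profile) : Γ.u i a ∈ Γ.payoffs := by
  simp only [payoffs, List.mem_flatMap, List.mem_map]
  exact ⟨i, by simp, finPiFinEquiv a, by simp, by simp⟩

theorem payoffColour_inj (i : Fin Γ.N) (a : Γ.Profile) (j : Fin Γ.N) (b : Γ.Profile)
    (h : Γ.payoffColour (Γ.u i a) = Γ.payoffColour (Γ.u j b)) : Γ.u i a = Γ.u j b :=
  prefixInjective_encRat.injective
    ((List.idxOf_inj (List.mem_map_of_mem (mem_payoffs i a))).1 h)

theorem actionList_ofFn : actionList (List.ofFn Γ.numActions) = Γ.actions.map actionCode := by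
  rw [actionList, List.length_ofFn, ← List.map_coe_finRange_eq_range, List.flatMap_map, actions,
    List.map_flatMap]
  congr 1
  funext i
  rw [show (List.ofFn Γ.numActions).getD i 0 = Γ.numActions i by simp,
    ← List.map_coe_finRange_eq_range, List.map_map, List.map_map]
  rfl

theorem payoffs_getD (i : Fin Γ.N) (k : Fin (∏ j, Γ.numActions j)) :
    (Γ.payoffs.map encRat).getD (i * (∏ j, Γ.numActions j) + k) [] =
      encRat (Γ.u i (finPiFinEquiv.symm k)) := by
  have h : Γ.payoffs.map encRat = (List.range Γ.N).flatMap fun i =>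
      (List.range (∏ j, Γ.numActions j)).map fun k =>
        if h : i < Γ.N ∧ k < ∏ j, Γ.numActions j then
          encRat (Γ.u ⟨i, h.1⟩ (finPiFinEquiv.symm ⟨k, h.2⟩)) else [] := by
    rw [payoffs, List.map_flatMap, ← List.map_coe_finRange_eq_range (n := Γ.N), List.flatMap_map]
    congr 1
    funext i
    rw [List.map_map, ← List.map_coe_finRange_eq_range, List.map_map]
    congr 1
    funext k
    simp
  have h1 := getD_flatMap [] (∏ j, Γ.numActions j) (List.range Γ.N) (fun i =>
      (List.range (∏ j, Γ.numActions j)).map fun k =>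
        if h : i < Γ.N ∧ k < ∏ j, Γ.numActions j then
          encRat (Γ.u ⟨i, h.1⟩ (finPiFinEquiv.symm ⟨k, h.2⟩)) else []) []
    (fun _ _ => by simp) i k (by simp) k.2
  rw [List.append_nil, ← h] at h1
  rw [h1]
  simp

/-- What is computed from codes agrees with the abstract coloured graph. The number of profiles is
recovered as the quotient of the numbers of payoffs and of players. -/
theorem nodeList_eq (xs : List Γ.Action) : nodeList Γ.table (xs.map actionCode) =
    Γ.nodes.map fun v => (nodeCode v, nodeColour Γ.payoffColour xs v) := by
  rw [nodeList, nodes, List.map_append, List.map_append, table, actionList_ofFn]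
  simp only [List.length_ofFn, List.length_map, length_payoffs]
  congr 1
  · rw [← List.map_coe_finRange_eq_range, List.map_map, List.map_map]
    rfl
  congr 1
  · rw [List.map_map, List.map_map]
    congr 1
    funext x
    have := idxOf_map_of_injective actionCode_injective xs x
    simp only [Function.comp_apply, nodeCode, nodeColour, ← this]
    rfl
  · rw [← List.map_coe_finRange_eq_range (n := Γ.N), List.flatMap_map, List.map_flatMap]
    congr 1
    funext i
    rw [Nat.mul_div_cancel_left _ i.pos, ← List.map_coe_finRange_eq_range, List.map_map,
      List.map_map]
    congr 1
    funext k
    simp only [Function.comp_apply, digitList_eq Γ.numActions_pos, payoffs_getD]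
    rfl

theorem codeRel_nodeCode (v w : Γ.Node) :
    (codeRel (nodeCode v) (nodeCode w) || codeRel (nodeCode w) (nodeCode v)) = true ↔
      Γ.nodeGraph.Adj v w := by
  have e : ∀ (x : Γ.Action) (i : Fin Γ.N) (a : Γ.Profile),
      (2 :: (i : ℕ) :: List.ofFn fun j => (a j : ℕ))[2 + (x.1 : ℕ)]?.getD 0 = a x.1 := fun x i a => by
    rw [Nat.add_comm]; simp
  rcases v with i | x | ⟨i, a⟩ <;> rcases w with j | y | ⟨j, b⟩ <;>
    simp [codeRel, nodeCode, actionCode, nodeGraph, Plays, Fin.ext_iff]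
  · rw [e]
  · rw [e]

theorem codeAdj_nodeCode (v w : Γ.Node × ℕ) :
    codeAdj (Prod.map nodeCode id v) (Prod.map nodeCode id w) = true ↔
      (leafGraph Γ.nodeGraph).Adj v w := by
  obtain ⟨v, i⟩ := v
  obtain ⟨w, j⟩ := w
  have h := codeRel_nodeCode v w
  rw [Bool.or_eq_true] at h
  rcases i with _ | i <;> rcases j with _ | j <;>
    simp [codeAdj, leafGraph, h, nodeCode_injective.eq_iff]

/-- The list of all vertices of the coloured graph of a game. -/
def leaves (xs : List Γ.Action) : List (Γ.Node × ℕ) :=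
  Γ.nodes.flatMap fun v => (List.range (nodeColour Γ.payoffColour xs v + 3)).map fun j => (v, j)

theorem mem_leaves (xs : List Γ.Action) (v : Γ.Node × ℕ) :
    v ∈ leaves xs ↔ v.2 < nodeColour Γ.payoffColour xs v.1 + 3 := by
  obtain ⟨v, j⟩ := v
  simp [leaves, mem_nodes]

theorem nodup_leaves (xs : List Γ.Action) : (leaves xs).Nodup := by
  refine List.nodup_flatMap.2 ⟨fun i _ => List.nodup_range.map fun k l h => ?_, ?_⟩
  · simpa using h
  · refine nodup_nodes.imp fun {v w} hvw => ?_
    simp only [Function.onFun, List.disjoint_left, List.mem_map]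
    rintro _ ⟨k, -, rfl⟩ ⟨l, -, h⟩
    exact hvw (congrArg Prod.fst h).symm

theorem gameGraphString_eq (xs : List Γ.Action) : gameGraphString Γ.table (xs.map actionCode) =
    encGraph ⟨(leaves xs).length, (leafGraph Γ.nodeGraph).comap (leaves xs).get⟩ := by
  rw [gameGraphString, nodeList_eq, ← graphString_eq _ codeAdj_nodeCode,
    ← graphString_map (Prod.map nodeCode id)]
  congr 1
  simp only [leafList, leaves, List.flatMap_map, List.map_flatMap, List.map_map]
  rfl

/-- A query for a symmetry that maps the list of actions `xs` to the list `ys`. -/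
theorem solvedBy_graphIsomorphism {f : List Bool → List Bool} (hf : graphIsomorphism.SolvedBy f)
    {xs ys : List Γ.Action} (hx : xs.Nodup) (hlen : xs.length = ys.length) :
    (f (gameGraphString Γ.table (xs.map actionCode) ++
      gameGraphString Γ.table (ys.map actionCode)) == [true]) = true ↔
    ∃ φ : Equiv.Perm Γ.Action, φ ∈ Γ.symmetryGroup ∧ xs.map φ = ys := by
  classical
  rw [gameGraphString_eq, gameGraphString_eq,
    ← nonempty_iso_iff_exists_map_eq payoffColour_inj hx hlen]
  have h := hf (⟨_, (leafGraph Γ.nodeGraph).comap (leaves xs).get⟩,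
    ⟨_, (leafGraph Γ.nodeGraph).comap (leaves ys).get⟩)
  obtain ⟨e⟩ := nonempty_iso_of_list (A := leafGraph Γ.nodeGraph) (nodup_leaves xs) (mem_leaves xs)
  obtain ⟨e'⟩ := nonempty_iso_of_list (A := leafGraph Γ.nodeGraph) (nodup_leaves ys) (mem_leaves ys)
  simp only [graphIsomorphism] at h
  rw [h]
  simp only [beq_iff_eq, List.cons.injEq, and_true, decide_eq_true_iff]
  exact ⟨fun ⟨g⟩ => ⟨(e.symm.trans g).trans e'⟩, fun ⟨g⟩ => ⟨(e.trans g).trans e'.symm⟩⟩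

end Game

end GameSym

namespace GameSym

open Polynomial (X)

/-! ## Iterated oracle queries and binary multiplication -/

section oracle

variable {α β γ σ τ : Type} [Coded α] [Coded β] [Coded γ] [Coded σ] [Coded τ]

/-- Iteration over a list with additive growth of the intermediate results. -/
theorem PTO.foldl {L : α → List τ} {S : α → σ} {g : (List Bool → List Bool) → α → σ → τ → σ}
    (hL : PT L) (hS : PT S) (hg : PTO fun f (p : α × σ × τ) => g f p.1 p.2.1 p.2.2)
    (hB : ∀ r : Polynomial ℕ, ∃ p : Polynomial ℕ, ∀ f, LengthBounded r f →
      ∀ a s x, sz (g f a s x) ≤ sz s + p.eval (sz (a, x))) :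
    PTO fun f a => (L a).foldl (g f a) (S a) := by
  have e : ∀ (f : List Bool → List Bool) (l : List τ) (a : α) (s : σ),
      l.foldl (fun (p : α × σ) x => (p.1, g f p.1 p.2 x)) (a, s) = (a, l.foldl (g f a) s) := by
    intro f l
    induction l with
    | nil => intro a s; rfl
    | cons x l ih => intro a s; simp [ih]
  have h1 : PTO fun f a => (L a).foldl (fun (p : α × σ) x => (p.1, g f p.1 p.2 x)) (a, S a) := by
    refine PTO.foldl_of_bound (g := fun f (p : α × σ) x => (p.1, g f p.1 p.2 x)) hL
      (PT.prodMk PT.id hS) ?_ fun r => ?_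
    · have h2 : PT fun q : (α × σ) × τ => (q.1.1, q.1.2, q.2) := by fun_prop
      have h3 : PT fun q : (α × σ) × τ => q.1.1 := by fun_prop
      exact PTO.prodMk h3 (PTO.comp hg h2)
    obtain ⟨p, hp⟩ := hB r
    obtain ⟨pL, hpL⟩ := hL.sz_le
    obtain ⟨pS, hpS⟩ := hS.sz_le
    refine ⟨X + (pS + pL * p.comp (X + pL + 1)) + 1, fun f hf a l hl => ?_⟩
    have key : ∀ l : List τ, (∀ x ∈ l, x ∈ L a) → ∀ s,
        sz (l.foldl (g f a) s) ≤ sz s + l.length * p.eval (sz a + pL.eval (sz a) + 1) := by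
      intro l
      induction l with
      | nil => intro _ s; simp
      | cons x l ih =>
        intro h s
        have h1 := ih (fun y hy => h y (by simp [hy])) (g f a s x)
        have h2 := hp f hf a s x
        have h3 := eval_mono p (show sz (a, x) ≤ sz a + pL.eval (sz a) + 1 by
          have := (sz_le_of_mem (h x (by simp))).trans (hpL a)
          rw [sz_pair]; omega)
        rw [List.foldl_cons, List.length_cons, Nat.succ_mul]
        omega
    have h1 := key l (fun x hx => hl.subset hx) (S a)
    have h2 := hpS a
    have h3 : l.length ≤ pL.eval (sz a) :=
      hl.length_le.trans ((length_le_sz _).trans (hpL a))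
    have h4 := Nat.mul_le_mul_right (p.eval (sz a + pL.eval (sz a) + 1)) h3
    rw [e, sz_pair]
    simp only [Polynomial.eval_add, Polynomial.eval_mul, Polynomial.eval_X, Polynomial.eval_one,
      Polynomial.eval_comp]
    omega
  simp only [e] at h1
  exact PTO.comp (G := fun _ (p : α × σ) => p.2) PT.snd h1

theorem PTO.map {L : α → List β} {g : (List Bool → List Bool) → α → β → γ} (hL : PT L)
    (hg : PTO fun f (p : α × β) => g f p.1 p.2) : PTO fun f a => (L a).map fun x => g f a x := by
  have h : PTO fun f a => (L a).foldl (fun acc x => acc ++ [g f a x]) [] := by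
    refine PTO.foldl (g := fun f a acc x => acc ++ [g f a x]) hL (by fun_prop) ?_ fun r => ?_
    · have h1 : PT fun p : α × List γ × β => (p.1, p.2.2) := by fun_prop
      have h2 : PT fun p : α × List γ × β => p.2.1 := by fun_prop
      have h3 : PT fun p : List γ × γ => p.1 ++ [p.2] := by fun_prop
      have h4 : PTO fun f (p : α × List γ × β) => (p.2.1, g f p.1 p.2.2) :=
        PTO.prodMk h2 (PTO.comp hg h1)
      exact PTO.comp (G := fun _ (p : List γ × γ) => p.1 ++ [p.2]) h3 h4
    · obtain ⟨c, hc⟩ := hg.exists_bound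
      obtain ⟨p, hp⟩ := hc r
      refine ⟨p + 2, fun f hf a s x => ?_⟩
      have := (hp f hf).1 (a, x)
      have := sz_concat_le s (g f a x)
      simp only [Polynomial.eval_add, Polynomial.eval_ofNat] at *
      omega
  convert h using 3 with f a
  have : ∀ (l : List β) (t : List γ), l.foldl (fun acc x => acc ++ [g f a x]) t =
      t ++ l.map (g f a) := by
    intro l
    induction l with
    | nil => intro t; simp
    | cons x l ih => intro t; simp [ih]
  simp [this]

end oracle

/-! ### Products in binary with factors in unary -/

section arithmetic

variable {α : Type} [Coded α]

/-- A step of the multiplication of a number in binary by `c`. -/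
def mulStep (c : ℕ) (s : ℕ × List Bool) (b : Bool) : ℕ × List Bool :=
  let t := (bif b then c else 0) + s.1
  (t / 2, s.2 ++ [t % 2 == 1])

/-- A step of writing a number in binary. -/
def flushStep (s : ℕ × List Bool) : ℕ × List Bool :=
  bif s.1 == 0 then s else (s.1 / 2, s.2 ++ [s.1 % 2 == 1])

/-- The product of a number in binary and `c`. -/
def mulBits (c : ℕ) (l : List Bool) : List Bool :=
  (flushStep^[c] (l.foldl (mulStep c) (0, []))).2

@[fun_prop]
theorem PT.mulBits {c : α → ℕ} {l : α → List Bool} (hc : PT c) (hl : PT l) :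
    PT fun a => mulBits (c a) (l a) := by
  have h1 : PT fun p : ℕ × List Bool => p.2.foldl (mulStep p.1) (0, []) := by
    refine PT.foldl (g := fun (p : ℕ × List Bool) => mulStep p.1) (by fun_prop) (by fun_prop)
      (by unfold mulStep; fun_prop) ⟨2 * X + 10, fun a s x => ?_⟩
    obtain ⟨k, acc⟩ := s
    obtain ⟨c, l⟩ := a
    have h1 := sz_concat_le acc (((bif x then c else 0) + k) % 2 == 1)
    have h2 := sz_bool_le (((bif x then c else 0) + k) % 2 == 1)
    have h3 : (bif x then c else 0) ≤ c := by cases x <;> simp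
    have h4 := Nat.div_le_self ((bif x then c else 0) + k) 2
    simp only [mulStep, sz_pair, sz_nat, Polynomial.eval_add, Polynomial.eval_mul,
      Polynomial.eval_ofNat, Polynomial.eval_X] at *
    omega
  have h2 : PT fun p : ℕ × List Bool => (flushStep^[p.1] (p.2.foldl (mulStep p.1) (0, []))).2 := by
    refine PT.comp (G := fun s : ℕ × List Bool => s.2) (by fun_prop)
      (PT.iterate (g := fun _ => flushStep) (by fun_prop) h1 (by unfold flushStep; fun_prop)
        ⟨10, fun a s => ?_⟩)
    obtain ⟨k, acc⟩ := s
    have h1 := sz_concat_le acc (k % 2 == 1)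
    have h2 := sz_bool_le (k % 2 == 1)
    have h4 := Nat.div_le_self k 2
    unfold flushStep
    cases k == 0 <;>
      simp only [cond_true, cond_false, sz_pair, sz_nat, Polynomial.eval_ofNat] at * <;> omega
  exact PT.comp (G := fun p : ℕ × List Bool =>
    (flushStep^[p.1] (p.2.foldl (mulStep p.1) (0, []))).2) h2 (PT.prodMk hc hl)

theorem bits_of_pos {k : ℕ} (h : 0 < k) : k.bits = (k % 2 == 1) :: (k / 2).bits := by
  have h1 := Nat.div_add_mod k 2
  rcases Nat.mod_two_eq_zero_or_one k with h2 | h2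
  · rw [h2] at h1 ⊢
    conv_lhs => rw [← h1]
    exact Nat.bit0_bits _ (by omega)
  · rw [h2] at h1 ⊢
    conv_lhs => rw [← h1]
    exact Nat.bit1_bits _

theorem flushStep_iterate (n k : ℕ) (hk : k ≤ n) (acc : List Bool) :
    flushStep^[n] (k, acc) = (0, acc ++ k.bits) := by
  induction n generalizing k acc with
  | zero =>
    obtain rfl : k = 0 := by omega
    simp
  | succ n ih =>
    rw [Function.iterate_succ_apply]
    rcases Nat.eq_zero_or_pos k with rfl | h
    · rw [show flushStep (0, acc) = (0, acc) from rfl, ih 0 (by omega)]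
    · have h1 : (k == 0) = false := beq_false_of_ne h.ne'
      rw [flushStep, h1, cond_false, ih _ (by simp only; omega), bits_of_pos h]
      simp

/-- The invariant of schoolbook multiplication: the bits written so far, followed by the bits of the
carry plus `c` times the unread part, are the bits of the result. The carry stays at most `c`, since
`(c + k) / 2 ≤ c` for `k ≤ c`; this is why `c` steps suffice in `mulBits` to write it out. -/
theorem foldl_mulStep {c : ℕ} (hc : 0 < c) (N k : ℕ) (hk : k ≤ c) (acc : List Bool) :
    (N.bits.foldl (mulStep c) (k, acc)).1 ≤ c ∧
    (N.bits.foldl (mulStep c) (k, acc)).2 ++ (N.bits.foldl (mulStep c) (k, acc)).1.bits =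
      acc ++ (c * N + k).bits := by
  induction N using Nat.binaryRec' generalizing k acc with
  | zero => simpa using hk
  | bit b n h ih =>
    rw [Nat.bits_append_bit n b h, List.foldl_cons, mulStep]
    have h1 : (bif b then c else 0) ≤ c := by cases b <;> simp
    obtain ⟨h2, h3⟩ := ih (((bif b then c else 0) + k) / 2) (by omega)
      (acc ++ [((bif b then c else 0) + k) % 2 == 1])
    refine ⟨h2, h3.trans ?_⟩
    have hpos : 0 < c * Nat.bit b n := Nat.mul_pos hc (Nat.pos_of_ne_zero fun h0 => by
      rw [Nat.bit_eq_zero_iff] at h0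
      rw [h h0.1] at h0
      simp at h0)
    have e : c * Nat.bit b n + k = 2 * (c * n) + ((bif b then c else 0) + k) := by
      cases b <;> simp [Nat.bit_val] <;> ring
    rw [bits_of_pos (by omega : 0 < c * Nat.bit b n + k), e, List.append_assoc,
      List.singleton_append, Nat.mul_add_mod, Nat.mul_add_div (by norm_num)]

theorem mulBits_bits {c : ℕ} (hc : 0 < c) (N : ℕ) : mulBits c N.bits = (c * N).bits := by
  obtain ⟨h1, h2⟩ := foldl_mulStep hc N 0 (by omega) []
  rw [mulBits, show N.bits.foldl (mulStep c) (0, []) = ((N.bits.foldl (mulStep c) (0, [])).1,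
    (N.bits.foldl (mulStep c) (0, [])).2) from rfl, flushStep_iterate _ _ h1]
  simpa using h2

/-- The product of a list of numbers, in binary. -/
def prodBits (cs : List ℕ) : List Bool := cs.foldl (fun N c => mulBits c N) [true]

theorem prodBits_eq {cs : List ℕ} (h : ∀ c ∈ cs, 0 < c) : prodBits cs = cs.prod.bits := by
  have key : ∀ N : ℕ, cs.foldl (fun N c => mulBits c N) N.bits = (cs.prod * N).bits := by
    induction cs with
    | nil => intro N; simp
    | cons c cs ih =>
      intro N
      rw [List.foldl_cons, mulBits_bits (h c (by simp)), ih fun d hd => h d (by simp [hd]),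
        List.prod_cons]
      congr 1
      ring
  simpa [prodBits] using key 1

/-- Additive growth by `c` is crude but enough: the factors are represented in unary, so their sum
is bounded by the size of the list of factors. -/
theorem length_mulBits_le (c : ℕ) (l : List Bool) : (mulBits c l).length ≤ l.length + c := by
  have h1 : ∀ s : ℕ × List Bool, (l.foldl (mulStep c) s).2.length = s.2.length + l.length := by
    induction l with
    | nil => intro s; rfl
    | cons b l ih => intro s; rw [List.foldl_cons, ih]; simp [mulStep]; omega
  have h2 : ∀ (n : ℕ) (s : ℕ × List Bool), (flushStep^[n] s).2.length ≤ s.2.length + n := by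
    intro n
    induction n with
    | zero => intro s; rfl
    | succ n ih =>
      intro s
      have h3 : (flushStep s).2.length ≤ s.2.length + 1 := by
        unfold flushStep
        cases s.1 == 0 <;> simp
      have := ih (flushStep s)
      rw [Function.iterate_succ_apply]
      omega
  have := h2 c (l.foldl (mulStep c) (0, []))
  rw [h1] at this
  simpa [mulBits] using this

@[fun_prop]
theorem PT.prodBits {cs : α → List ℕ} (h : PT cs) : PT fun a => prodBits (cs a) := by
  have h1 : PT GameSym.prodBits := by
    unfold GameSym.prodBits
    refine PT.foldl_of_bound (g := fun _ N c => GameSym.mulBits c N) (by fun_prop) (by fun_prop)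
      (by fun_prop) ⟨4 * X + 5, fun cs l hl => ?_⟩
    have h2 : ∀ (l : List ℕ) (t : List Bool),
        (l.foldl (fun N c => GameSym.mulBits c N) t).length ≤ t.length + l.sum := by
      intro l
      induction l with
      | nil => intro t; simp
      | cons c l ih =>
        intro t
        have h3 := ih (GameSym.mulBits c t)
        have h4 := length_mulBits_le c t
        rw [List.foldl_cons, List.sum_cons]
        omega
    have h3 : ∀ l : List ℕ, l.sum ≤ sz l := by
      intro l
      induction l with
      | nil => simp
      | cons c l ih => rw [List.sum_cons, sz_cons, sz_nat]; omega
    have h4 : l.sum ≤ cs.sum := hl.sublist.sum_le_sum fun _ _ => Nat.zero_le _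
    have h5 := h3 cs
    have h6 := h2 l [true]
    have h7 := sz_bits_le (l.foldl (fun N c => GameSym.mulBits c N) [true])
    simp only [Polynomial.eval_add, Polynomial.eval_mul, Polynomial.eval_ofNat, Polynomial.eval_X,
      List.length_singleton] at *
    omega
  exact PT.comp h1 h

end arithmetic

end GameSym

namespace GameSym

/-! ## Permutation groups and bases -/

section permGroup

variable {α : Type} {H : Subgroup (Equiv.Perm α)} {xs ys : List α}

/-- The image of a prefix of the list `xs` under a permutation in `H`. -/
def IsPartialImage (H : Subgroup (Equiv.Perm α)) (xs ys : List α) : Prop :=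
  ∃ φ ∈ H, (xs.take ys.length).map φ = ys

theorem IsPartialImage.length_le (h : IsPartialImage H xs ys) : ys.length ≤ xs.length := by
  obtain ⟨φ, -, h⟩ := h
  have := congrArg List.length h
  rw [List.length_map, List.length_take] at this
  omega

theorem isPartialImage_take (i : ℕ) : IsPartialImage H xs (xs.take i) := by
  refine ⟨1, H.one_mem, ?_⟩
  simp

/-- Partial images of this form describe the orbit of the next base point under the pointwise
stabilizer of the previous ones. This links the oracle queries to the stabilizer chain. -/
theorem take_append_singleton_map_eq_iff {i : ℕ} (hi : i < xs.length) (y : α)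
    (φ : Equiv.Perm α) : (xs.take (xs.take i ++ [y]).length).map φ = xs.take i ++ [y] ↔
      (∀ x ∈ xs.take i, φ x = x) ∧ φ xs[i] = y := by
  have h1 : (xs.take i ++ [y]).length = i + 1 := by simp; omega
  rw [h1, List.take_succ_eq_append_getElem hi, List.map_append]
  constructor
  · intro h
    obtain ⟨h2, h3⟩ := List.append_inj' h rfl
    exact ⟨List.map_inj_left.1 (h2.trans (List.map_id _).symm), by simpa using h3⟩
  · rintro ⟨h2, h3⟩
    rw [List.map_congr_left (g := id) h2, List.map_id, List.map_singleton, h3]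

/-- The orbit-stabilizer theorem, with the stabilizer written as a subgroup of the full permutation
group so that it can replace `H` in an induction. -/
theorem card_eq_mul_card_inf_stabilizer [Finite α] (x : α) :
    Nat.card H = Nat.card {y // ∃ φ ∈ H, φ x = y} *
      Nat.card (H ⊓ MulAction.stabilizer (Equiv.Perm α) x : Subgroup (Equiv.Perm α)) := by
  have h1 := Subgroup.card_mul_index (MulAction.stabilizer H x)
  rw [MulAction.index_stabilizer] at h1
  rw [← h1, mul_comm]
  congr 1
  · refine (Nat.card_congr (Equiv.subtypeEquivRight fun y => ?_)).symm
    simp [MulAction.mem_orbit_iff, Subgroup.smul_def]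
  · exact Nat.card_congr
      { toFun := fun φ => ⟨φ.1.1, φ.1.2, φ.2⟩
        invFun := fun φ => ⟨⟨φ.1, φ.2.1⟩, φ.2.2⟩
        left_inv := fun _ => rfl
        right_inv := fun _ => rfl }

/-- The order of a permutation group is the product of the lengths of the orbits in a stabilizer
chain. -/
theorem card_eq_prod [Finite α] (h : ∀ φ ∈ H, (∀ x ∈ xs, φ x = x) → φ = 1) :
    Nat.card H = ((List.range xs.length).map fun i =>
      Nat.card {y // IsPartialImage H xs (xs.take i ++ [y])}).prod := by
  have e : ∀ (H : Subgroup (Equiv.Perm α)) (xs : List α) (i : ℕ) (hi : i < xs.length),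
      Nat.card {y // IsPartialImage H xs (xs.take i ++ [y])} =
        Nat.card {y // ∃ φ ∈ H, (∀ x ∈ xs.take i, φ x = x) ∧ φ xs[i] = y} := fun H xs i hi =>
    Nat.card_congr (Equiv.subtypeEquivRight fun y => by
      simp only [IsPartialImage, take_append_singleton_map_eq_iff hi])
  induction xs generalizing H with
  | nil =>
    obtain rfl : H = ⊥ := (Subgroup.eq_bot_iff_forall _).2 fun φ hφ => h φ hφ (by simp)
    simp
  | cons x xs ih =>
    rw [List.length_cons, List.range_succ_eq_map, List.map_cons, List.prod_cons, List.map_map,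
      card_eq_mul_card_inf_stabilizer x, e H (x :: xs) 0 (by simp)]
    congr 1
    · simp
    · rw [ih (H := H ⊓ MulAction.stabilizer (Equiv.Perm α) x) fun φ hφ hfix =>
        h φ hφ.1 (List.forall_mem_cons.2 ⟨hφ.2, hfix⟩)]
      · congr 1
        refine List.map_congr_left fun i hi => ?_
        have hi' : i < xs.length := by simpa using hi
        rw [e _ xs i hi', Function.comp_apply, e _ _ _ (by simpa using hi')]
        refine Nat.card_congr (Equiv.subtypeEquivRight fun y => exists_congr fun φ => ?_)
        simp only [Subgroup.mem_inf, MulAction.mem_stabilizer_iff, Equiv.Perm.smul_def,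
          List.take_succ_cons, List.forall_mem_cons, List.getElem_cons_succ]
        tauto

/-- Elements of a stabilizer chain that reach all points of the orbits generate the group. -/
theorem le_of_forall_isPartialImage {K : Subgroup (Equiv.Perm α)} (hKH : K ≤ H)
    (h1 : ∀ φ ∈ H, (∀ x ∈ xs, φ x = x) → φ = 1)
    (h2 : ∀ i < xs.length, ∀ y, IsPartialImage H xs (xs.take i ++ [y]) →
      ∃ ψ ∈ K, xs.take i ++ [y] <+: xs.map ψ) : H ≤ K := by
  have key : ∀ d i, i + d = xs.length → ∀ φ ∈ H, (∀ x ∈ xs.take i, φ x = x) → φ ∈ K := by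
    intro d
    induction d with
    | zero =>
      intro i hi φ hφ h
      rw [List.take_of_length_le (by omega)] at h
      rw [h1 φ hφ h]
      exact K.one_mem
    | succ d ih =>
      intro i hi φ hφ h
      have hi' : i < xs.length := by omega
      obtain ⟨ψ, hψ, hp⟩ := h2 i hi' (φ xs[i])
        ⟨φ, hφ, (take_append_singleton_map_eq_iff hi' _ φ).2 ⟨h, rfl⟩⟩
      have h3 : (xs.take (xs.take i ++ [φ xs[i]]).length).map ψ = xs.take i ++ [φ xs[i]] := by
        rw [List.map_take]
        exact (List.prefix_iff_eq_take.1 hp).symm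
      obtain ⟨h4, h5⟩ := (take_append_singleton_map_eq_iff hi' _ ψ).1 h3
      -- Sifting: `φ` and `ψ` both fix the first `i` base points and agree on the next one, so the
      -- quotient fixes one base point more.
      have h6 : ψ⁻¹ * φ ∈ K := by
        refine ih (i + 1) (by omega) _ (H.mul_mem (H.inv_mem (hKH hψ)) hφ) fun x hx => ?_
        rw [Equiv.Perm.mul_apply, Equiv.Perm.inv_eq_iff_eq]
        rw [List.take_succ_eq_append_getElem hi', List.mem_append, List.mem_singleton] at hx
        rcases hx with hx | rfl
        · rw [h x hx, h4 x hx]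
        · exact h5.symm
      simpa using K.mul_mem hψ h6
  exact fun φ hφ => key xs.length 0 (by simp) φ hφ (by simp)

open Classical in
/-- A step in extending a partial image of `xs`. -/
noncomputable def extendStep (H : Subgroup (Equiv.Perm α)) (xs ys : List α) (z : α) : List α :=
  if ys.length < xs.length ∧ IsPartialImage H xs (ys ++ [z]) then ys ++ [z] else ys

theorem isPartialImage_foldl (l : List α) (h : IsPartialImage H xs ys) :
    IsPartialImage H xs (l.foldl (extendStep H xs) ys) := by
  induction l generalizing ys with
  | nil => exact h
  | cons z l ih =>
    refine ih ?_
    unfold extendStep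
    split_ifs with h1
    · exact h1.2
    · exact h

theorem prefix_foldl_extendStep (l : List α) : ys <+: l.foldl (extendStep H xs) ys := by
  induction l generalizing ys with
  | nil => exact List.prefix_rfl
  | cons z l ih =>
    refine List.IsPrefix.trans ?_ ih
    unfold extendStep
    split_ifs
    · exact List.prefix_append _ _
    · exact List.prefix_rfl

/-- A permutation that realizes `ys` provides a point `z` by which `ys` can be extended. As `z`
occurs in `l`, a pass through `l` either reaches `z` with `ys` unchanged, and then extends it, or
has extended it before. -/
theorem length_lt_length_foldl {l : List α} (h : IsPartialImage H xs ys)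
    (hlt : ys.length < xs.length) (hl : ∀ x, x ∈ l) :
    ys.length < (l.foldl (extendStep H xs) ys).length := by
  obtain ⟨φ, hφ, hys⟩ := h
  have hz : IsPartialImage H xs (ys ++ [φ xs[ys.length]]) := by
    refine ⟨φ, hφ, ?_⟩
    rw [List.length_append, List.length_singleton, List.take_succ_eq_append_getElem hlt,
      List.map_append, hys]
    rfl
  generalize φ xs[ys.length] = z at hz
  have hzl := hl z
  clear hl
  induction l with
  | nil => simp at hzl
  | cons w l ih =>
    rw [List.foldl_cons]
    by_cases h1 : IsPartialImage H xs (ys ++ [w])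
    · rw [extendStep, if_pos ⟨hlt, h1⟩]
      have := (prefix_foldl_extendStep (H := H) (xs := xs) (ys := ys ++ [w]) l).length_le
      simp at this
      omega
    · rw [extendStep, if_neg fun h => h1 h.2]
      refine ih ((List.mem_cons.1 hzl).resolve_left ?_)
      rintro rfl
      exact h1 hz

/-- Trying all points often enough extends a partial image to a full image. -/
theorem exists_foldl_extendStep_eq {l : List α} (h : IsPartialImage H xs ys) (hl : ∀ x, x ∈ l) :
    ∃ φ ∈ H, ((List.range xs.length).flatMap fun _ => l).foldl (extendStep H xs) ys =
      xs.map φ := by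
  -- Each pass through all points adds at least one entry until the image is complete.
  have key : ∀ n, min xs.length (ys.length + n) ≤
      (((List.range n).flatMap fun _ => l).foldl (extendStep H xs) ys).length := by
    intro n
    induction n with
    | zero => simp
    | succ n ih =>
      rw [List.range_succ, List.flatMap_append, List.foldl_append]
      have h1 := isPartialImage_foldl ((List.range n).flatMap fun _ => l) h
      generalize ((List.range n).flatMap fun _ => l).foldl (extendStep H xs) ys = zs at ih h1
      simp only [List.flatMap_cons, List.flatMap_nil, List.append_nil]
      rcases Nat.lt_or_ge zs.length xs.length with h2 | h2
      · have := length_lt_length_foldl h1 h2 hl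
        omega
      · have := (prefix_foldl_extendStep (H := H) (xs := xs) (ys := zs) l).length_le
        omega
  have h1 := isPartialImage_foldl ((List.range xs.length).flatMap fun _ => l) h
  have h2 := h1.length_le
  have h3 := key xs.length
  obtain ⟨φ, hφ, h4⟩ := h1
  refine ⟨φ, hφ, ?_⟩
  rw [← h4, List.take_of_length_le (by omega)]

end permGroup

end GameSym

namespace GameSym

open Polynomial (X)

/-! ## Reductions to graph isomorphism -/

section machine

variable {α : Type} [Coded α]

/-- The oracle's answer to the question whether a symmetry of the game with data `D` maps the list
of actions `xs` to the list `ys`. -/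
def askMap (f : List Bool → List Bool) (D : List ℕ × List (List Bool)) (xs ys : List (List ℕ)) :
    Bool :=
  f (gameGraphString D xs ++ gameGraphString D ys) == [true]

theorem PTO.askMap {D : α → List ℕ × List (List Bool)} {xs ys : α → List (List ℕ)} (hD : PT D)
    (hx : PT xs) (hy : PT ys) : PTO fun f a => askMap f (D a) (xs a) (ys a) := by
  have h1 : PT fun a => gameGraphString (D a) (xs a) ++ gameGraphString (D a) (ys a) := by fun_prop
  have h2 : PT fun y : List Bool => y == [true] := by fun_prop
  exact PTO.comp (G := fun _ (y : List Bool) => y == [true]) h2 (PTO.query.comp h1)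

/-- The number of entries `true` in a list. -/
def countTrue (l : List Bool) : ℕ := (l.flatMap fun b => bif b then [()] else []).length

theorem PT.countTrue : PT countTrue := by
  unfold GameSym.countTrue; fun_prop

theorem countTrue_eq {β : Type} (l : List β) (p : β → Bool) :
    countTrue (l.map p) = (l.filter p).length := by
  induction l with
  | nil => rfl
  | cons x l ih =>
    rw [List.filter_cons]
    cases h : p x
    · simpa [countTrue, h] using ih
    · rw [List.map_cons, h, if_pos rfl, List.length_cons, ← ih]
      simp only [countTrue, List.flatMap_cons, cond_true, List.singleton_append, List.length_cons]

/-- The number of images of an action under the symmetries that fix all previous actions. -/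
def orbitCount (f : List Bool → List Bool) (D : List ℕ × List (List Bool)) (i : ℕ) : ℕ :=
  countTrue ((actionList D.1).map fun y =>
    askMap f D ((actionList D.1).take (i + 1)) ((actionList D.1).take i ++ [y]))

theorem PTO.orbitCount : PTO fun f (p : (List ℕ × List (List Bool)) × ℕ) =>
    orbitCount f p.1 p.2 := by
  have h2 : PTO fun f (p : (List ℕ × List (List Bool)) × ℕ) =>
      (actionList p.1.1).map fun y => GameSym.askMap f p.1 ((actionList p.1.1).take (p.2 + 1))
        ((actionList p.1.1).take p.2 ++ [y]) :=
    PTO.map (g := fun f (p : (List ℕ × List (List Bool)) × ℕ) y => GameSym.askMap f p.1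
      ((actionList p.1.1).take (p.2 + 1)) ((actionList p.1.1).take p.2 ++ [y])) (by fun_prop)
      (PTO.askMap (by fun_prop) (by fun_prop) (by fun_prop))
  exact PTO.comp (G := fun _ l => GameSym.countTrue l) PT.countTrue h2

/-- The number of symmetries of a game. -/
def symmetryCount (f : List Bool → List Bool) (D : List ℕ × List (List Bool)) : List Bool :=
  prodBits ((List.range (actionList D.1).length).map fun i => orbitCount f D i)

theorem PTO.symmetryCount : PTO fun f z => symmetryCount f (parse z) := by
  have h1 : PTO fun f (D : List ℕ × List (List Bool)) =>
      (List.range (actionList D.1).length).map fun i => GameSym.orbitCount f D i :=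
    PTO.map (g := fun f (D : List ℕ × List (List Bool)) i => GameSym.orbitCount f D i) (by fun_prop)
      PTO.orbitCount
  have h2 : PTO fun f (D : List ℕ × List (List Bool)) => GameSym.symmetryCount f D :=
    PTO.comp (G := fun _ l => GameSym.prodBits l) (by fun_prop : PT fun l => GameSym.prodBits l) h1
  exact PTO.comp (F := fun _ z => GameSym.parse z) h2 (by fun_prop : PT fun z => GameSym.parse z)

/-- A step in extending the list `ys` of images of actions to the images of all actions in `A`. -/
def askStep (f : List Bool → List Bool) (D : List ℕ × List (List Bool)) (A ys : List (List ℕ))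
    (z : List ℕ) : List (List ℕ) :=
  bif Nat.blt ys.length A.length && askMap f D (A.take (ys.length + 1)) (ys ++ [z]) then
    ys ++ [z] else ys

/-- The images of all actions under a symmetry that fixes the first `i` actions, and maps the next
one to `y` if possible. -/
def extend (f : List Bool → List Bool) (D : List ℕ × List (List Bool)) (p : ℕ × List ℕ) :
    List (List ℕ) :=
  (p.2 :: (List.range (actionList D.1).length).flatMap fun _ => actionList D.1).foldl
    (askStep f D (actionList D.1)) ((actionList D.1).take p.1)

theorem PTO.bif_and {β : Type} [Coded β] {b : α → Bool} {c : (List Bool → List Bool) → α → Bool}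
    {F G : α → β} (hb : PT b) (hc : PTO c) (hF : PT F) (hG : PT G) :
    PTO fun f a => bif b a && c f a then F a else G a := by
  have h1 : PT fun q : α × Bool => bif b q.1 && q.2 then F q.1 else G q.1 := by fun_prop
  exact PTO.comp (G := fun _ (q : α × Bool) => bif b q.1 && q.2 then F q.1 else G q.1) h1
    (PTO.prodMk PT.id hc)

theorem PTO.extend : PTO fun f (p : (List ℕ × List (List Bool)) × ℕ × List ℕ) =>
    extend f p.1 p.2 := by
  unfold GameSym.extend
  refine PTO.foldl (g := fun f (p : (List ℕ × List (List Bool)) × ℕ × List ℕ) =>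
    askStep f p.1 (actionList p.1.1)) (by fun_prop) (by fun_prop) ?_ fun r =>
      ⟨X + 2, fun f _ a s x => ?_⟩
  · have h1 : PTO fun f (q : ((List ℕ × List (List Bool)) × ℕ × List ℕ) ×
        List (List ℕ) × List ℕ) => GameSym.askMap f q.1.1
          ((actionList q.1.1.1).take (q.2.1.length + 1)) (q.2.1 ++ [q.2.2]) :=
      PTO.askMap (by fun_prop) (by fun_prop) (by fun_prop)
    exact PTO.bif_and (by fun_prop) h1 (by fun_prop) (by fun_prop)
  · have h1 := sz_concat_le s x
    unfold askStep
    cases Nat.blt s.length (actionList a.1.1).length &&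
      GameSym.askMap f a.1 ((actionList a.1.1).take (s.length + 1)) (s ++ [x]) <;>
    simp only [cond_true, cond_false, sz_pair, Polynomial.eval_add, Polynomial.eval_X,
      Polynomial.eval_ofNat] <;> omega

/-- The code of a list of symmetries that are given by the codes of the images of all actions. -/
def tables (l : List (List (List ℕ))) : List Bool :=
  (l.flatMap fun ys => true :: ys.flatMap fun y =>
    encUnary (y.getD 1 0) ++ encUnary (y.getD 2 0)) ++ [false]

/-- The tables of symmetries that generate the symmetry group of a game. -/
def symmetryTables (f : List Bool → List Bool) (D : List ℕ × List (List Bool)) : List Bool :=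
  tables (((List.range (actionList D.1).length).flatMap fun i =>
    (actionList D.1).map fun y => (i, y)).map fun p => extend f D p)

theorem PTO.symmetryTables : PTO fun f z => symmetryTables f (parse z) := by
  have h1 : PTO fun f (D : List ℕ × List (List Bool)) =>
      ((List.range (actionList D.1).length).flatMap fun i =>
        (actionList D.1).map fun y => (i, y)).map fun p => GameSym.extend f D p :=
    PTO.map (g := fun f (D : List ℕ × List (List Bool)) p => GameSym.extend f D p) (by fun_prop)
      PTO.extend
  have h2 : PTO fun f (D : List ℕ × List (List Bool)) => GameSym.symmetryTables f D :=
    PTO.comp (G := fun _ l => tables l)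
      (by unfold tables; fun_prop : PT fun l => tables l) h1
  exact PTO.comp (F := fun _ z => GameSym.parse z) h2 (by fun_prop : PT fun z => GameSym.parse z)

end machine

namespace Game

variable {Γ : Game} {f : List Bool → List Bool}

theorem askMap_eq (hf : graphIsomorphism.SolvedBy f) {ys : List Γ.Action}
    (hlen : ys.length ≤ Γ.actions.length) :
    askMap f Γ.table ((Γ.actions.map actionCode).take ys.length) (ys.map actionCode) = true ↔
      IsPartialImage Γ.symmetryGroup Γ.actions ys := by
  rw [← List.map_take]
  exact solvedBy_graphIsomorphism hf (nodup_actions.sublist (List.take_sublist _ _)) (by simpa)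

theorem actionList_table : actionList Γ.table.1 = Γ.actions.map actionCode := actionList_ofFn

/-- Each action occurs once in the list of actions, so counting the positive answers counts the
points of the orbit. -/
theorem orbitCount_eq (hf : graphIsomorphism.SolvedBy f) {i : ℕ} (hi : i < Γ.actions.length) :
    orbitCount f Γ.table i =
      Nat.card {y // IsPartialImage Γ.symmetryGroup Γ.actions (Γ.actions.take i ++ [y])} := by
  classical
  have h1 : ∀ y, (Γ.actions.take i ++ [y]).length = i + 1 := fun y => by simp; omega
  have h2 : ∀ y, askMap f Γ.table ((Γ.actions.map actionCode).take (i + 1))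
      ((Γ.actions.map actionCode).take i ++ [actionCode y]) =
      decide (IsPartialImage Γ.symmetryGroup Γ.actions (Γ.actions.take i ++ [y])) := fun y => by
    rw [Bool.eq_iff_iff, decide_eq_true_iff, ← askMap_eq hf (by rw [h1]; omega), h1]
    simp
  rw [orbitCount, actionList_table, List.map_map]
  simp only [Function.comp_def, h2]
  rw [countTrue_eq, ← List.toFinset_card_of_nodup (nodup_actions.filter _)]
  rw [← Fintype.card_coe, ← Nat.card_eq_fintype_card]
  refine Nat.card_congr (Equiv.subtypeEquivRight fun y => ?_)
  simp [mem_actions]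

theorem eq_one_of_fix_actions (φ : Equiv.Perm Γ.Action) (h : ∀ x ∈ Γ.actions, φ x = x) : φ = 1 :=
  Equiv.ext fun x => h x (mem_actions x)

theorem symmetryCount_eq (hf : graphIsomorphism.SolvedBy f) :
    symmetryCount f Γ.table = (Nat.card Γ.symmetryGroup).bits := by
  have h1 : (List.range (actionList Γ.table.1).length).map (fun i => orbitCount f Γ.table i) =
      (List.range Γ.actions.length).map fun i =>
        Nat.card {y // IsPartialImage Γ.symmetryGroup Γ.actions (Γ.actions.take i ++ [y])} := by
    rw [actionList_table, List.length_map]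
    exact List.map_congr_left fun i hi => orbitCount_eq hf (by simpa using hi)
  rw [symmetryCount, h1, card_eq_prod fun φ _ => eq_one_of_fix_actions φ, prodBits_eq]
  intro c hc
  obtain ⟨i, hi, rfl⟩ := List.mem_map.1 hc
  have hi' : i < Γ.actions.length := by simpa using hi
  -- The identity shows that no orbit is empty; positive factors are needed for the binary product.
  have : Nonempty {y // IsPartialImage Γ.symmetryGroup Γ.actions (Γ.actions.take i ++ [y])} :=
    ⟨⟨Γ.actions[i], by
      rw [← List.take_succ_eq_append_getElem hi']; exact isPartialImage_take _⟩⟩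
  exact Nat.card_pos

/-- The greedy search on codes simulates the abstract one. The comparison of lengths in `askStep`
ensures that an answer counts only for lists of equal length, the case covered by `askMap_eq`. -/
theorem foldl_askStep (hf : graphIsomorphism.SolvedBy f) (l ys : List Γ.Action) :
    (l.map actionCode).foldl (askStep f Γ.table (Γ.actions.map actionCode)) (ys.map actionCode) =
      (l.foldl (extendStep Γ.symmetryGroup Γ.actions) ys).map actionCode := by
  induction l generalizing ys with
  | nil => rfl
  | cons z l ih =>
    rw [List.map_cons, List.foldl_cons, List.foldl_cons, ← ih]
    congr 1
    unfold askStep extendStep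
    rw [List.length_map, List.length_map]
    split_ifs with h
    · have h1 := (askMap_eq hf (ys := ys ++ [z]) (by simp; omega)).2 h.2
      rw [List.length_append, List.length_singleton, List.map_append, List.map_singleton] at h1
      have h2 : Nat.blt ys.length Γ.actions.length = true := by rw [Nat.blt_eq]; exact h.1
      rw [h1, h2]
      simp
    · rw [Bool.cond_eq_ite, if_neg]
      rw [Bool.and_eq_true, Nat.blt_eq]
      rintro ⟨h1, h2⟩
      refine h ⟨h1, (askMap_eq hf (by simp; omega)).1 ?_⟩
      simpa using h2

/-- The point `y` is tried before all others, so it is taken as the next image whenever that is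
possible. If not, the search continues from the identity on the first actions and still ends with a
symmetry, which is a redundant but harmless generator. -/
theorem exists_extend_eq (hf : graphIsomorphism.SolvedBy f) (i : ℕ) (y : Γ.Action) :
    ∃ φ ∈ Γ.symmetryGroup, extend f Γ.table (i, actionCode y) =
        (Γ.actions.map φ).map actionCode ∧
      (i < Γ.actions.length →
        IsPartialImage Γ.symmetryGroup Γ.actions (Γ.actions.take i ++ [y]) →
        Γ.actions.take i ++ [y] <+: Γ.actions.map φ) := by
  set ys := extendStep Γ.symmetryGroup Γ.actions (Γ.actions.take i) y with hys
  have h1 : IsPartialImage Γ.symmetryGroup Γ.actions ys :=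
    isPartialImage_foldl [y] (isPartialImage_take i)
  obtain ⟨φ, hφ, h2⟩ := exists_foldl_extendStep_eq h1 mem_actions
  refine ⟨φ, hφ, ?_, fun hi h => ?_⟩
  · have h3 := foldl_askStep hf (y :: (List.range Γ.actions.length).flatMap fun _ => Γ.actions)
      (Γ.actions.take i)
    rw [List.foldl_cons, ← hys, h2, List.map_cons, List.map_flatMap, List.map_take] at h3
    rw [extend, actionList_table, List.length_map]
    exact h3
  · rw [← h2]
    refine List.IsPrefix.trans ?_ (prefix_foldl_extendStep _)
    rw [hys, extendStep, if_pos ⟨by simpa using hi, h⟩]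

theorem encPerm_eq (φ : Equiv.Perm Γ.Action) :
    encPerm φ = (Γ.actions.map φ).flatMap encAction := by
  simp [encPerm, actions, List.flatMap_map, List.flatMap_assoc, List.map_flatMap]

theorem tables_eq (L : List (Equiv.Perm Γ.Action)) :
    tables (L.map fun φ : Equiv.Perm Γ.Action => (Γ.actions.map φ).map actionCode) = encList encPerm L := by
  rw [tables, encList, List.flatMap_map]
  congr 2
  funext φ
  rw [encPerm_eq, List.flatMap_map]
  rfl

theorem symmetryTables_eq (hf : graphIsomorphism.SolvedBy f) :
    ∃ L : List (Equiv.Perm Γ.Action), Subgroup.closure {φ | φ ∈ L} = Γ.symmetryGroup ∧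
      symmetryTables f Γ.table = encList encPerm L := by
  choose φ h1 h2 h3 using exists_extend_eq (Γ := Γ) hf
  let L := (List.range Γ.actions.length).flatMap fun i => Γ.actions.map fun y => φ i y
  have hL : ∀ i < Γ.actions.length, ∀ y, φ i y ∈ L := fun i hi y =>
    List.mem_flatMap.2 ⟨i, by simpa, List.mem_map.2 ⟨y, mem_actions y, rfl⟩⟩
  have hle : Subgroup.closure {φ | φ ∈ L} ≤ Γ.symmetryGroup := by
    rw [Subgroup.closure_le]
    intro ψ hψ
    obtain ⟨i, -, hi⟩ := List.mem_flatMap.1 hψ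
    obtain ⟨y, -, rfl⟩ := List.mem_map.1 hi
    exact h1 i y
  refine ⟨L, le_antisymm hle ?_, ?_⟩
  · exact le_of_forall_isPartialImage hle (fun φ _ => eq_one_of_fix_actions φ) fun i hi y hy =>
      ⟨φ i y, Subgroup.subset_closure (hL i hi y), h3 i y hi hy⟩
  · rw [← tables_eq, symmetryTables, actionList_table, List.length_map]
    congr 1
    simp only [L, List.map_flatMap, List.map_map]
    congr 1
    funext i
    refine List.map_congr_left fun y _ => ?_
    simpa using h2 i y

end Game

/-- Counting symmetries reduces to graph isomorphism. -/
theorem symmetryCounting_reducible_graphIsomorphism :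
    TuringReducible symmetryCounting graphIsomorphism := by
  refine TuringReducible.of_pto
    (fun f x => (fun f z => symmetryCount f (parse z)) f (symmetryCounting.encode x)) ?_ ?_
  · let _ := symmetryCounting.coded
    have h0 : PT symmetryCounting.encode := .of_bits_eq fun _ => rfl
    exact PTO.comp (G := fun f z => symmetryCount f (parse z)) PTO.symmetryCount h0
  · intro f hf (Γ : Game)
    show symmetryCount f (parse (encGame Γ)) = (Nat.card Γ.symmetryGroup).bits
    rw [Γ.parse_encGame, Game.symmetryCount_eq hf]

/-- Computing generators of the symmetry group reduces to graph isomorphism. -/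
theorem symmetryGenerators_reducible_graphIsomorphism :
    TuringReducible symmetryGenerators graphIsomorphism := by
  refine TuringReducible.of_pto
    (fun f x => (fun f z => symmetryTables f (parse z)) f (symmetryGenerators.encode x)) ?_ ?_
  · let _ := symmetryGenerators.coded
    have h0 : PT symmetryGenerators.encode := .of_bits_eq fun _ => rfl
    exact PTO.comp (G := fun f z => symmetryTables f (parse z)) PTO.symmetryTables h0
  · intro f hf (Γ : Game)
    show ∃ L : List (Equiv.Perm Γ.Action), Subgroup.closure {φ | φ ∈ L} = Γ.symmetryGroup ∧
      symmetryTables f (parse (encGame Γ)) = encList encPerm L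
    rw [Γ.parse_encGame]
    exact Game.symmetryTables_eq hf

end GameSym

/-! ### The reductions and the two group isomorphisms combined -/

theorem mainTheorem3 :
    (GameSym.TuringEquivalent GameSym.symmetryCounting GameSym.graphIsomorphism ∧
      GameSym.TuringEquivalent GameSym.symmetryGenerators GameSym.graphIsomorphism) ∧
    (∀ (Γ : GameSym.Game) (lam lam' : ℕ), lam ≠ lam' →
      (∀ i a, Γ.u i a ≠ lam ∧ Γ.u i a ≠ lam') →
      ∃ M : Γ.symmetryGroup ≃* (Γ.labeledGraph lam lam').autGroup,
        ∀ φ : Γ.symmetryGroup,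
          (∀ x : Γ.Action, (M φ).1 (.player x.1) = .player (φ.1 x).1) ∧
          (∀ x : Γ.Action, (M φ).1 (.action x) = .action (φ.1 x)) ∧
          (∀ a b : Γ.Profile, GameSym.Game.MapsProfile φ.1 a b →
            (M φ).1 (.profile a) = .profile b)) ∧
    (∀ (n : ℕ) (hn : 0 < n) (G : SimpleGraph (Fin n)) (c d : Fin 4 → ℚ),
      Function.Injective c → Function.Injective d →
      ∃ M : (G ≃g G) ≃* (GameSym.graphGame hn G c d).symmetryGroup,
        ∀ ψ : G ≃g G,
          (∀ v : Fin n,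
            (M ψ).1 (GameSym.graphGame.fst v) = GameSym.graphGame.fst (ψ v) ∧
            (M ψ).1 (GameSym.graphGame.snd v.castSucc) =
              GameSym.graphGame.snd (ψ v).castSucc) ∧
          (M ψ).1 (GameSym.graphGame.snd (Fin.last n)) =
            GameSym.graphGame.snd (Fin.last n)) := by
  refine ⟨⟨⟨GameSym.symmetryCounting_reducible_graphIsomorphism,
    GameSym.graphIsomorphism_reducible_symmetryCounting⟩,
    ⟨GameSym.symmetryGenerators_reducible_graphIsomorphism,
    GameSym.graphIsomorphism_reducible_symmetryGenerators⟩⟩, ?_, ?_⟩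
  · exact fun Γ lam lam' h hu => GameSym.Game.exists_symmetryGroup_mulEquiv_autGroup h hu
  · exact fun n hn G c d hc _ => GameSym.graphGame.exists_mulEquiv_symmetryGroup hc
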